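/- **Theorem.** For a finite simple graph $G$ and a positive integer $k$, let $R(G,k,k+1)$ be the graph whose nodes are the dominating sets $D$ of $G$ with $k\le |D|\le k+1$, two of them being adjacent if and only if their symmetric difference consists of exactly one vertex. A *reconfiguration sequence* from $D_s$ to $D_t$ is a walk from $D_s$ to $D_t$ in $R(G,k,k+1)$; its length is the number of its steps. *Dominating Set Reconfiguration* (DSR) takes as input a graph $G$, a positive integer $k$ and two dominating sets $D_s, D_t$ of $G$ with $|D_s|=|D_t|=k$, and asks whether there is a reconfiguration sequence from $D_s$ to $D_t$. DSR parameterized by $k+d$ is fixed-parameter tractable on graphs that exclude $K_{d,d}$, $d\ge 1$, as a (not necessarily induced) subgraph: there are a single algorithm, a function $f:\mathbb N\to\mathbb N$ and a constant $c$ such that, for all $k,d\ge 1$ and every input $(G,k,d,D_s,D_t)$ of this kind with $G$ not containing $K_{d,d}$ as a subgraph, the algorithm decides DSR within $f(k+d)\cdot N^{c}$ steps, where $N$ is the length of the input. Shortest sequences can also be found in such time: there is an algorithm with a running time of the same form that on these inputs outputs a shortest reconfiguration sequence from $D_s$ to $D_t$ if there is one, and reports that there is none otherwise. Moreover, for every such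 input there is a vertex set $W\subseteq V(G)$ with $D_s\cup D_t\subseteq W$ and $$|W|\le dk^d+2k+2d\,(3dk^d)^{2d}$$ such that every dominating set of $G[W]$ of size $k$ or $k+1$ is a dominating set of $G$, and the distance (possibly infinite) between $D_s$ and $D_t$ in $R(G[W],k,k+1)$ equals their distance in $R(G,k,k+1)$. In particular, shortest reconfiguration sequences in $G[W]$ are shortest reconfiguration sequences in $G$. -/

import Mathlib

/-- `D` is a dominating set of `G`: every vertex lies in `D` or has a neighbour in `D`. -/
def IsDominating {V : Type*} (G : SimpleGraph V) (D : Finset V) : Prop :=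
  ∀ v : V, v ∈ D ∨ ∃ u ∈ D, G.Adj u v

/-- The nodes of the reconfiguration graph `R(G, k, k+1)`: the dominating sets of `G` of size
`k` or `k + 1`. -/
abbrev DSNode {V : Type*} (G : SimpleGraph V) (k : ℕ) : Type _ :=
  {D : Finset V // IsDominating G D ∧ k ≤ D.card ∧ D.card ≤ k + 1}

open Classical in
/-- The reconfiguration graph `R(G, k, k+1)`: two nodes are adjacent if and only if their
symmetric difference consists of exactly one vertex. A reconfiguration sequence is a walk in
this graph, and its length is the length of the walk. -/
def reconfGraph {V : Type*} (G : SimpleGraph V) (k : ℕ) : SimpleGraph (DSNode G k) where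
  Adj A B := (symmDiff A.1 B.1).card = 1
  symm := ⟨fun A B h => by rw [symmDiff_comm]; exact h⟩
  loopless := ⟨fun A h => by simp at h⟩

/-- An instance of Dominating Set Reconfiguration: a finite graph `G`, a positive integer `k` and
two dominating sets of `G` of size `k`. -/
structure DSRInstance where
  n : ℕ
  G : SimpleGraph (Fin n)
  k : ℕ
  k_pos : 0 < k
  Ds : Finset (Fin n)
  Dt : Finset (Fin n)
  Ds_dominating : IsDominating G Ds
  Dt_dominating : IsDominating G Dt
  Ds_card : Ds.card = k
  Dt_card : Dt.card = k

namespace DSRInstance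

/-- The source as a node of the reconfiguration graph. -/
def source (x : DSRInstance) : DSNode x.G x.k :=
  ⟨x.Ds, x.Ds_dominating, x.Ds_card.ge, x.Ds_card.le.trans (Nat.le_succ _)⟩

/-- The target as a node of the reconfiguration graph. -/
def target (x : DSRInstance) : DSNode x.G x.k :=
  ⟨x.Dt, x.Dt_dominating, x.Dt_card.ge, x.Dt_card.le.trans (Nat.le_succ _)⟩

/-- The question of the problem: is there a path from the source to the target in
`R(G, k, k+1)`? -/
def IsYes (x : DSRInstance) : Prop := (reconfGraph x.G x.k).Reachable x.source x.target

end DSRInstance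

/-- An instance of Dominating Set Reconfiguration together with an integer `d > 0` such that the
graph does not contain `K_{d,d}` as a (not necessarily induced) subgraph. -/
structure BicliqueFreeDSR extends DSRInstance where
  d : ℕ
  d_pos : 0 < d
  free : (completeBipartiteGraph (Fin d) (Fin d)).Free G

/-! ### The machine model

Random access machine with finitely many registers and finitely many arrays holding natural
numbers (only those mentioned in the program are ever used), programmed in a structured way. The
arithmetic operations are addition and truncated subtraction (there is no multiplication), so that
counting each operation as one step is polynomially equivalent to Turing machine time. -/

/-- Expressions; `arr a i` reads cell `i` of the array named `a`. -/
inductive RamExpr : Type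
  | const (c : ℕ)
  | var (x : ℕ)
  | arr (a : ℕ) (i : RamExpr)
  | add (e₁ e₂ : RamExpr)
  | sub (e₁ e₂ : RamExpr)

/-- The contents of the registers and of the arrays. -/
structure RamState where
  reg : ℕ → ℕ
  mem : ℕ → ℕ → ℕ

namespace RamExpr

/-- The value of an expression in a state. -/
def eval (s : RamState) : RamExpr → ℕ
  | const c => c
  | var x => s.reg x
  | arr a i => s.mem a (i.eval s)
  | add e₁ e₂ => e₁.eval s + e₂.eval s
  | sub e₁ e₂ => e₁.eval s - e₂.eval s

/-- The number of steps that the evaluation of an expression takes: one for each operation. -/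
def cost : RamExpr → ℕ
  | const _ => 1
  | var _ => 1
  | arr _ i => i.cost + 1
  | add e₁ e₂ => e₁.cost + e₂.cost + 1
  | sub e₁ e₂ => e₁.cost + e₂.cost + 1

end RamExpr

/-- Programs. -/
inductive RamProg : Type
  | skip
  | assign (x : ℕ) (e : RamExpr)
  | store (a : ℕ) (i e : RamExpr)
  | seq (p q : RamProg)
  | ite (e : RamExpr) (p q : RamProg)
  | loop (e : RamExpr) (p : RamProg)

/-- `Exec p s t s'`: the program `p`, started in the state `s`, halts after exactly `t` steps in
the state `s'`. Here `ite e p q` runs `p` if the value of `e` is nonzero and `q` otherwise, and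
`loop e p` repeats `p` as long as the value of `e` is nonzero. -/
inductive Exec : RamProg → RamState → ℕ → RamState → Prop
  | skip (s : RamState) : Exec RamProg.skip s 1 s
  | assign (s : RamState) (x : ℕ) (e : RamExpr) :
      Exec (RamProg.assign x e) s (e.cost + 1) ⟨Function.update s.reg x (e.eval s), s.mem⟩
  | store (s : RamState) (a : ℕ) (i e : RamExpr) :
      Exec (RamProg.store a i e) s (i.cost + e.cost + 1)
        ⟨s.reg, Function.update s.mem a (Function.update (s.mem a) (i.eval s) (e.eval s))⟩
  | seq {p q : RamProg} {s s' s'' : RamState} {t t' : ℕ} (h : Exec p s t s')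
      (h' : Exec q s' t' s'') : Exec (RamProg.seq p q) s (t + t') s''
  | ite_true {e : RamExpr} {p q : RamProg} {s s' : RamState} {t : ℕ} (he : e.eval s ≠ 0)
      (h : Exec p s t s') : Exec (RamProg.ite e p q) s (e.cost + 1 + t) s'
  | ite_false {e : RamExpr} {p q : RamProg} {s s' : RamState} {t : ℕ} (he : e.eval s = 0)
      (h : Exec q s t s') : Exec (RamProg.ite e p q) s (e.cost + 1 + t) s'
  | loop_exit {e : RamExpr} {p : RamProg} {s : RamState} (he : e.eval s = 0) :
      Exec (RamProg.loop e p) s (e.cost + 1) s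
  | loop_step {e : RamExpr} {p : RamProg} {s s' s'' : RamState} {t t' : ℕ} (he : e.eval s ≠ 0)
      (h : Exec p s t s') (h' : Exec (RamProg.loop e p) s' t' s'') :
      Exec (RamProg.loop e p) s (e.cost + 1 + t + t') s''

/-- The machine is deterministic: running time and final state are determined by the program and
the initial state. -/
theorem Exec.det {p : RamProg} {s s₁ s₂ : RamState} {t₁ t₂ : ℕ} (h₁ : Exec p s t₁ s₁)
    (h₂ : Exec p s t₂ s₂) : t₁ = t₂ ∧ s₁ = s₂ := by
  induction h₁ generalizing t₂ s₂ with
  | skip => cases h₂; exact ⟨rfl, rfl⟩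
  | assign => cases h₂; exact ⟨rfl, rfl⟩
  | store => cases h₂; exact ⟨rfl, rfl⟩
  | seq _ _ ih ih' =>
    cases h₂ with
    | seq a b =>
      obtain ⟨rfl, rfl⟩ := ih a
      obtain ⟨rfl, rfl⟩ := ih' b
      exact ⟨rfl, rfl⟩
  | ite_true he _ ih =>
    cases h₂ with
    | ite_true _ a => obtain ⟨rfl, rfl⟩ := ih a; exact ⟨rfl, rfl⟩
    | ite_false he' _ => exact absurd he' he
  | ite_false he _ ih =>
    cases h₂ with
    | ite_true he' _ => exact absurd he he'
    | ite_false _ a => obtain ⟨rfl, rfl⟩ := ih a; exact ⟨rfl, rfl⟩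
  | loop_exit he =>
    cases h₂ with
    | loop_exit => exact ⟨rfl, rfl⟩
    | loop_step he' _ _ => exact absurd he he'
  | loop_step he _ _ ih ih' =>
    cases h₂ with
    | loop_exit he' => exact absurd he' he
    | loop_step _ a b =>
      obtain ⟨rfl, rfl⟩ := ih a
      obtain ⟨rfl, rfl⟩ := ih' b
      exact ⟨rfl, rfl⟩

/-- The initial state on an input word: the word is written in array `0`, its length in register
`0`, and everything else is zero. -/
def initState (w : List ℕ) : RamState where
  reg := fun x => if x = 0 then w.length else 0
  mem := fun a i => if a = 0 then w.getD i 0 else 0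

/-- The output of a final state: the first `ℓ` cells of array `1`, where `ℓ` is the content of
register `0`. -/
def outputOf (s : RamState) : List ℕ := (List.range (s.reg 0)).map (s.mem 1)

/-- On input `w` the program `p` halts after exactly `t` steps with output `out`. -/
def Computes (p : RamProg) (w : List ℕ) (t : ℕ) (out : List ℕ) : Prop :=
  ∃ s, Exec p (initState w) t s ∧ outputOf s = out

/-- A parameterized problem with instances `ι`, encoded by words over the natural numbers, and
with parameter `param`, whose admissible outputs are described by `Sol`, is fixed-parameter
tractable: a single program produces on each instance `x` an admissible output within
`f (param x) * |x| ^ c` steps, where `f` is some function and `c` a constant. -/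
def FPTSolvable {ι : Type} (encode : ι → List ℕ) (param : ι → ℕ) (Sol : ι → List ℕ → Prop) :
    Prop :=
  ∃ (p : RamProg) (f : ℕ → ℕ) (c : ℕ), ∀ x : ι, ∃ (t : ℕ) (out : List ℕ),
    Computes p (encode x) t out ∧ t ≤ f (param x) * (encode x).length ^ c ∧ Sol x out

/-- Fixed-parameter tractability of a decision problem: output `1` on the yes-instances and `0` on
the no-instances. -/
def FPTDecidable {ι : Type} (encode : ι → List ℕ) (param : ι → ℕ) (Yes : ι → Prop) : Prop :=
  FPTSolvable encode param fun x out => (Yes x ∧ out = [1]) ∨ (¬ Yes x ∧ out = [0])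

/-! ### Encodings -/

/-- A set of vertices as a 0-1 word of length `n`. -/
def encodeSet {n : ℕ} (S : Finset (Fin n)) : List ℕ :=
  List.ofFn fun v : Fin n => if v ∈ S then 1 else 0

open Classical in
/-- The adjacency matrix, row by row. -/
noncomputable def encodeGraph {n : ℕ} (G : SimpleGraph (Fin n)) : List ℕ :=
  (List.finRange n).flatMap fun u => List.ofFn fun v : Fin n => if G.Adj u v then 1 else 0

namespace BicliqueFreeDSR

/-- The input word: `n`, `k`, `d`, the adjacency matrix, the source and the target. -/
noncomputable def encode (x : BicliqueFreeDSR) : List ℕ :=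
  [x.n, x.k, x.d] ++ encodeGraph x.G ++ encodeSet x.Ds ++ encodeSet x.Dt

/-- The parameter `k + d`. -/
def param (x : BicliqueFreeDSR) : ℕ := x.k + x.d

/-- The admissible outputs of the search version: `0` if there is no reconfiguration sequence, and
otherwise `1` followed by the sets of a shortest reconfiguration sequence. -/
def IsShortestSolution (x : BicliqueFreeDSR) (out : List ℕ) : Prop :=
  (¬ x.IsYes ∧ out = [0]) ∨
    ∃ w : (reconfGraph x.G x.k).Walk x.source x.target,
      (∀ w' : (reconfGraph x.G x.k).Walk x.source x.target, w.length ≤ w'.length) ∧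
        out = 1 :: w.support.flatMap fun D => encodeSet D.1

/-- `W` induces a reduced instance: it contains the source and the target, every set of `k` or
`k + 1` vertices of `G[W]` that dominates `G[W]` dominates `G` (so that reconfiguration sequences
in `G[W]` are reconfiguration sequences in `G`), and the distance of source and target (infinite
if there is no path) is the same in the reconfiguration graphs of `G[W]` and of `G` (so that
shortest reconfiguration sequences in `G[W]` are shortest in `G`). -/
def IsReduction (x : BicliqueFreeDSR) (W : Finset (Fin x.n)) : Prop :=
  (∀ D : DSNode (x.G.induce (W : Set (Fin x.n))) x.k,
      IsDominating x.G (D.1.map (Function.Embedding.subtype _))) ∧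
    ∃ S T : DSNode (x.G.induce (W : Set (Fin x.n))) x.k,
      S.1.map (Function.Embedding.subtype _) = x.Ds ∧
      T.1.map (Function.Embedding.subtype _) = x.Dt ∧
      (reconfGraph (x.G.induce (W : Set (Fin x.n))) x.k).edist S T =
        (reconfGraph x.G x.k).edist x.source x.target

end BicliqueFreeDSR

/-! Call `C` a domination core if every set of at most `k + 1` vertices that dominates `C` dominates
`G`. Excluding `K_{d,d}` forces small cores to exist. Inside a core `C`, keep `A ⊆ C` and a set `U`
of vertices each of which dominates all of `A`, beginning with `A = C` and `U = ∅`. If every vertex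
outside `U` dominates only a small share of `A` (less than about one part in `k + 1`), then `k + 1`
vertices avoiding `U` cannot dominate `A` minus a vertex, while a set meeting `U` dominates all of
`A`; so any vertex of `A` can be dropped from the core (`IsCore.erase`). Otherwise a vertex
dominating a large share joins `U`, and `A` shrinks by a factor of about `k + 1`. After `d` rounds
without removal, `A` has at most one vertex or `U` has `d`, so `A` has fewer than `2d` vertices, and
`C` has fewer than `2d (k+1)^d` (`exists_core`).

Relative to a core, a vertex matters only through its trace, the part of `C` that it dominates. With
`S = D_s ∪ D_t`, a kernel `W` contains `C`, `S` and, for each omitted vertex, at least `k + 1`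
vertices of the same trace outside `C ∪ S`. A reconfiguration sequence of `G` is copied into `W`
step by step; the copy agrees with the original on `S` and has equally many vertices of each trace
outside `S`. A set that receives a vertex has at most `k` elements, so a suitable vertex of `W` is
still free (`TraceEquiv.exists_insert`). The length is unchanged, and the ends lie in `S`, hence are
unchanged too (`reach_kernel_iff`). The size of `W` is bounded by counting traces: small traces are
few, and `d` vertices of `C` have fewer than `d` common neighbours (`card_kernel_le`). This gives
the stated bound for `k, d ≥ 2`; the cases `k = 1` and `d = 1` are direct.

For the algorithm, greedy versions of both constructions run in polynomial time. The size of `W` is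
bounded in terms of `k + d`, so its subsets can be coded by the numbers below `2 ^ |W|`, and a
breadth-first search from `D_t` with stored parents yields a shortest sequence (`run_solve`). The
decision program keeps only the first cell of that output. -/

/-! ### Domination cores in graphs without `K_{d,d}`. -/

section Combinatorics

open Finset
open scoped Classical

variable {V : Type*}

/-- Closed adjacency: equal or adjacent. -/
def CAdj (G : SimpleGraph V) (u v : V) : Prop := u = v ∨ G.Adj u v

theorem isDominating_iff {G : SimpleGraph V} {D : Finset V} :
    IsDominating G D ↔ ∀ v, ∃ u ∈ D, CAdj G u v := by
  refine forall_congr' fun v => ⟨?_, ?_⟩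
  · rintro (h | ⟨u, hu, h⟩)
    · exact ⟨v, h, Or.inl rfl⟩
    · exact ⟨u, hu, Or.inr h⟩
  · rintro ⟨u, hu, rfl | h⟩
    · exact Or.inl hu
    · exact Or.inr ⟨u, hu, h⟩

/-- `D` dominates all vertices of `C`. -/
def Dominates (G : SimpleGraph V) (D C : Finset V) : Prop := ∀ c ∈ C, ∃ u ∈ D, CAdj G u c

/-- A domination core for sets of at most `q` vertices. -/
def IsCore (G : SimpleGraph V) (q : ℕ) (C : Finset V) : Prop :=
  ∀ D : Finset V, D.card ≤ q → Dominates G D C → IsDominating G D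

theorem isCore_univ [Fintype V] (G : SimpleGraph V) (q : ℕ) : IsCore G q univ :=
  fun _ _ h => isDominating_iff.2 fun v => h v (mem_univ v)

/-- A set `D` that meets `U` dominates `c` anyway. If it avoids `U`, its at most `q` vertices
dominate at most `b * q` elements of `A`, too few for `A.erase c`. -/
theorem IsCore.erase [DecidableEq V] {G : SimpleGraph V} {q b : ℕ} {C A U : Finset V} (hC : IsCore G q C)
    (hAC : A ⊆ C) (hU : ∀ u ∈ U, ∀ a ∈ A, CAdj G u a)
    (hb : ∀ v ∉ U, (A.filter fun a => CAdj G v a).card ≤ b) (hA : b * q + 1 < A.card)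
    {c : V} (hc : c ∈ A) : IsCore G q (C.erase c) := by
  intro D hD hdom
  by_cases hDU : ∃ u ∈ D, u ∈ U
  · obtain ⟨u, huD, huU⟩ := hDU
    refine hC D hD fun x hx => ?_
    by_cases hxc : x = c
    · exact ⟨u, huD, hxc ▸ hU u huU c hc⟩
    · exact hdom x (mem_erase.2 ⟨hxc, hx⟩)
  · exfalso
    push Not at hDU
    have hsub : A.erase c ⊆ D.biUnion fun u => A.filter fun a => CAdj G u a := by
      intro a ha
      obtain ⟨hac, haA⟩ := mem_erase.1 ha
      obtain ⟨u, hu, h⟩ := hdom a (mem_erase.2 ⟨hac, hAC haA⟩)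
      exact mem_biUnion.2 ⟨u, hu, mem_filter.2 ⟨haA, h⟩⟩
    have h1 := (card_le_card hsub).trans (card_biUnion_le_card_mul _ _ b fun u hu => hb u (hDU u hu))
    rw [card_erase_of_mem hc] at h1
    have h2 : D.card * b ≤ b * q := by rw [mul_comm]; exact Nat.mul_le_mul_left _ hD
    omega

/-- A graph without `K_{d,d}` has no two completely adjacent sets of `d` vertices. -/
theorem free_card_lt {G : SimpleGraph V} {d : ℕ}
    (hG : (completeBipartiteGraph (Fin d) (Fin d)).Free G) {X Y : Finset V}
    (hX : d ≤ X.card) (h : ∀ x ∈ X, ∀ y ∈ Y, G.Adj x y) : Y.card < d := by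
  by_contra! hY
  have e : ∀ Z : Finset V, d ≤ Z.card → ∃ f : Fin d → V, Function.Injective f ∧ ∀ i, f i ∈ Z := by
    intro Z hZ
    refine ⟨fun i => Z.equivFin.symm (Fin.castLE hZ i), fun i j hij => ?_, fun i => Subtype.prop _⟩
    exact Fin.castLE_injective hZ (Z.equivFin.symm.injective (Subtype.ext hij))
  obtain ⟨f, hf, hfX⟩ := e X hX
  obtain ⟨g, hg, hgY⟩ := e Y hY
  refine hG ⟨⟨⟨Sum.elim f g, ?_⟩, ?_⟩⟩
  · rintro (a | a) (b | b) hab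
    · simp at hab
    · exact h _ (hfX a) _ (hgY b)
    · exact (h _ (hfX b) _ (hgY a)).symm
    · simp at hab
  · rintro (a | a) (b | b) hab
    · exact congrArg _ (hf hab)
    · exact absurd hab (h _ (hfX a) _ (hgY b)).ne
    · exact absurd hab (h _ (hfX b) _ (hgY a)).ne'
    · exact congrArg _ (hg hab)

/-- Closed adjacency is genuine adjacency off `U`, so `A \ U` has fewer than `d` elements, and at
most `d` more lie in `U`. -/
theorem free_card_lt_of_cadj [DecidableEq V] {G : SimpleGraph V} {d : ℕ}
    (hG : (completeBipartiteGraph (Fin d) (Fin d)).Free G) {U A : Finset V}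
    (hU : U.card = d) (h : ∀ u ∈ U, ∀ a ∈ A, CAdj G u a) : A.card < 2 * d := by
  have h1 : (A \ U).card < d := free_card_lt hG hU.ge fun u hu a ha => by
    obtain ⟨haA, haU⟩ := mem_sdiff.1 ha
    exact (h u hu a haA).resolve_left fun hua => haU (hua ▸ hu)
  have h2 := le_card_sdiff U A
  omega

/-- Counting `|A| + 1` instead of `|A|` makes the loss per round exactly a factor `q`: `b * q + 2 ≤
q * (b + 1)` because `q ≥ 2`. -/
theorem card_round {q r c a b : ℕ} (hq : 2 ≤ q) (hc : c + 1 ≤ q ^ r * (a + 1))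
    (ha : a ≤ b * q + 1) : c + 1 ≤ q ^ (r + 1) * (b + 1) :=
  calc c + 1 ≤ q ^ r * (a + 1) := hc
    _ ≤ q ^ r * (q * (b + 1)) := Nat.mul_le_mul_left _ (by nlinarith)
    _ = q ^ (r + 1) * (b + 1) := by ring

theorem card_core [DecidableEq V] {G : SimpleGraph V} {d q c : ℕ} (hd : 0 < d)
    (hG : (completeBipartiteGraph (Fin d) (Fin d)).Free G) {U A : Finset V}
    (hU : A.card ≤ 1 ∨ U.card = d) (h : ∀ u ∈ U, ∀ a ∈ A, CAdj G u a)
    (hc : c + 1 ≤ q ^ d * (A.card + 1)) : c + 1 ≤ q ^ d * (2 * d) := by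
  refine hc.trans (Nat.mul_le_mul_left _ ?_)
  rcases hU with hU | hU
  · omega
  · exact free_card_lt_of_cadj hG hU h

theorem exists_core [DecidableEq V] [Fintype V] {G : SimpleGraph V} {d q : ℕ} (hd : 0 < d) (hq : 2 ≤ q)
    (hG : (completeBipartiteGraph (Fin d) (Fin d)).Free G) :
    ∃ C : Finset V, IsCore G q C ∧ C.card + 1 ≤ q ^ d * (2 * d) := by
  -- In a minimum core no vertex can be dropped, so every round must enlarge `U` until `A` is
  -- trivial.
  obtain ⟨C, hC, hmin⟩ := exists_min_image (univ.filter fun C : Finset V => IsCore G q C) card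
    ⟨univ, mem_filter.2 ⟨mem_univ _, isCore_univ G q⟩⟩
  replace hC := (mem_filter.1 hC).2
  have key : ∀ r : ℕ, ∃ A U : Finset V, A ⊆ C ∧ (∀ u ∈ U, ∀ a ∈ A, CAdj G u a) ∧
      (A.card ≤ 1 ∨ U.card = r) ∧ C.card + 1 ≤ q ^ r * (A.card + 1) := by
    intro r
    induction r with
    | zero => exact ⟨C, ∅, Subset.rfl, by simp, by simp, by simp⟩
    | succ r ih =>
      obtain ⟨A, U, hAC, hU, hr, hc⟩ := ih
      by_cases hA1 : A.card ≤ 1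
      · refine ⟨A, U, hAC, hU, Or.inl hA1, hc.trans (Nat.mul_le_mul_right _ ?_)⟩
        exact Nat.pow_le_pow_right (by omega) (Nat.le_succ r)
      by_cases hv : ∃ v ∉ U, A.card ≤ (A.filter fun a => CAdj G v a).card * q + 1
      · obtain ⟨v, hvU, hv⟩ := hv
        refine ⟨A.filter fun a => CAdj G v a, insert v U, (filter_subset _ _).trans hAC, ?_, ?_,
          card_round hq hc hv⟩
        · intro u hu a ha
          rcases mem_insert.1 hu with rfl | hu
          · exact (mem_filter.1 ha).2
          · exact hU u hu a (mem_filter.1 ha).1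
        · rw [card_insert_of_notMem hvU]
          exact Or.inr (by omega)
      · exfalso
        push Not at hv
        obtain ⟨c, hcA⟩ : A.Nonempty := card_pos.1 (by omega)
        have h1 : IsCore G q (C.erase c) :=
          -- The largest `b` with `b * q + 1 < A.card`.
          hC.erase (b := (A.card - 2) / q) hAC hU (fun v hvU => by
            have := hv v hvU
            rw [Nat.le_div_iff_mul_le (by omega)]
            omega) (by
            have := Nat.div_mul_le_self (A.card - 2) q
            omega) hcA
        have h2 := hmin _ (mem_filter.2 ⟨mem_univ _, h1⟩)
        rw [card_erase_of_mem (hAC hcA)] at h2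
        have : 0 < C.card := card_pos.2 ⟨c, hAC hcA⟩
        omega
  obtain ⟨A, U, -, hU, hr, hc⟩ := key d
  exact ⟨C, hC, card_core hd hG hr hU hc⟩

end Combinatorics

/-! ### Traces on the core, kernels and their size. -/

section Kernel

open Finset
open scoped Classical

variable {V : Type*}

/-- `u` and `v` dominate the same vertices of `C`. -/
def SameTrace (G : SimpleGraph V) (C : Finset V) (u v : V) : Prop :=
  ∀ c ∈ C, CAdj G u c ↔ CAdj G v c

theorem SameTrace.refl (G : SimpleGraph V) (C : Finset V) (v : V) : SameTrace G C v v :=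
  fun _ _ => Iff.rfl

theorem SameTrace.symm {G : SimpleGraph V} {C : Finset V} {u v : V} (h : SameTrace G C u v) :
    SameTrace G C v u := fun c hc => (h c hc).symm

theorem SameTrace.trans {G : SimpleGraph V} {C : Finset V} {u v w : V} (h : SameTrace G C u v)
    (h' : SameTrace G C v w) : SameTrace G C u w := fun c hc => (h c hc).trans (h' c hc)

/-- `u` is a vertex outside `C ∪ S` with the same trace as `v`. -/
def IsRep (G : SimpleGraph V) (C S : Finset V) (v u : V) : Prop :=
  (u ∉ C ∧ u ∉ S) ∧ SameTrace G C u v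

/-- `W` contains `C`, `S` and at least `q` vertices outside `C ∪ S` of the trace of each vertex
that is not in `W`. -/
def IsKernel (G : SimpleGraph V) (C S : Finset V) (q : ℕ) (W : Finset V) : Prop :=
  C ⊆ W ∧ S ⊆ W ∧
    ∀ v ∉ W, q ≤ (W.filter (IsRep G C S v)).card

/-- At most `q` vertices of `W` outside `C ∪ S` have the same trace. -/
def HasSmallFibers (G : SimpleGraph V) (C S : Finset V) (q : ℕ) (W : Finset V) : Prop :=
  ∀ v ∈ W, v ∉ C → v ∉ S → (W.filter (IsRep G C S v)).card ≤ q

/-- In a minimum kernel, a vertex outside `C ∪ S` whose fibre has more than `q` members would be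
superfluous. -/
theorem exists_kernel [DecidableEq V] [Fintype V] (G : SimpleGraph V) (C S : Finset V) (q : ℕ) :
    ∃ W, IsKernel G C S q W ∧ HasSmallFibers G C S q W := by
  obtain ⟨W, hW, hmin⟩ := exists_min_image (univ.filter fun W : Finset V => IsKernel G C S q W) card
    ⟨univ, mem_filter.2 ⟨mem_univ _, subset_univ _, subset_univ _, fun v hv => by simp at hv⟩⟩
  replace hW := (mem_filter.1 hW).2
  refine ⟨W, hW, fun v hvW hvC hvS => ?_⟩
  by_contra! hlt
  have hk : IsKernel G C S q (W.erase v) := by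
    refine ⟨fun c hc => mem_erase.2 ⟨fun h => hvC (h ▸ hc), hW.1 hc⟩,
      fun c hc => mem_erase.2 ⟨fun h => hvS (h ▸ hc), hW.2.1 hc⟩, fun w hw => ?_⟩
    -- Erasing `v` costs a fibre at most one member, so a fibre of size `q + 1` remains large
    -- enough.
    have hb : ∀ w', q + 1 ≤ (W.filter (IsRep G C S w')).card →
        q ≤ ((W.erase v).filter (IsRep G C S w')).card := by
      intro w' hw'
      rw [filter_erase]
      have := pred_card_le_card_erase (a := v)
        (s := W.filter (IsRep G C S w'))
      omega
    by_cases hwv : w = v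
    · exact hb w (hwv ▸ Nat.succ_le_of_lt hlt)
    have hwW : w ∉ W := fun h => hw (mem_erase.2 ⟨hwv, h⟩)
    by_cases hs : SameTrace G C v w
    · refine hb w (hlt.trans_eq (congrArg card (filter_congr fun u _ => ?_)))
      exact and_congr_right fun _ => ⟨fun h => h.trans hs, fun h => h.trans hs.symm⟩
    · rw [filter_erase, erase_eq_of_notMem fun h => hs (mem_filter.1 h).2.2]
      exact hW.2.2 w hwW
  have := hmin _ (mem_filter.2 ⟨mem_univ _, hk⟩)
  rw [card_erase_of_mem hvW] at this
  have : 0 < W.card := card_pos.2 ⟨v, hvW⟩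
  omega

/-- Outside `C ∪ S`, there are at most `M ^ d` traces with fewer than `d` elements, each occurring
at most `k + 1` times. A vertex with a larger trace is charged to a `d`-subset of it, and each of
the at most `M ^ d` such subsets is charged at most `d - 1` times. The factors add up to `k + d`. -/
theorem card_kernel_le [DecidableEq V] {G : SimpleGraph V} {C S W : Finset V} {d k M : ℕ}
    (hd : 0 < d) (hG : (completeBipartiteGraph (Fin d) (Fin d)).Free G)
    (hW : HasSmallFibers G C S (k + 1) W) (hC : C.card ≤ M) (hS : S.card ≤ 2 * k) (hM : 2 ≤ M) :
    W.card ≤ M + 2 * k + (k + d) * M ^ d := by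
  set T : V → Finset V := fun v => C.filter fun c => CAdj G v c with hT
  set R := W.filter fun v => v ∉ C ∧ v ∉ S with hR
  have h0 : W ⊆ C ∪ S ∪ R := by
    intro v hv
    simp only [hR, mem_union, mem_filter]
    tauto
  have hsmall : (R.filter fun v => (T v).card < d).card ≤ (k + 1) * M ^ d := by
    have h1 : (R.filter fun v => (T v).card < d).card ≤
        (k + 1) * (C.powerset.filter fun Y => Y.card < d).card := by
      refine card_le_mul_card_image_of_maps_to (f := T) (fun v hv => ?_) _ fun Y hY => ?_
      · exact mem_filter.2 ⟨mem_powerset.2 (filter_subset _ _), (mem_filter.1 hv).2⟩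
      · by_cases hne : ((R.filter fun v => (T v).card < d).filter fun v => T v = Y).Nonempty
        · obtain ⟨v, hv⟩ := hne
          simp only [mem_filter, hR] at hv
          refine (card_le_card fun u hu => ?_).trans (hW v hv.1.1.1 hv.1.1.2.1 hv.1.1.2.2)
          simp only [mem_filter, hR, IsRep] at hu ⊢
          refine ⟨hu.1.1.1, hu.1.1.2, fun c hc => ?_⟩
          have : c ∈ T u ↔ c ∈ T v := by rw [hu.2, hv.2]
          simpa [hT, hc] using this
        · rw [not_nonempty_iff_eq_empty.1 hne]; simp
    refine h1.trans (Nat.mul_le_mul_left _ ?_)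
    calc (C.powerset.filter fun Y => Y.card < d).card
        ≤ ((range d).biUnion fun i => C.powersetCard i).card := card_le_card fun Y hY => by
          simp only [mem_filter, mem_powerset] at hY
          exact mem_biUnion.2 ⟨Y.card, mem_range.2 hY.2, mem_powersetCard.2 ⟨hY.1, rfl⟩⟩
      _ ≤ ∑ i ∈ range d, (C.powersetCard i).card := card_biUnion_le
      _ ≤ ∑ i ∈ range d, M ^ i := sum_le_sum fun i _ => by
          rw [card_powersetCard]
          exact (Nat.choose_le_pow _ _).trans (Nat.pow_le_pow_left hC _)
      _ ≤ M ^ d := (Nat.geomSum_lt hM fun i hi => mem_range.1 hi).le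
  have hlarge : (R.filter fun v => ¬ (T v).card < d).card ≤ (d - 1) * M ^ d := by
    have hex : ∀ v, ∃ Y : Finset V, ¬ (T v).card < d → Y ⊆ T v ∧ Y.card = d := by
      intro v
      by_cases h : (T v).card < d
      · exact ⟨∅, fun h' => absurd h h'⟩
      · obtain ⟨Y, hY⟩ := exists_subset_card_eq (not_lt.1 h)
        exact ⟨Y, fun _ => hY⟩
    choose Y hY using hex
    have h1 : (R.filter fun v => ¬ (T v).card < d).card ≤ (d - 1) * (C.powersetCard d).card := by
      refine card_le_mul_card_image_of_maps_to (f := Y) (fun v hv => ?_) _ fun Z hZ => ?_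
      · obtain ⟨h, h'⟩ := hY v (mem_filter.1 hv).2
        exact mem_powersetCard.2 ⟨h.trans (filter_subset _ _), h'⟩
      · refine Nat.le_sub_one_of_lt (free_card_lt hG (X := Z) (mem_powersetCard.1 hZ).2.ge ?_)
        intro x hx v hv
        simp only [mem_filter, hR] at hv
        have hxv := (hY v hv.1.2).1 (hv.2 ▸ hx)
        -- As `v` lies outside `C`, it differs from `x ∈ C`, and closed adjacency is an edge.
        rcases (mem_filter.1 hxv).2 with h | h
        · exact absurd (h ▸ (mem_filter.1 hxv).1) hv.1.1.2.1
        · exact h.symm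
    refine h1.trans (Nat.mul_le_mul_left _ ?_)
    rw [card_powersetCard]
    exact (Nat.choose_le_pow _ _).trans (Nat.pow_le_pow_left hC _)
  have hcard := card_le_card h0
  have h2 := card_union_le (C ∪ S) R
  have h3 := card_union_le C S
  have h4 := card_filter_add_card_filter_not (s := R) fun v => (T v).card < d
  obtain ⟨e, rfl⟩ : ∃ e, d = e + 1 := ⟨d - 1, by omega⟩
  have h5 : (k + 1) * M ^ (e + 1) + (e + 1 - 1) * M ^ (e + 1) = (k + (e + 1)) * M ^ (e + 1) := by
    rw [Nat.add_sub_cancel]; ring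
  omega

/-- Both terms depending on the core are at most `X = d (2d)^d k^(2d²)`, and `2 * X` fits into the
last term of the bound. The core idea is to trade `(k + 1) ^ (d² + 1)` for `k ^ (2d²)`, which fails
for `k = 1`. -/
theorem kernel_bound_arith {k d : ℕ} (hk : 2 ≤ k) (hd : 2 ≤ d) :
    (k + 1) ^ d * (2 * d) + 2 * k + (k + d) * ((k + 1) ^ d * (2 * d)) ^ d ≤
      d * k ^ d + 2 * k + 2 * d * (3 * (d * k ^ d)) ^ (2 * d) := by
  have h1 : (k + 1) ^ (d * d + 1) ≤ k ^ (2 * (d * d)) := by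
    obtain ⟨e, he⟩ : ∃ e, d * d = 4 + e := ⟨d * d - 4, by have := Nat.mul_le_mul hd hd; omega⟩
    rw [he]
    -- The case `d = 2`, which is tight: `243 ≤ 256` for `k = 2`. Each further unit of `d * d` only
    -- needs `k + 1 ≤ k ^ 2`.
    have h5 : (k + 1) ^ 5 ≤ k ^ 8 := by
      obtain ⟨j, rfl⟩ : ∃ j, k = j + 2 := ⟨k - 2, by omega⟩
      have : (j + 2) ^ 8 = (j + 2 + 1) ^ 5 + ((j + 2) ^ 8 - (j + 2 + 1) ^ 5) := by
        refine (Nat.add_sub_of_le ?_).symm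
        ring_nf
        nlinarith [Nat.zero_le j, Nat.zero_le (j^2), Nat.zero_le (j^3), Nat.zero_le (j^4), Nat.zero_le (j^5), Nat.zero_le (j^6), Nat.zero_le (j^7), Nat.zero_le (j^8)]
      omega
    have h2 : k + 1 ≤ k ^ 2 := by nlinarith
    calc (k + 1) ^ (4 + e + 1) = (k + 1) ^ 5 * (k + 1) ^ e := by ring
      _ ≤ k ^ 8 * (k ^ 2) ^ e := Nat.mul_le_mul h5 (Nat.pow_le_pow_left h2 e)
      _ = k ^ (2 * (4 + e)) := by ring
  set X := d * (2 * d) ^ d * k ^ (2 * (d * d)) with hX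
  have h3 : (k + d) * ((k + 1) ^ d * (2 * d)) ^ d ≤ X :=
    calc (k + d) * ((k + 1) ^ d * (2 * d)) ^ d
        ≤ (d * (k + 1)) * ((k + 1) ^ d * (2 * d)) ^ d := Nat.mul_le_mul_right _ (by nlinarith)
      _ = d * (2 * d) ^ d * (k + 1) ^ (d * d + 1) := by rw [mul_pow, ← pow_mul]; ring
      _ ≤ X := Nat.mul_le_mul_left _ h1
  have h4 : (k + 1) ^ d * (2 * d) ≤ X :=
    calc (k + 1) ^ d * (2 * d) ≤ ((k + 1) ^ d * (2 * d)) ^ d := Nat.le_self_pow (by omega) _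
      _ ≤ (k + d) * ((k + 1) ^ d * (2 * d)) ^ d := Nat.le_mul_of_pos_left _ (by omega)
      _ ≤ X := h3
  have h5 : X + X ≤ 2 * d * (3 * (d * k ^ d)) ^ (2 * d) :=
    calc X + X = 2 * d * ((2 * d) ^ d * k ^ (2 * (d * d))) := by rw [hX]; ring
      _ ≤ 2 * d * ((3 * d) ^ (2 * d) * k ^ (2 * (d * d))) := by
          refine Nat.mul_le_mul_left _ (Nat.mul_le_mul_right _ ?_)
          calc (2 * d) ^ d ≤ (3 * d) ^ d := Nat.pow_le_pow_left (by omega) _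
            _ ≤ (3 * d) ^ (2 * d) := Nat.pow_le_pow_right (by omega) (by omega)
      _ = 2 * d * (3 * (d * k ^ d)) ^ (2 * d) := by
          rw [← mul_assoc 3, mul_pow (3 * d), ← pow_mul]; congr 3; ring
  omega

theorem core_bound_arith {d : ℕ} (hd : 0 < d) :
    2 ^ d * (2 * d) + 2 ≤ d + 2 + 2 * d * (3 * d) ^ (2 * d) := by
  have : 2 ^ d ≤ (3 * d) ^ (2 * d) :=
    calc 2 ^ d ≤ (3 * d) ^ d := Nat.pow_le_pow_left (by omega) _
      _ ≤ (3 * d) ^ (2 * d) := Nat.pow_le_pow_right (by omega) (by omega)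
  have := Nat.mul_le_mul_left (2 * d) this
  rw [mul_comm (2 ^ d)]
  omega

end Kernel

/-! ### Walks of prescribed length. -/

/-- `b` can be reached from `a` in exactly `ℓ` steps of the relation `R`. -/
def Reach {α : Type*} (R : α → α → Prop) : ℕ → α → α → Prop
  | 0, a, b => a = b
  | ℓ + 1, a, b => ∃ c, R a c ∧ Reach R ℓ c b

section Reach

variable {α β : Type*}

/-- Path lifting, step by step from a given start. It transports walks on plain vertex sets back to
walks on the nodes of a reconfiguration graph or on masks. -/
theorem Reach.lift {R : α → α → Prop} {R' : β → β → Prop} {f : α → β}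
    (h : ∀ a y, R' (f a) y → ∃ b, f b = y ∧ R a b) {ℓ : ℕ} {a : α} {y : β}
    (hr : Reach R' ℓ (f a) y) : ∃ b, f b = y ∧ Reach R ℓ a b := by
  induction ℓ generalizing a with
  | zero => exact ⟨a, hr, rfl⟩
  | succ ℓ ih =>
    obtain ⟨c, hc, hr⟩ := hr
    obtain ⟨b, rfl, hb⟩ := h a c hc
    obtain ⟨b', hb', hr'⟩ := ih hr
    exact ⟨b', hb', b, hb, hr'⟩

theorem Reach.map {R : α → α → Prop} {R' : β → β → Prop} {f : α → β}
    (h : ∀ a b, R a b → R' (f a) (f b)) {ℓ : ℕ} {a b : α}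
    (hr : Reach R ℓ a b) : Reach R' ℓ (f a) (f b) := by
  induction ℓ generalizing a with
  | zero => exact congrArg f hr
  | succ ℓ ih =>
    obtain ⟨c, hc, hr⟩ := hr
    exact ⟨f c, h _ _ hc, ih hr⟩

theorem exists_walk_iff_reach {H : SimpleGraph α} {ℓ : ℕ} {a b : α} :
    (∃ w : H.Walk a b, w.length = ℓ) ↔ Reach H.Adj ℓ a b := by
  induction ℓ generalizing a with
  | zero =>
    refine ⟨?_, ?_⟩
    · rintro ⟨w, hw⟩
      exact SimpleGraph.Walk.eq_of_length_eq_zero hw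
    · rintro rfl
      exact ⟨SimpleGraph.Walk.nil, rfl⟩
  | succ ℓ ih =>
    refine ⟨?_, ?_⟩
    · rintro ⟨w, hw⟩
      cases w with
      | nil => simp at hw
      | cons h w => exact ⟨_, h, ih.1 ⟨w, by simpa using hw⟩⟩
    · rintro ⟨c, hc, hr⟩
      obtain ⟨w, hw⟩ := ih.2 hr
      exact ⟨SimpleGraph.Walk.cons hc w, by simp [hw]⟩

/-- Allowing shorter replacements rather than equal lengths is what the case `k = 1` requires. -/
theorem edist_le_of_reach {H : SimpleGraph α} {H' : SimpleGraph β} {a b : α} {a' b' : β}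
    (h : ∀ ℓ, Reach H.Adj ℓ a b → ∃ ℓ' ≤ ℓ, Reach H'.Adj ℓ' a' b') :
    H'.edist a' b' ≤ H.edist a b := by
  refine le_iInf fun w => ?_
  obtain ⟨ℓ', hℓ, h'⟩ := h w.length (exists_walk_iff_reach.1 ⟨w, rfl⟩)
  obtain ⟨w', rfl⟩ := exists_walk_iff_reach.2 h'
  exact w'.edist_le.trans (by exact_mod_cast hℓ)

end Reach

/-! ### Reconfiguration steps on plain vertex sets, in `G` and in induced subgraphs. -/

section Reconfiguration

open Finset

variable {V : Type*} [DecidableEq V]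

/-- One of the two sets arises from the other by adding a vertex. -/
def Flip (A B : Finset V) : Prop := ∃ v, (v ∉ A ∧ B = insert v A) ∨ (v ∉ B ∧ A = insert v B)

theorem card_symmDiff_eq_one_iff {A B : Finset V} : (symmDiff A B).card = 1 ↔ Flip A B := by
  refine ⟨fun h => ?_, ?_⟩
  · obtain ⟨v, hv⟩ := card_eq_one.1 h
    have hmem : ∀ x, (x ∈ A ∧ x ∉ B ∨ x ∈ B ∧ x ∉ A) ↔ x = v := fun x => by
      rw [← mem_symmDiff, hv, mem_singleton]
    refine ⟨v, ?_⟩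
    rcases (hmem v).2 rfl with ⟨hA, hB⟩ | ⟨hB, hA⟩
    · refine Or.inr ⟨hB, ext fun x => ?_⟩
      rw [mem_insert]
      by_cases hx : x = v
      · simp [hx, hA]
      · have := mt (hmem x).1 hx
        tauto
    · refine Or.inl ⟨hA, ext fun x => ?_⟩
      rw [mem_insert]
      by_cases hx : x = v
      · simp [hx, hB]
      · have := mt (hmem x).1 hx
        tauto
  · rintro ⟨v, ⟨hv, rfl⟩ | ⟨hv, rfl⟩⟩
    · rw [card_eq_one]
      refine ⟨v, ext fun x => ?_⟩
      rw [mem_symmDiff, mem_insert, mem_singleton]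
      by_cases hx : x = v
      · simp [hx, hv]
      · tauto
    · rw [card_eq_one]
      refine ⟨v, ext fun x => ?_⟩
      rw [mem_symmDiff, mem_insert, mem_singleton]
      by_cases hx : x = v
      · simp [hx, hv]
      · tauto

theorem reconfGraph_adj_iff {G : SimpleGraph V} {k : ℕ} {A B : DSNode G k} :
    (reconfGraph G k).Adj A B ↔ Flip A.1 B.1 := by
  rw [← card_symmDiff_eq_one_iff]
  simp only [reconfGraph]
  convert Iff.rfl

/-- `D` is a node of the reconfiguration graph that is contained in `W`. -/
def IsNode (G : SimpleGraph V) (k : ℕ) (W D : Finset V) : Prop :=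
  D ⊆ W ∧ IsDominating G D ∧ k ≤ D.card ∧ D.card ≤ k + 1

/-- A reconfiguration step inside `W`. -/
def RStep (G : SimpleGraph V) (k : ℕ) (W A B : Finset V) : Prop :=
  IsNode G k W A ∧ IsNode G k W B ∧ Flip A B

theorem reach_reconfGraph_iff [Fintype V] {G : SimpleGraph V} {k ℓ : ℕ} {A B : DSNode G k} :
    Reach (reconfGraph G k).Adj ℓ A B ↔ Reach (RStep G k univ) ℓ A.1 B.1 := by
  refine ⟨Reach.map fun A B h =>
    ⟨⟨subset_univ _, A.2⟩, ⟨subset_univ _, B.2⟩, reconfGraph_adj_iff.1 h⟩, fun h => ?_⟩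
  obtain ⟨B', hB', h⟩ := h.lift (R := (reconfGraph G k).Adj) (f := Subtype.val) fun A Y hY =>
    ⟨⟨Y, hY.2.1.2⟩, rfl, reconfGraph_adj_iff.2 hY.2.2⟩
  rwa [Subtype.ext hB'] at h

theorem flip_map_iff {U : Type*} [DecidableEq U] (f : U ↪ V) {A B : Finset U} :
    Flip (A.map f) (B.map f) ↔ Flip A B := by
  rw [← card_symmDiff_eq_one_iff, ← card_symmDiff_eq_one_iff, map_eq_image, map_eq_image,
    ← image_symmDiff _ _ f.injective, card_image_of_injective _ f.injective]

variable {G : SimpleGraph V} {k : ℕ} {C S W : Finset V}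

/-- A set dominating `G[W]` dominates the core `C ⊆ W`, hence all of `G`. Conversely, vertices of
`W` keep their dominators, because the set lies in `W`. -/
theorem isDominating_induce_iff {V : Type*} {G : SimpleGraph V} {k : ℕ} {C W : Finset V}
    (hC : IsCore G (k + 1) C) (hW : C ⊆ W)
    {D : Finset (W : Set V)} (hD : D.card ≤ k + 1) :
    IsDominating (G.induce (W : Set V)) D ↔
      IsDominating G (D.map (Function.Embedding.subtype _)) := by
  rw [isDominating_iff]
  refine ⟨fun h => hC _ (by rwa [card_map]) fun c hc => ?_, fun h v => ?_⟩
  · obtain ⟨u, hu, hadj⟩ := h ⟨c, hW hc⟩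
    refine ⟨u, mem_map_of_mem _ hu, hadj.imp (congrArg Subtype.val) fun h => h⟩
  · obtain ⟨u, hu, hadj⟩ := isDominating_iff.1 h v
    obtain ⟨u', hu', rfl⟩ := mem_map.1 hu
    exact ⟨u', hu', hadj.imp Subtype.ext fun h => h⟩

theorem reach_induce_iff (hC : IsCore G (k + 1) C) (hW : C ⊆ W) {ℓ : ℕ}
    {A B : DSNode (G.induce (W : Set V)) k} :
    Reach (reconfGraph (G.induce (W : Set V)) k).Adj ℓ A B ↔
      Reach (RStep G k W) ℓ (A.1.map (Function.Embedding.subtype _))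
        (B.1.map (Function.Embedding.subtype _)) := by
  have hnode : ∀ A : DSNode (G.induce (W : Set V)) k,
      IsNode G k W (A.1.map (Function.Embedding.subtype _)) := fun A =>
    ⟨fun x hx => by obtain ⟨y, -, rfl⟩ := mem_map.1 hx; exact y.2,
      (isDominating_induce_iff hC hW A.2.2.2).1 A.2.1, by simpa using A.2.2⟩
  refine ⟨Reach.map (f := fun A : DSNode (G.induce (W : Set V)) k =>
    A.1.map (Function.Embedding.subtype _)) fun A B h => ⟨hnode A, hnode B,
      (flip_map_iff _).2 (reconfGraph_adj_iff.1 h)⟩, fun h => ?_⟩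
  obtain ⟨B', hB', h⟩ := h.lift (R := (reconfGraph (G.induce (W : Set V)) k).Adj)
    (f := fun A : DSNode (G.induce (W : Set V)) k => A.1.map (Function.Embedding.subtype _))
    fun A Y hY => by
      have hYm : (Y.subtype (· ∈ (W : Set V))).map (Function.Embedding.subtype _) = Y := by
        rw [subtype_map]
        exact filter_true_of_mem fun x hx => hY.2.1.1 hx
      have hc : (Y.subtype (· ∈ (W : Set V))).card = Y.card := by
        conv_rhs => rw [← hYm, card_map]
      refine ⟨⟨Y.subtype (· ∈ (W : Set V)), ?_, by rw [hc]; exact hY.2.1.2.2⟩, hYm, ?_⟩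
      · rw [isDominating_induce_iff hC hW (hc ▸ hY.2.1.2.2.2), hYm]
        exact hY.2.1.2.1
      · rw [reconfGraph_adj_iff, ← flip_map_iff (Function.Embedding.subtype _), hYm]
        exact hY.2.2
  have : B' = B := Subtype.ext (map_injective _ hB')
  rwa [this] at h

end Reconfiguration

/-! ### Copying a reconfiguration sequence into the kernel. -/

section Transfer

open Finset
open scoped Classical

variable {V : Type*} [DecidableEq V] {G : SimpleGraph V} {k : ℕ} {C S W : Finset V}

/-- `u` lies outside `S` and has the same trace as `v`. -/
def IsTwin (G : SimpleGraph V) (C S : Finset V) (v u : V) : Prop := u ∉ S ∧ SameTrace G C u v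

/-- `D` and `D'` agree on `S` and contain equally many vertices of each trace outside `S`. -/
def TraceEquiv (G : SimpleGraph V) (C S D D' : Finset V) : Prop :=
  D.card = D'.card ∧ (∀ v ∈ S, v ∈ D ↔ v ∈ D') ∧
    ∀ v, (D.filter (IsTwin G C S v)).card = (D'.filter (IsTwin G C S v)).card

/-- The vertices `v` and `v'` are equal or twins outside `S`, so every trace class outside `S` gains
both or neither. -/
theorem traceEquiv_insert_insert {D D' : Finset V} (h : TraceEquiv G C S D D') {v v' : V} (hv : v ∉ D)
    (hv' : v' ∉ D') (hvv : v = v' ∨ IsTwin G C S v v' ∧ v ∉ S) :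
    TraceEquiv G C S (insert v D) (insert v' D') := by
  refine ⟨by rw [card_insert_of_notMem hv, card_insert_of_notMem hv', h.1], fun x hx => ?_,
    fun x => ?_⟩
  · rw [mem_insert, mem_insert, h.2.1 x hx]
    rcases hvv with rfl | ⟨h1, h2⟩
    · rfl
    · have e1 : x ≠ v := fun e => h2 (e ▸ hx)
      have e2 : x ≠ v' := fun e => h1.1 (e ▸ hx)
      simp [e1, e2]
  · have hiff : IsTwin G C S x v ↔ IsTwin G C S x v' := by
      rcases hvv with rfl | ⟨h1, h2⟩
      · rfl
      · exact ⟨fun h => ⟨h1.1, h1.2.trans h.2⟩, fun h => ⟨h2, h1.2.symm.trans h.2⟩⟩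
    rw [filter_insert, filter_insert]
    by_cases hx : IsTwin G C S x v
    · rw [if_pos hx, if_pos (hiff.1 hx), card_insert_of_notMem fun h => hv (mem_filter.1 h).1,
        card_insert_of_notMem fun h => hv' (mem_filter.1 h).1, h.2.2]
    · rw [if_neg hx, if_neg (mt hiff.2 hx), h.2.2]

theorem traceEquiv_of_insert_insert {D D' : Finset V} {v v' : V} (hv : v ∉ D)
    (hv' : v' ∉ D') (hvv : v = v' ∨ IsTwin G C S v v' ∧ v ∉ S)
    (h : TraceEquiv G C S (insert v D) (insert v' D')) : TraceEquiv G C S D D' := by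
  refine ⟨?_, fun x hx => ?_, fun x => ?_⟩
  · have := h.1
    rwa [card_insert_of_notMem hv, card_insert_of_notMem hv', Nat.succ_inj] at this
  · have := h.2.1 x hx
    rw [mem_insert, mem_insert] at this
    rcases hvv with rfl | ⟨h1, h2⟩
    · by_cases e : x = v
      · subst e; tauto
      · tauto
    · have e1 : x ≠ v := fun e => h2 (e ▸ hx)
      have e2 : x ≠ v' := fun e => h1.1 (e ▸ hx)
      tauto
  · have hiff : IsTwin G C S x v ↔ IsTwin G C S x v' := by
      rcases hvv with rfl | ⟨h1, h2⟩
      · rfl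
      · exact ⟨fun h => ⟨h1.1, h1.2.trans h.2⟩, fun h => ⟨h2, h1.2.symm.trans h.2⟩⟩
    have := h.2.2 x
    rw [filter_insert, filter_insert] at this
    by_cases hx : IsTwin G C S x v
    · rwa [if_pos hx, if_pos (hiff.1 hx), card_insert_of_notMem fun h => hv (mem_filter.1 h).1,
        card_insert_of_notMem fun h => hv' (mem_filter.1 h).1, Nat.succ_inj] at this
    · rwa [if_neg hx, if_neg (mt hiff.2 hx)] at this

/-- Suppose every twin of `v` in `W` were already used by `D'`. By equivalence `D` has as many twins
as `D'`, so at least as many as `W`. If `W` contains all twins, this contradicts `v ∉ D`; if it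
misses one, then `W` has at least `k + 1` twins, more than `D.card`. -/
theorem TraceEquiv.exists_insert (hW : IsKernel G C S (k + 1) W) {D D' : Finset V}
    (h : TraceEquiv G C S D D') (hk : D.card ≤ k) {v : V} (hv : v ∉ D) :
    ∃ v' ∈ W, v' ∉ D' ∧ TraceEquiv G C S (insert v D) (insert v' D') := by
  by_cases hvS : v ∈ S
  · have hv' : v ∉ D' := fun e => hv ((h.2.1 v hvS).2 e)
    exact ⟨v, hW.2.1 hvS, hv', traceEquiv_insert_insert h hv hv' (Or.inl rfl)⟩
  have key : ∃ v' ∈ W, v' ∉ D' ∧ IsTwin G C S v v' := by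
    by_contra! hno
    have hsub : W.filter (IsTwin G C S v) ⊆ D'.filter (IsTwin G C S v) := fun u hu => by
      obtain ⟨huW, hu⟩ := mem_filter.1 hu
      exact mem_filter.2 ⟨by_contra fun huD => hno u huW huD hu, hu⟩
    have h1 := card_le_card hsub
    rw [← h.2.2 v] at h1
    by_cases hall : ∀ u, IsTwin G C S v u → u ∈ W
    · have hss : D.filter (IsTwin G C S v) ⊂ W.filter (IsTwin G C S v) := by
        refine (ssubset_iff_of_subset fun u hu => ?_).2 ⟨v, ?_, fun hm => hv (mem_filter.1 hm).1⟩
        · exact mem_filter.2 ⟨hall u (mem_filter.1 hu).2, (mem_filter.1 hu).2⟩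
        · exact mem_filter.2 ⟨hall v ⟨hvS, SameTrace.refl _ _ _⟩, hvS, SameTrace.refl _ _ _⟩
      exact absurd (card_lt_card hss) (not_lt.2 h1)
    · push Not at hall
      obtain ⟨u, hu, huW⟩ := hall
      have h2 : W.filter (IsRep G C S u) ⊆ W.filter (IsTwin G C S v) := fun x hx => by
        obtain ⟨hxW, hx⟩ := mem_filter.1 hx
        exact mem_filter.2 ⟨hxW, hx.1.2, hx.2.trans hu.2⟩
      have h3 := hW.2.2 u huW
      have h4 := card_le_card h2
      have h5 := card_filter_le D (IsTwin G C S v)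
      omega
  obtain ⟨v', hv'W, hv'D, ht⟩ := key
  exact ⟨v', hv'W, hv'D, traceEquiv_insert_insert h hv hv'D (Or.inr ⟨ht, hvS⟩)⟩

theorem TraceEquiv.exists_mem {D D' : Finset V} (h : TraceEquiv G C S D D') {v : V} (hv : v ∈ D) :
    ∃ v' ∈ D', v = v' ∨ IsTwin G C S v v' ∧ v ∉ S := by
  by_cases hvS : v ∈ S
  · exact ⟨v, (h.2.1 v hvS).1 hv, Or.inl rfl⟩
  · have : 0 < (D.filter (IsTwin G C S v)).card :=
      card_pos.2 ⟨v, mem_filter.2 ⟨hv, hvS, SameTrace.refl _ _ _⟩⟩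
    rw [h.2.2 v] at this
    obtain ⟨v', hv'⟩ := card_pos.1 this
    exact ⟨v', (mem_filter.1 hv').1, Or.inr ⟨(mem_filter.1 hv').2, hvS⟩⟩

/-- Each dominator of a core vertex in `D` has a counterpart in `D'` with the same trace, and
dominating the core suffices. -/
theorem TraceEquiv.isNode (hC : IsCore G (k + 1) C) {X D D' : Finset V} (h : TraceEquiv G C S D D')
    (hD : IsNode G k X D) (hsub : D' ⊆ W) : IsNode G k W D' := by
  refine ⟨hsub, hC D' (h.1 ▸ hD.2.2.2) fun c hc => ?_, h.1 ▸ hD.2.2⟩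
  obtain ⟨u, hu, hadj⟩ := isDominating_iff.1 hD.2.1 c
  obtain ⟨u', hu', rfl | htw⟩ := h.exists_mem hu
  · exact ⟨u, hu', hadj⟩
  · exact ⟨u', hu', (htw.1.2 c hc).2 hadj⟩

/-- The copy follows every insertion and removal with one of its own, so the length is preserved
exactly. This makes shortest sequences survive, not merely reachability. -/
theorem reach_transfer (hC : IsCore G (k + 1) C) (hW : IsKernel G C S (k + 1) W) {X : Finset V}
    {ℓ : ℕ} {A B A' : Finset V} (h : Reach (RStep G k X) ℓ A B) (hs : TraceEquiv G C S A A')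
    (hA' : A' ⊆ W) : ∃ B', TraceEquiv G C S B B' ∧ Reach (RStep G k W) ℓ A' B' := by
  induction ℓ generalizing A A' with
  | zero => exact ⟨A', h ▸ hs, rfl⟩
  | succ ℓ ih =>
    obtain ⟨D, ⟨hA, hD, v, hv⟩, hr⟩ := h
    have hstep : ∃ D', D' ⊆ W ∧ TraceEquiv G C S D D' ∧ Flip A' D' := by
      rcases hv with ⟨hv, rfl⟩ | ⟨hv, rfl⟩
      · have hk := hD.2.2.2
        rw [card_insert_of_notMem hv] at hk
        obtain ⟨v', hvW, hvA, hs'⟩ := hs.exists_insert hW (Nat.le_of_succ_le_succ hk) hv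
        exact ⟨_, insert_subset hvW hA', hs', v', Or.inl ⟨hvA, rfl⟩⟩
      · obtain ⟨v', hv', hvv⟩ := hs.exists_mem (mem_insert_self v D)
        refine ⟨A'.erase v', (erase_subset _ _).trans hA', traceEquiv_of_insert_insert hv
          (notMem_erase _ _) hvv ?_, v', Or.inr ⟨notMem_erase _ _, (insert_erase hv').symm⟩⟩
        rwa [insert_erase hv']
    obtain ⟨D', hD'W, hs', hf⟩ := hstep
    obtain ⟨B', hB', hr'⟩ := ih hr hs' hD'W
    exact ⟨B', hB', D', ⟨hs.isNode hC hA hA', hs'.isNode hC hD hD'W, hf⟩, hr'⟩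

theorem TraceEquiv.eq_of_subset {V : Type*} {G : SimpleGraph V} {C S D D' : Finset V} (h : TraceEquiv G C S D D') (hD : D ⊆ S) : D = D' :=
  eq_of_subset_of_card_le (fun v hv => (h.2.1 v (hD hv)).1 hv) h.1.ge

theorem reach_kernel_iff [Fintype V] (hC : IsCore G (k + 1) C) (hW : IsKernel G C S (k + 1) W)
    {ℓ : ℕ} {A B : Finset V} (hA : A ⊆ S) (hB : B ⊆ S) :
    Reach (RStep G k univ) ℓ A B ↔ Reach (RStep G k W) ℓ A B := by
  refine ⟨fun h => ?_, Reach.map (f := id) fun A B h =>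
    ⟨⟨subset_univ _, h.1.2⟩, ⟨subset_univ _, h.2.1.2⟩, h.2.2⟩⟩
  obtain ⟨B', hs, hr⟩ := reach_transfer (A' := A) hC hW h
    ⟨rfl, fun _ _ => Iff.rfl, fun _ => rfl⟩ (hA.trans hW.2.1)
  rwa [hs.eq_of_subset hB]

end Transfer

/-! ### The reduced instance and its explicit size. -/

section Reduction

open Finset

namespace BicliqueFreeDSR

variable (x : BicliqueFreeDSR)

/-- Only one direction needs a hypothesis: nodes contained in `W` are nodes of `G`, so walks inside
`W` are walks in `G`. -/
theorem isReduction_of_reach {C W : Finset (Fin x.n)} (hC : IsCore x.G (x.k + 1) C)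
    (hCW : C ⊆ W) (hs : x.Ds ⊆ W) (ht : x.Dt ⊆ W)
    (h : ∀ ℓ, Reach (RStep x.G x.k univ) ℓ x.Ds x.Dt →
      ∃ ℓ' ≤ ℓ, Reach (RStep x.G x.k W) ℓ' x.Ds x.Dt) : x.IsReduction W := by
  refine ⟨fun D => (isDominating_induce_iff hC hCW D.2.2.2).1 D.2.1, ?_⟩
  have hex : ∀ D ⊆ W, IsDominating x.G D → D.card = x.k →
      ∃ A : DSNode (x.G.induce (W : Set (Fin x.n))) x.k,
        A.1.map (Function.Embedding.subtype _) = D := by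
    intro D hD hdom hk
    have hm : (D.subtype (· ∈ (W : Set (Fin x.n)))).map (Function.Embedding.subtype _) = D := by
      rw [subtype_map]
      exact filter_true_of_mem fun v hv => hD hv
    have hc : (D.subtype (· ∈ (W : Set (Fin x.n)))).card = x.k := by
      rw [← card_map (Function.Embedding.subtype _), hm, hk]
    exact ⟨⟨_, (isDominating_induce_iff hC hCW (hc.le.trans (Nat.le_succ _))).2 (hm.symm ▸ hdom),
      hc.ge, hc.le.trans (Nat.le_succ _)⟩, hm⟩
  obtain ⟨S, hS⟩ := hex x.Ds hs x.Ds_dominating x.Ds_card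
  obtain ⟨T, hT⟩ := hex x.Dt ht x.Dt_dominating x.Dt_card
  refine ⟨S, T, hS, hT, le_antisymm (edist_le_of_reach fun ℓ hℓ => ?_)
    (edist_le_of_reach fun ℓ hℓ => ⟨ℓ, le_rfl, ?_⟩)⟩
  · obtain ⟨ℓ', hle, h'⟩ := h ℓ (reach_reconfGraph_iff.1 hℓ)
    exact ⟨ℓ', hle, (reach_induce_iff hC hCW).2 (by rwa [hS, hT])⟩
  · have h1 := (reach_induce_iff hC hCW).1 hℓ
    rw [hS, hT] at h1
    exact reach_reconfGraph_iff.2 (h1.map (f := id) fun A B h =>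
      ⟨⟨subset_univ _, h.1.2⟩, ⟨subset_univ _, h.2.1.2⟩, h.2.2⟩)

theorem isReduction_of_kernel {C W : Finset (Fin x.n)} (hC : IsCore x.G (x.k + 1) C)
    (hW : IsKernel x.G C (x.Ds ∪ x.Dt) (x.k + 1) W) : x.IsReduction W :=
  x.isReduction_of_reach hC hW.1 (subset_union_left.trans hW.2.1)
    (subset_union_right.trans hW.2.1) fun ℓ h =>
      ⟨ℓ, le_rfl, (reach_kernel_iff hC hW subset_union_left subset_union_right).1 h⟩

/-- For singletons `{a} ≠ {b}`, the route through `{a, b}` has length 2, and it only needs the core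
and the two ends. No shorter walk exists, as a single step changes the cardinality. -/
theorem isReduction_of_k_eq_one {C W : Finset (Fin x.n)} (hk : x.k = 1)
    (hC : IsCore x.G (x.k + 1) C) (hCW : C ⊆ W) (hs : x.Ds ⊆ W) (ht : x.Dt ⊆ W) :
    x.IsReduction W := by
  refine x.isReduction_of_reach hC hCW hs ht fun ℓ h => ?_
  obtain ⟨a, ha⟩ := card_eq_one.1 (x.Ds_card.trans hk)
  obtain ⟨b, hb⟩ := card_eq_one.1 (x.Dt_card.trans hk)
  by_cases hab : a = b
  · exact ⟨0, Nat.zero_le _, by rw [ha, hb, hab]; exact rfl⟩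
  refine ⟨2, ?_, insert a x.Dt, ?_, x.Dt, ?_, rfl⟩
  · match ℓ, h with
    | 0, h =>
      have h : x.Ds = x.Dt := h
      rw [ha, hb] at h
      exact absurd (singleton_injective h) hab
    | 1, h =>
      obtain ⟨B, ⟨-, -, v, hv⟩, hB⟩ := h
      have hB : B = x.Dt := hB
      subst hB
      rcases hv with ⟨hv, h⟩ | ⟨hv, h⟩
      · have := congrArg card h
        rw [card_insert_of_notMem hv, x.Ds_card, x.Dt_card] at this
        omega
      · have := congrArg card h
        rw [card_insert_of_notMem hv, x.Ds_card, x.Dt_card] at this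
        omega
    | ℓ + 2, _ => omega
  all_goals
    have hna : a ∉ x.Dt := by rw [hb]; simpa using hab
    have hnb : b ∉ x.Ds := by rw [ha]; simpa using Ne.symm hab
    have hc : (insert a x.Dt).card = 2 := by rw [card_insert_of_notMem hna, x.Dt_card, hk]
    have hn : IsNode x.G x.k W (insert a x.Dt) := by
      refine ⟨insert_subset (hs (by simp [ha])) ht, ?_, by omega, by omega⟩
      rw [isDominating_iff]
      intro v
      obtain ⟨u, hu, h⟩ := isDominating_iff.1 x.Dt_dominating v
      exact ⟨u, mem_insert_of_mem hu, h⟩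
  · refine ⟨⟨hs, x.Ds_dominating, x.Ds_card.ge, by have := x.Ds_card; omega⟩, hn, b,
      Or.inl ⟨hnb, ?_⟩⟩
    rw [ha, hb, pair_comm]
  · exact ⟨hn, ⟨ht, x.Dt_dominating, x.Dt_card.ge, by have := x.Dt_card; omega⟩, a,
      Or.inr ⟨hna, rfl⟩⟩

theorem card_union_le_two_mul : (x.Ds ∪ x.Dt).card ≤ 2 * x.k := by
  have := card_union_le x.Ds x.Dt
  rw [x.Ds_card, x.Dt_card] at this
  omega

/-- The kernel bound is good enough for `k, d ≥ 2`. For `k = 1` the core together with the two ends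
is used instead. -/
theorem exists_isReduction : ∃ W : Finset (Fin x.n), x.IsReduction W ∧
    W.card ≤ x.d * x.k ^ x.d + 2 * x.k + 2 * x.d * (3 * (x.d * x.k ^ x.d)) ^ (2 * x.d) := by
  have hk := x.k_pos
  have hd := x.d_pos
  obtain ⟨C, hC, hcard⟩ := exists_core (q := x.k + 1) x.d_pos (by omega) x.free
  have hS := x.card_union_le_two_mul
  by_cases hk1 : x.k = 1
  · refine ⟨C ∪ (x.Ds ∪ x.Dt), x.isReduction_of_k_eq_one hk1 hC subset_union_left
      (subset_union_left.trans subset_union_right) (subset_union_right.trans subset_union_right), ?_⟩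
    have h1 := card_union_le C (x.Ds ∪ x.Dt)
    have h2 := core_bound_arith x.d_pos
    rw [hk1] at hS hcard ⊢
    norm_num at hcard ⊢
    omega
  obtain ⟨W, hW, hW'⟩ := exists_kernel x.G C (x.Ds ∪ x.Dt) (x.k + 1)
  refine ⟨W, x.isReduction_of_kernel hC hW, ?_⟩
  by_cases hd1 : x.d = 1
  · have hDs : x.Ds = univ := by
      rw [eq_univ_iff_forall]
      intro v
      refine (x.Ds_dominating v).resolve_right ?_
      rintro ⟨u, -, huv⟩
      have hG : (completeBipartiteGraph (Fin 1) (Fin 1)).Free x.G := hd1 ▸ x.free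
      have := free_card_lt hG (X := {u}) (Y := {v}) (by simp) (by simpa using huv)
      simp at this
    have := card_le_univ W
    rw [← card_univ, ← hDs, x.Ds_card] at this
    omega
  · have hpow : 1 ≤ (x.k + 1) ^ x.d := Nat.one_le_pow _ _ (by omega)
    refine (card_kernel_le (M := (x.k + 1) ^ x.d * (2 * x.d)) x.d_pos x.free hW' (by omega) hS
      (by nlinarith)).trans (kernel_bound_arith (by omega) (by omega))

end BicliqueFreeDSR

end Reduction

/-! ### Correctness and running time of programs: frames and loops. -/

section Framework

/-- Update of a register. -/
def RamState.setReg (s : RamState) (x v : ℕ) : RamState := ⟨Function.update s.reg x v, s.mem⟩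

/-- Update of a memory cell. -/
def RamState.setMem (s : RamState) (a i v : ℕ) : RamState :=
  ⟨s.reg, Function.update s.mem a (Function.update (s.mem a) i v)⟩

namespace RamState

variable (s : RamState)

@[simp] theorem setReg_reg (x v y : ℕ) : (s.setReg x v).reg y = if y = x then v else s.reg y :=
  Function.update_apply _ _ _ _

@[simp] theorem setReg_mem (x v : ℕ) : (s.setReg x v).mem = s.mem := rfl

@[simp] theorem setMem_reg (a i v : ℕ) : (s.setMem a i v).reg = s.reg := rfl

@[simp] theorem setMem_mem (a i v b j : ℕ) :
    (s.setMem a i v).mem b j = if b = a ∧ j = i then v else s.mem b j := by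
  simp only [setMem, Function.update_apply]
  by_cases hb : b = a
  · subst hb
    simp [Function.update_apply]
  · simp [hb]

end RamState

attribute [simp] RamExpr.eval RamExpr.cost

namespace RamProg

/-- Does the program contain an assignment to register `r`? -/
def writesReg : RamProg → ℕ → Bool
  | skip, _ => false
  | assign x _, r => decide (x = r)
  | store _ _ _, _ => false
  | seq p q, r => p.writesReg r || q.writesReg r
  | ite _ p q, r => p.writesReg r || q.writesReg r
  | loop _ p, r => p.writesReg r

/-- Does the program contain a store to array `a`? -/
def writesMem : RamProg → ℕ → Bool
  | skip, _ => false
  | assign _ _, _ => false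
  | store b _ _, a => decide (b = a)
  | seq p q, a => p.writesMem a || q.writesMem a
  | ite _ p q, a => p.writesMem a || q.writesMem a
  | loop _ p, a => p.writesMem a

end RamProg

/-- `s'` agrees with `s` on all registers and arrays that `p` does not write to. -/
def Frame (p : RamProg) (s s' : RamState) : Prop :=
  (∀ r, p.writesReg r = false → s'.reg r = s.reg r) ∧
    ∀ a, p.writesMem a = false → s'.mem a = s.mem a

/-- Which registers and arrays a program writes is decided by its syntax, so for concrete programs
preservation facts reduce to `rfl`. -/
theorem Exec.frame {p : RamProg} {s s' : RamState} {t : ℕ} (h : Exec p s t s') :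
    Frame p s s' := by
  induction h with
  | skip => exact ⟨fun _ _ => rfl, fun _ _ => rfl⟩
  | assign s x e =>
    refine ⟨fun r hr => ?_, fun _ _ => rfl⟩
    have : x ≠ r := by simpa [RamProg.writesReg] using hr
    exact Function.update_of_ne this.symm _ _
  | store s a i e =>
    refine ⟨fun _ _ => rfl, fun b hb => ?_⟩
    have : a ≠ b := by simpa [RamProg.writesMem] using hb
    exact Function.update_of_ne this.symm _ _
  | seq _ _ ih ih' =>
    refine ⟨fun r hr => ?_, fun a ha => ?_⟩
    · simp only [RamProg.writesReg, Bool.or_eq_false_iff] at hr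
      exact (ih'.1 r hr.2).trans (ih.1 r hr.1)
    · simp only [RamProg.writesMem, Bool.or_eq_false_iff] at ha
      exact (ih'.2 a ha.2).trans (ih.2 a ha.1)
  | ite_true _ _ ih =>
    refine ⟨fun r hr => ?_, fun a ha => ?_⟩
    · simp only [RamProg.writesReg, Bool.or_eq_false_iff] at hr
      exact ih.1 r hr.1
    · simp only [RamProg.writesMem, Bool.or_eq_false_iff] at ha
      exact ih.2 a ha.1
  | ite_false _ _ ih =>
    refine ⟨fun r hr => ?_, fun a ha => ?_⟩
    · simp only [RamProg.writesReg, Bool.or_eq_false_iff] at hr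
      exact ih.1 r hr.2
    · simp only [RamProg.writesMem, Bool.or_eq_false_iff] at ha
      exact ih.2 a ha.2
  | loop_exit => exact ⟨fun _ _ => rfl, fun _ _ => rfl⟩
  | loop_step _ _ _ ih ih' =>
    exact ⟨fun r hr => (ih'.1 r hr).trans (ih.1 r hr), fun a ha => (ih'.2 a ha).trans (ih.2 a ha)⟩

/-- Started in `s`, the program `p` halts within `t` steps in a state satisfying `Q`. -/
def Run (p : RamProg) (s : RamState) (t : ℕ) (Q : RamState → Prop) : Prop :=
  ∃ t' s', Exec p s t' s' ∧ t' ≤ t ∧ Q s'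

namespace Run

variable {p q : RamProg} {s : RamState} {t t₁ t₂ : ℕ} {Q Q' : RamState → Prop} {e : RamExpr}

/-- The frame is handed to the new postcondition, so postconditions need to mention only what
changes. -/
theorem mono (h : Run p s t₁ Q) (ht : t₁ ≤ t) (hQ : ∀ s', Q s' → Frame p s s' → Q' s') :
    Run p s t Q' := by
  obtain ⟨t', s', h, ht', hs⟩ := h
  exact ⟨t', s', h, ht'.trans ht, hQ s' hs h.frame⟩

theorem skip (h : Q s) : Run RamProg.skip s 1 Q := ⟨1, s, Exec.skip s, le_rfl, h⟩

theorem assign {x : ℕ} (h : Q (s.setReg x (e.eval s))) :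
    Run (RamProg.assign x e) s (e.cost + 1) Q :=
  ⟨_, _, Exec.assign s x e, le_rfl, h⟩

theorem store {a : ℕ} {i : RamExpr} (h : Q (s.setMem a (i.eval s) (e.eval s))) :
    Run (RamProg.store a i e) s (i.cost + e.cost + 1) Q :=
  ⟨_, _, Exec.store s a i e, le_rfl, h⟩

theorem seq (h : Run p s t₁ Q') (h' : ∀ s', Q' s' → Frame p s s' → Run q s' t₂ Q) :
    Run (RamProg.seq p q) s (t₁ + t₂) Q := by
  obtain ⟨a, s', h₁, ha, hs'⟩ := h
  obtain ⟨b, s'', h₂, hb, hs''⟩ := h' s' hs' h₁.frame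
  exact ⟨_, s'', h₁.seq h₂, Nat.add_le_add ha hb, hs''⟩

theorem assign_seq {x : ℕ} (h : Run q (s.setReg x (e.eval s)) t Q) :
    Run (RamProg.seq (RamProg.assign x e) q) s (e.cost + 1 + t) Q :=
  seq (Q' := fun s' => s' = s.setReg x (e.eval s)) (assign rfl) fun _ h' _ => h' ▸ h

theorem store_seq {a : ℕ} {i : RamExpr} (h : Run q (s.setMem a (i.eval s) (e.eval s)) t Q) :
    Run (RamProg.seq (RamProg.store a i e) q) s (i.cost + e.cost + 1 + t) Q :=
  seq (Q' := fun s' => s' = s.setMem a (i.eval s) (e.eval s)) (store rfl) fun _ h' _ => h' ▸ h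

theorem ite (h : e.eval s ≠ 0 → Run p s t Q) (h' : e.eval s = 0 → Run q s t Q) :
    Run (RamProg.ite e p q) s (e.cost + 1 + t) Q := by
  by_cases he : e.eval s = 0
  · obtain ⟨a, s', h₁, ha, hs'⟩ := h' he
    exact ⟨_, s', Exec.ite_false he h₁, by omega, hs'⟩
  · obtain ⟨a, s', h₁, ha, hs'⟩ := h he
    exact ⟨_, s', Exec.ite_true he h₁, by omega, hs'⟩

end Run

/-- The loop `for x := 0 to lim - 1 do p`, where `lim` is a register. -/
def RamProg.forTo (x lim : ℕ) (p : RamProg) : RamProg :=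
  RamProg.seq (RamProg.assign x (RamExpr.const 0))
    (RamProg.loop (RamExpr.sub (RamExpr.var lim) (RamExpr.var x))
      (RamProg.seq p (RamProg.assign x (RamExpr.add (RamExpr.var x) (RamExpr.const 1)))))

/-- Each round pays 4 for the test and 4 for the increment; the final 6 is the initial assignment
and the last test. By `hI` the invariant ignores the counter, which is incremented after `p` has
restored the invariant. -/
theorem Run.forTo {x lim : ℕ} {p : RamProg} {s : RamState} {T N : ℕ} (I : ℕ → RamState → Prop)
    (hN : s.reg lim = N) (hlim : p.writesReg lim = false) (hx : p.writesReg x = false)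
    (hne : x ≠ lim) (hI : ∀ i s' v, I i s' → I i (s'.setReg x v)) (h0 : I 0 s)
    (hstep : ∀ i < N, ∀ s', I i s' → s'.reg x = i → Frame (RamProg.forTo x lim p) s s' →
      Run p s' T (I (i + 1))) :
    Run (RamProg.forTo x lim p) s (N * (T + 8) + 6) (I N) := by
  set b := RamProg.seq p (RamProg.assign x (RamExpr.add (RamExpr.var x) (RamExpr.const 1))) with hb
  set c := RamExpr.sub (RamExpr.var lim) (RamExpr.var x) with hc
  have hfr : ∀ s', Frame b (s.setReg x 0) s' → Frame (RamProg.forTo x lim p) s s' := by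
    intro s' h
    refine ⟨fun r hr => ?_, fun a ha => ?_⟩
    · simp only [RamProg.forTo, RamProg.writesReg, Bool.or_eq_false_iff, decide_eq_false_iff_not]
        at hr
      rw [h.1 r (by simp [hb, RamProg.writesReg, hr]), RamState.setReg_reg,
        if_neg (Ne.symm hr.1)]
    · simp only [RamProg.forTo, RamProg.writesMem, Bool.or_eq_false_iff] at ha
      exact h.2 a (by simp [hb, RamProg.writesMem, ha])
  -- Induction on the number `j` of rounds that remain.
  have key : ∀ j i s', i + j = N → I i s' → s'.reg x = i → Frame b (s.setReg x 0) s' →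
      Run (RamProg.loop c b) s' (j * (T + 8) + 4) (I N) := by
    intro j
    induction j with
    | zero =>
      intro i s' hij hIi hxi hf
      have hl : s'.reg lim = N := by rw [(hfr s' hf).1 lim (by
        simp [RamProg.forTo, RamProg.writesReg, hlim, hne]), hN]
      exact ⟨_, s', Exec.loop_exit (by simp [hc, hl, hxi]; omega), by simp [hc], by
        rwa [← hij, Nat.add_zero]⟩
    | succ j ih =>
      intro i s' hij hIi hxi hf
      have hl : s'.reg lim = N := by rw [(hfr s' hf).1 lim (by
        simp [RamProg.forTo, RamProg.writesReg, hlim, hne]), hN]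
      obtain ⟨t₁, s₁, h₁, ht₁, hI₁⟩ := hstep i (by omega) s' hIi hxi (hfr s' hf)
      have hx₁ : s₁.reg x = i := (h₁.frame.1 x hx).trans hxi
      have hb' : Exec b s' (t₁ + 4) (s₁.setReg x (i + 1)) := by
        have := h₁.seq (Exec.assign s₁ x (RamExpr.add (RamExpr.var x) (RamExpr.const 1)))
        simpa [hb, hx₁, RamState.setReg] using this
      obtain ⟨t₂, s₂, h₂, ht₂, hI₂⟩ := ih (i + 1) (s₁.setReg x (i + 1)) (by omega) (hI _ _ _ hI₁)
        (by simp) ⟨fun r hr => (hb'.frame.1 r hr).trans (hf.1 r hr),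
          fun a ha => (hb'.frame.2 a ha).trans (hf.2 a ha)⟩
      refine ⟨_, s₂, Exec.loop_step (by simp [hc, hl, hxi]; omega) hb' h₂, ?_, hI₂⟩
      simp only [hc, RamExpr.cost]
      rw [Nat.succ_mul]
      omega
  have := key N 0 (s.setReg x 0) (by omega) (hI _ _ _ h0) (by simp)
    ⟨fun _ _ => rfl, fun _ _ => rfl⟩
  refine (Run.assign_seq this).mono ?_ fun _ h _ => h
  simp only [RamExpr.cost]
  omega

end Framework

/-! ### Counting and mapping loops, and the layout of the input word. -/

section Loops

open scoped Classical

/-- The indicator of a proposition. -/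
noncomputable def ind (p : Prop) : ℕ := if p then 1 else 0

@[simp] theorem ind_eq_zero {p : Prop} : ind p = 0 ↔ ¬ p := by
  unfold ind; split_ifs <;> simp [*]

theorem ind_of {p : Prop} (h : p) : ind p = 1 := if_pos h

theorem ind_of_not {p : Prop} (h : ¬ p) : ind p = 0 := if_neg h

theorem ind_and (p q : Prop) : ind (p ∧ q) = ind p + ind q - 1 := by
  by_cases hp : p <;> by_cases hq : q <;> simp [ind, hp, hq]

/-- `c := ∑ e`, the sum over those `x < lim` for which `cond` is nonzero after running `pre`. -/
def RamProg.countTo (x lim c : ℕ) (pre : RamProg) (cond e : RamExpr) : RamProg :=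
  RamProg.seq (RamProg.assign c (RamExpr.const 0))
    (RamProg.forTo x lim (RamProg.seq pre
      (RamProg.ite cond (RamProg.assign c (RamExpr.add (RamExpr.var c) e)) RamProg.skip)))

/-- Each hit adds `K`, so multiples of a count are obtained although the machine cannot multiply. -/
theorem Run.countTo {x lim c : ℕ} {pre : RamProg} {cond e : RamExpr} {s : RamState} {T N : ℕ}
    (P : ℕ → Prop) [DecidablePred P] (K : ℕ) (hN : s.reg lim = N)
    (hw : pre.writesReg lim = false ∧ pre.writesReg x = false ∧ pre.writesReg c = false)
    (hne : x ≠ lim ∧ c ≠ lim ∧ c ≠ x)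
    (hstep : ∀ i < N, ∀ s', s'.reg x = i → Frame (RamProg.countTo x lim c pre cond e) s s' →
      Run pre s' T fun s'' => (cond.eval s'' ≠ 0 ↔ P i) ∧ (P i → e.eval s'' = K)) :
    Run (RamProg.countTo x lim c pre cond e) s (N * (T + cond.cost + e.cost + 12) + 8)
      fun s' => s'.reg c = Nat.count P N * K := by
  have hfr : ∀ s', Frame (RamProg.forTo x lim (RamProg.seq pre
      (RamProg.ite cond (RamProg.assign c (RamExpr.add (RamExpr.var c) e)) RamProg.skip)))
      (s.setReg c 0) s' → Frame (RamProg.countTo x lim c pre cond e) s s' := by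
    refine fun s' h => ⟨fun r hr => ?_, fun a ha => ?_⟩
    · simp only [RamProg.countTo, RamProg.writesReg, Bool.or_eq_false_iff,
        decide_eq_false_iff_not] at hr
      rw [h.1 r hr.2, RamState.setReg_reg, if_neg (Ne.symm hr.1)]
    · simp only [RamProg.countTo, RamProg.writesMem, Bool.or_eq_false_iff] at ha
      exact h.2 a ha.2
  have h := Run.forTo (x := x) (lim := lim) (N := N) (s := s.setReg c 0)
    (p := RamProg.seq pre
      (RamProg.ite cond (RamProg.assign c (RamExpr.add (RamExpr.var c) e)) RamProg.skip))
    (T := T + (cond.cost + 1 + (e.cost + 3)))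
    (fun i s' => s'.reg c = Nat.count P i * K) (by simp [hN, Ne.symm hne.2.1])
    (by simp [RamProg.writesReg, hw.1, hne.2.1])
    (by simp [RamProg.writesReg, hw.2.1, hne.2.2]) hne.1
    (fun i s' v h => by simpa [hne.2.2] using h) (by simp) ?_
  · refine (Run.assign_seq h).mono ?_ fun _ h _ => h
    simp only [RamExpr.cost]
    ring_nf
    omega
  · intro i hi s' hI hx hf
    refine Run.seq (hstep i hi s' hx (hfr s' hf)) fun s'' h'' hf'' => ?_
    have hc : s''.reg c = Nat.count P i * K := (hf''.1 c hw.2.2).trans hI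
    refine Run.ite (fun he => ?_) fun he => ?_
    · have hP := h''.1.1 he
      refine (Run.assign ?_).mono (by simp; omega) fun _ h _ => h
      simp [hc, h''.2 hP, Nat.count_succ, hP]
      ring
    · have hP : ¬ P i := fun hP => h''.1.2 hP he
      refine (Run.skip ?_).mono (by omega) fun _ h _ => h
      simp [hc, Nat.count_succ, hP]

/-- `a[x] := e` for all `x < lim`. -/
def RamProg.mapTo (x lim a : ℕ) (e : RamExpr) : RamProg :=
  RamProg.forTo x lim (RamProg.store a (RamExpr.var x) e)

/-- When cell `i` is computed it still has its old value; thus `e` may read it, and an array can be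
updated in place. -/
theorem Run.mapTo {x lim a : ℕ} {e : RamExpr} {s : RamState} {N : ℕ} (F : ℕ → ℕ)
    (hN : s.reg lim = N) (hne : x ≠ lim)
    (hstep : ∀ i < N, ∀ s', s'.reg x = i → Frame (RamProg.mapTo x lim a e) s s' →
      s'.mem a i = s.mem a i → e.eval s' = F i) :
    Run (RamProg.mapTo x lim a e) s (N * (e.cost + 10) + 6)
      fun s' => ∀ j, s'.mem a j = if j < N then F j else s.mem a j := by
  have h := Run.forTo (x := x) (lim := lim) (N := N) (s := s)
    (p := RamProg.store a (RamExpr.var x) e) (T := 1 + e.cost + 1)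
    (fun i s' => ∀ j, s'.mem a j = if j < i then F j else s.mem a j) hN rfl rfl hne
    (fun i s' v h => h) (by simp) ?_
  · refine h.mono ?_ fun _ h _ => h
    refine Nat.add_le_add_right (Nat.mul_le_mul_left _ (by omega)) _
  · intro i hi s' hI hx hf
    refine Run.store fun j => ?_
    have he := hstep i hi s' hx hf (by simp [hI])
    simp only [RamState.setMem_mem, RamExpr.eval, hx, he, true_and]
    by_cases hj : j = i
    · simp [hj]
    · have : j < i + 1 ↔ j < i := by omega
      simp [hj, hI, this]

theorem count_eq_card_filter {n : ℕ} (p : Fin n → Prop) [DecidablePred p] (q : ℕ → Prop)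
    [DecidablePred q]
    (h : ∀ i : Fin n, q i ↔ p i) : Nat.count q n = (Finset.univ.filter p).card := by
  rw [Nat.count_eq_card_filter_range]
  refine (Finset.card_nbij (fun i : Fin n => i.val) ?_ ?_ ?_).symm
  · intro i hi
    have hp : p i := (Finset.mem_filter.1 hi).2
    exact Finset.mem_filter.2 ⟨Finset.mem_range.2 i.2, (h i).2 hp⟩
  · exact fun i _ j _ hij => Fin.ext hij
  · intro i hi
    simp only [Finset.coe_filter, Finset.mem_range, Set.mem_ofPred_eq] at hi
    exact ⟨⟨i, hi.1⟩, by simpa [h] using (h ⟨i, hi.1⟩).1 hi.2, rfl⟩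

theorem count_eq_zero_iff {n : ℕ} {q : ℕ → Prop} [DecidablePred q] : Nat.count q n = 0 ↔ ∀ i < n, ¬ q i := by
  rw [Nat.count_eq_card_filter_range, Finset.card_eq_zero, Finset.filter_eq_empty_iff]
  simp

theorem getD_flatMap {α : Type*} {f : α → List ℕ} {m : ℕ} (hf : ∀ a, (f a).length = m)
    (l : List α) {i j : ℕ} (hi : i < l.length) (hj : j < m) :
    (l.flatMap f).getD (i * m + j) 0 = (f l[i]).getD j 0 := by
  induction l generalizing i with
  | nil => simp at hi
  | cons a l ih =>
    rw [List.flatMap_cons]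
    cases i with
    | zero => rw [List.getD_append _ _ _ _ (by simp [hf, hj])]; simp
    | succ i =>
      rw [List.getD_append_right _ _ _ _ (by rw [hf]; nlinarith), hf,
        show (i + 1) * m + j - m = i * m + j by rw [Nat.succ_mul]; omega, ih (by simpa using hi)]
      simp

theorem length_encodeSet {n : ℕ} (S : Finset (Fin n)) : (encodeSet S).length = n := by
  simp [encodeSet]

theorem getD_encodeSet {n : ℕ} (S : Finset (Fin n)) (v : Fin n) :
    (encodeSet S).getD v 0 = ind (v ∈ S) := by
  simp [encodeSet, List.getD, ind]

theorem length_encodeGraph {n : ℕ} (G : SimpleGraph (Fin n)) : (encodeGraph G).length = n * n := by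
  simp [encodeGraph, List.length_flatMap]

theorem getD_encodeGraph {n : ℕ} (G : SimpleGraph (Fin n)) (u v : Fin n) :
    (encodeGraph G).getD (u * n + v) 0 = ind (G.Adj u v) := by
  unfold encodeGraph
  rw [getD_flatMap (m := n) (by simp) _ (by simp) v.2]
  simp [List.getD, ind]

namespace BicliqueFreeDSR

variable (x : BicliqueFreeDSR)

theorem length_encode : x.encode.length = x.n * x.n + 2 * x.n + 3 := by
  simp [encode, length_encodeGraph, length_encodeSet]
  ring

theorem getD_encode_adj (u v : Fin x.n) :
    x.encode.getD (3 + u * x.n + v) 0 = ind (x.G.Adj u v) := by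
  have h : u * x.n + v < x.n * x.n := by
    have := Nat.mul_le_mul_right x.n u.2
    rw [Nat.succ_mul] at this
    omega
  rw [encode, List.append_assoc, List.append_assoc, List.getD_append_right _ _ _ _ (by simp; omega),
    List.getD_append _ _ _ _ (by simp [length_encodeGraph]; omega), ← getD_encodeGraph]
  congr 1
  simp; omega

theorem getD_encode_source (v : Fin x.n) :
    x.encode.getD (3 + x.n * x.n + v) 0 = ind (v ∈ x.Ds) := by
  rw [encode, List.append_assoc, List.append_assoc, List.getD_append_right _ _ _ _ (by simp; omega),
    List.getD_append_right _ _ _ _ (by simp [length_encodeGraph]; omega),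
    List.getD_append _ _ _ _ (by simp [length_encodeGraph, length_encodeSet]; omega),
    ← getD_encodeSet]
  congr 1
  simp [length_encodeGraph]; omega

theorem getD_encode_target (v : Fin x.n) :
    x.encode.getD (3 + x.n * x.n + x.n + v) 0 = ind (v ∈ x.Dt) := by
  rw [encode, List.append_assoc, List.append_assoc, List.getD_append_right _ _ _ _ (by simp; omega),
    List.getD_append_right _ _ _ _ (by simp [length_encodeGraph]; omega),
    List.getD_append_right _ _ _ _ (by simp [length_encodeGraph, length_encodeSet]; omega),
    ← getD_encodeSet]
  congr 1
  simp [length_encodeGraph, length_encodeSet]; omega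

end BicliqueFreeDSR

end Loops

/-! ### Reading the input. -/

section Init

open scoped Classical

open RamExpr RamProg

infixr:60 " ;; " => RamProg.seq

/-- Reads the entry `u, v` of the closed adjacency matrix. -/
abbrev nbExpr (u v : RamExpr) : RamExpr := arr 0 (add (arr 2 u) v)

/-- Array `a` holds the indicator function of the set `S`. -/
def Holds {n : ℕ} (s : RamState) (a : ℕ) (S : Finset (Fin n)) : Prop :=
  ∀ v : Fin n, s.mem a v = ind (v ∈ S)

theorem Holds.frame {n : ℕ} {s s' : RamState} {a : ℕ} {S : Finset (Fin n)} (h : Holds s a S)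
    (h' : s'.mem a = s.mem a) : Holds s' a S := fun v => by rw [h', h]

/-- The input has been read: sizes, closed adjacency matrix, source and target are in place. -/
structure Loaded (x : BicliqueFreeDSR) (s : RamState) : Prop where
  n : s.reg 1 = x.n
  k : s.reg 2 = x.k
  d : s.reg 3 = x.d
  k1 : s.reg 4 = x.k + 1
  adj : ∀ u v : Fin x.n, s.mem 0 (s.mem 2 u + v) = ind (CAdj x.G u v)
  source : Holds s 13 x.Ds
  target : Holds s 14 x.Dt

/-- The program does not touch the data described by `Loaded`. -/
def RamProg.KeepsInput (p : RamProg) : Prop :=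
  (p.writesReg 1 || p.writesReg 2 || p.writesReg 3 || p.writesReg 4 || p.writesMem 0 ||
    p.writesMem 2 || p.writesMem 13 || p.writesMem 14) = false

theorem Loaded.frame {x : BicliqueFreeDSR} {p : RamProg} {s s' : RamState} (h : Loaded x s)
    (hf : Frame p s s') (hp : p.KeepsInput) : Loaded x s' := by
  simp only [RamProg.KeepsInput, Bool.or_eq_false_iff] at hp
  obtain ⟨⟨⟨⟨⟨⟨⟨h1, h2⟩, h3⟩, h4⟩, m0⟩, m2⟩, m13⟩, m14⟩ := hp
  exact ⟨by rw [hf.1 1 h1, h.n], by rw [hf.1 2 h2, h.k], by rw [hf.1 3 h3, h.d],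
    by rw [hf.1 4 h4, h.k1], by rw [hf.2 0 m0, hf.2 2 m2]; exact h.adj,
    h.source.frame (hf.2 13 m13), h.target.frame (hf.2 14 m14)⟩

theorem Loaded.setReg {x : BicliqueFreeDSR} {s : RamState} (h : Loaded x s) {r : ℕ} (hr : 5 ≤ r)
    (v : ℕ) : Loaded x (s.setReg r v) := by
  refine ⟨?_, ?_, ?_, ?_, h.adj, h.source, h.target⟩
  · rw [RamState.setReg_reg, if_neg (by omega), h.n]
  · rw [RamState.setReg_reg, if_neg (by omega), h.k]
  · rw [RamState.setReg_reg, if_neg (by omega), h.d]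
  · rw [RamState.setReg_reg, if_neg (by omega), h.k1]

/-- Reads the input. -/
def loadProg : RamProg :=
  assign 1 (arr 0 (const 0)) ;; assign 2 (arr 0 (const 1)) ;; assign 3 (arr 0 (const 2)) ;;
  assign 4 (add (var 2) (const 1)) ;; assign 5 (const 3) ;;
  forTo 6 1 (store 2 (var 6) (var 5) ;; store 0 (add (var 5) (var 6)) (const 1) ;;
    assign 5 (add (var 5) (var 1))) ;;
  mapTo 6 1 13 (arr 0 (add (var 5) (var 6))) ;;
  mapTo 6 1 14 (arr 0 (add (add (var 5) (var 1)) (var 6)))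

theorem eq_of_mul_add_eq {n a b c d : ℕ} (hb : b < n) (hd : d < n)
    (h : a * n + b = c * n + d) : a = c := by
  rcases lt_trichotomy a c with hac | hac | hac
  · have := Nat.mul_le_mul_right n hac
    rw [Nat.succ_mul] at this
    omega
  · exact hac
  · have := Nat.mul_le_mul_right n hac
    rw [Nat.succ_mul] at this
    omega

/-- Array `2` receives the row offsets `3 + u * n` by repeated addition, which replaces
multiplication in later accesses. Ones on the diagonal turn the adjacency matrix into the closed
one. -/
theorem run_load (x : BicliqueFreeDSR) :
    Run loadProg (initState x.encode) (70 * x.n + 70) (Loaded x) := by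
  set w := x.encode with hw
  have e0 : w.getD 0 0 = x.n := by simp [hw, BicliqueFreeDSR.encode]
  have e1 : w.getD 1 0 = x.k := by simp [hw, BicliqueFreeDSR.encode]
  have e2 : w.getD 2 0 = x.d := by simp [hw, BicliqueFreeDSR.encode]
  have m0 : ∀ i, (initState w).mem 0 i = w.getD i 0 := fun i => by simp [initState]
  set s5 := (((((initState w).setReg 1 x.n).setReg 2 x.k).setReg 3 x.d).setReg 4 (x.k + 1)).setReg 5 3
    with hs5
  have hloop := Run.forTo (x := 6) (lim := 1) (N := x.n) (s := s5)
    (p := store 2 (var 6) (var 5) ;; store 0 (add (var 5) (var 6)) (const 1) ;;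
      assign 5 (add (var 5) (var 1))) (T := 15)
    (fun i s => s.reg 5 = 3 + i * x.n ∧ (∀ u < i, s.mem 2 u = 3 + u * x.n) ∧
      ∀ j, s.mem 0 j = if ∃ u < i, j = 3 + u * x.n + u then 1 else w.getD j 0)
    (by simp [hs5]) rfl rfl (by decide)
    (fun i s v h => by simpa using h) (by simp [hs5, initState]) ?_
  · unfold loadProg
    refine (Run.assign_seq <| Run.assign_seq <| Run.assign_seq <| Run.assign_seq <|
      Run.assign_seq <| Run.seq (t₁ := x.n * 23 + 6) (t₂ := x.n * 14 + 6 + (x.n * 16 + 6))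
      (Q' := fun s => s.reg 5 = 3 + x.n * x.n ∧ (∀ u < x.n, s.mem 2 u = 3 + u * x.n) ∧
        (∀ j, s.mem 0 j = if ∃ u < x.n, j = 3 + u * x.n + u then 1 else w.getD j 0) ∧
        s.reg 1 = x.n ∧ s.reg 2 = x.k ∧ s.reg 3 = x.d ∧ s.reg 4 = x.k + 1) ?_ ?_).mono
      (by simp; omega) fun _ h _ => h
    · simp only [RamExpr.eval, RamState.setReg_mem, m0, e0, e1, e2, RamState.setReg_reg]
      refine hloop.mono le_rfl fun s h hf => ⟨h.1, h.2.1, h.2.2, ?_⟩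
      rw [hf.1 1 rfl, hf.1 2 rfl, hf.1 3 rfl, hf.1 4 rfl]
      simp [hs5]
    · rintro s ⟨h5, h2, h0, r1, r2, r3, r4⟩ -
      -- The diagonal cells lie inside the matrix, so the words of source and target are still
      -- intact.
      have hset : ∀ j, 3 + x.n * x.n ≤ j → s.mem 0 j = w.getD j 0 := by
        intro j hj
        rw [h0, if_neg]
        rintro ⟨u, hu, rfl⟩
        have := Nat.mul_le_mul_right x.n (Nat.succ_le_of_lt hu)
        rw [Nat.succ_mul] at this
        omega
      refine Run.seq ((Run.mapTo (fun i => w.getD (3 + x.n * x.n + i) 0) r1 (show 6 ≠ 1 by decide)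
        ?_).mono (le_of_eq (by simp)) fun _ h _ => h) ?_
      · intro i hi s' hx hf _
        have h5' := hf.1 5 rfl
        have h0' := hf.2 0 rfl
        simp only [RamExpr.eval, hx, h5', h0', h5]
        exact hset _ (by omega)
      intro s1 h13 hf1
      refine (Run.mapTo (fun i => w.getD (3 + x.n * x.n + x.n + i) 0)
        ((hf1.1 1 rfl).trans r1) (by decide) ?_).mono (le_of_eq (by simp)) ?_
      · intro i hi s' hx hf _
        have h5' := (hf.1 5 rfl).trans (hf1.1 5 rfl)
        have h1' := (hf.1 1 rfl).trans (hf1.1 1 rfl)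
        have h0' := (hf.2 0 rfl).trans (hf1.2 0 rfl)
        simp only [RamExpr.eval, hx, h5', h0', h1', h5, r1]
        exact hset _ (by omega)
      · intro s2 h14 hf2
        refine ⟨?_, ?_, ?_, ?_, ?_, ?_, ?_⟩
        · rw [hf2.1 1 rfl, hf1.1 1 rfl, r1]
        · rw [hf2.1 2 rfl, hf1.1 2 rfl, r2]
        · rw [hf2.1 3 rfl, hf1.1 3 rfl, r3]
        · rw [hf2.1 4 rfl, hf1.1 4 rfl, r4]
        · intro u v
          rw [hf2.2 0 rfl, hf1.2 0 rfl, hf2.2 2 rfl, hf1.2 2 rfl, h2 u u.2, h0]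
          by_cases huv : u = v
          · rw [if_pos ⟨u, u.2, by rw [huv]⟩, ind_of (show CAdj _ _ _ from Or.inl huv)]
          · rw [if_neg, x.getD_encode_adj]
            · simp [CAdj, huv]
            · rintro ⟨u', hu', he⟩
              have h1 : (u : ℕ) * x.n + v = u' * x.n + u' := by omega
              have h2 : (u : ℕ) = u' := eq_of_mul_add_eq v.2 hu' h1
              subst h2
              exact huv (Fin.ext (by omega))
        · intro v
          rw [hf2.2 13 rfl, h13, if_pos v.2, x.getD_encode_source]
        · intro v
          rw [h14, if_pos v.2, x.getD_encode_target]
  · rintro i hi s ⟨h5, h2, h0⟩ hx hf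
    have h1 : s.reg 1 = x.n := hf.1 1 rfl
    refine (Run.store_seq <| Run.store_seq <| Run.assign ?_).mono (by simp) fun _ h _ => h
    refine ⟨by simp [h5, h1]; ring, fun u hu => ?_, fun j => ?_⟩
    · rcases Nat.lt_succ_iff_lt_or_eq.1 hu with hu' | rfl
      · simp [hx, hu'.ne, h2 u hu']
      · simp [hx, h5]
    · simp only [RamState.setReg_mem, RamState.setMem_mem, RamExpr.eval, RamState.setMem_reg, h5, hx,
        true_and]
      by_cases hj : j = 3 + i * x.n + i
      · rw [if_pos hj, if_pos ⟨i, by omega, hj⟩]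
      · rw [if_neg hj, if_neg (by simp), h0]
        refine if_congr ⟨?_, ?_⟩ rfl rfl
        · rintro ⟨u, hu, h⟩
          exact ⟨u, by omega, h⟩
        · rintro ⟨u, hu, h⟩
          refine ⟨u, ?_, h⟩
          rcases Nat.lt_succ_iff_lt_or_eq.1 hu with hu' | rfl
          · exact hu'
          · exact absurd h hj

end Init

/-! ### One round of the greedy computation of a core. -/

section Core

open Finset
open scoped Classical

open RamExpr RamProg

theorem Run.countFin {n x lim c : ℕ} {pre : RamProg} {cond e : RamExpr} {s : RamState} {T : ℕ}
    (p : Fin n → Prop) [DecidablePred p] (K : ℕ) (hN : s.reg lim = n)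
    (hw : pre.writesReg lim = false ∧ pre.writesReg x = false ∧ pre.writesReg c = false)
    (hne : x ≠ lim ∧ c ≠ lim ∧ c ≠ x)
    (hstep : ∀ i : Fin n, ∀ s' : RamState, s'.reg x = i → Frame (RamProg.countTo x lim c pre cond e) s s' →
      Run pre s' T fun s'' => (cond.eval s'' ≠ 0 ↔ p i) ∧ (p i → e.eval s'' = K)) :
    Run (RamProg.countTo x lim c pre cond e) s (n * (T + cond.cost + e.cost + 12) + 8)
      fun s' => s'.reg c = (univ.filter p).card * K := by
  refine (Run.countTo (T := T) (fun i => ∃ h : i < n, p ⟨i, h⟩) K hN hw hne fun i hi s' hx hf =>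
    (hstep ⟨i, hi⟩ s' hx hf).mono le_rfl fun s'' h _ => ?_).mono le_rfl fun s' h _ => ?_
  · simpa [hi] using h
  · rw [h, count_eq_card_filter p _ fun i => by simp]

theorem Run.mapFin {n x lim a : ℕ} {e : RamExpr} {s : RamState} (S : Finset (Fin n))
    (hN : s.reg lim = n) (hne : x ≠ lim)
    (hstep : ∀ i : Fin n, ∀ s' : RamState, s'.reg x = i → Frame (RamProg.mapTo x lim a e) s s' →
      s'.mem a i = s.mem a i → e.eval s' = ind (i ∈ S)) :
    Run (RamProg.mapTo x lim a e) s (n * (e.cost + 10) + 6) fun s' => Holds s' a S := by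
  refine (Run.mapTo (fun i => ind (∃ h : i < n, (⟨i, h⟩ : Fin n) ∈ S)) hN hne fun i hi s' hx hf hm =>
    ?_).mono le_rfl fun s' h _ v => ?_
  · rw [hstep ⟨i, hi⟩ s' hx hf hm]
    simp [hi]
  · rw [h, if_pos v.2]
    simp

theorem Holds.update {n : ℕ} {s : RamState} {a : ℕ} {S : Finset (Fin n)} (h : Holds s a S)
    {S' : Finset (Fin n)} {c : Fin n} {b : ℕ} (hc : b = ind (c ∈ S'))
    (hS : ∀ v ≠ c, v ∈ S' ↔ v ∈ S) : Holds (s.setMem a c b) a S' := by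
  intro v
  by_cases hv : v = c
  · subst hv
    simp [hc]
  · have : (v : ℕ) ≠ c := fun h => hv (Fin.ext h)
    simp [this, h v, hS v hv]

/-- Finds a vertex that is not used and dominates the largest number of candidates; this number times
`k + 1` is left in register `10`. -/
def bestProg : RamProg :=
  assign 10 (const 0) ;; assign 11 (const 0) ;;
  forTo 12 1
    (countTo 6 1 13 skip (sub (add (arr 4 (var 6)) (nbExpr (var 12) (var 6))) (const 1)) (var 4) ;;
      ite (arr 5 (var 12)) skip
        (ite (sub (var 13) (var 10)) (assign 10 (var 13) ;; assign 11 (var 12)) skip))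

/-- Removes a candidate from the core in array `3` and from the candidates in array `4`. -/
def removeProg : RamProg :=
  forTo 6 1 (ite (arr 4 (var 6)) (assign 14 (var 6)) skip) ;;
  store 3 (var 14) (const 0) ;; store 4 (var 14) (const 0)

/-- Restricts the candidates to the closed neighbourhood of the vertex found by `bestProg`. -/
def restrictProg : RamProg :=
  store 5 (var 11) (const 1) ;;
  mapTo 6 1 4 (sub (add (arr 4 (var 6)) (nbExpr (var 11) (var 6))) (const 1))

/-- One round of the greedy procedure. -/
def roundProg : RamProg :=
  countTo 6 1 9 skip (arr 4 (var 6)) (const 1) ;; bestProg ;;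
  ite (sub (var 9) (add (var 10) (const 1))) removeProg restrictProg

/-- The effect of one round on the core `C`, the candidates `A` and the used vertices `U`. -/
def RoundStep {V : Type*} [DecidableEq V] (G : SimpleGraph V) (q : ℕ) (C A U C' A' U' : Finset V) :
    Prop :=
  (∃ b, (∀ v ∉ U, (A.filter fun a => CAdj G v a).card ≤ b) ∧ b * q + 1 < A.card ∧
    ∃ c ∈ A, C' = C.erase c ∧ A' = A.erase c ∧ U' = U) ∨
  ∃ v, C' = C ∧ A' = A.filter (fun a => CAdj G v a) ∧ U' = insert v U ∧
    A.card ≤ A'.card * q + 1 ∧ (v ∉ U ∨ A.card ≤ 1)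

/-- The data of a round: core, candidates and used vertices. -/
structure RoundData (x : BicliqueFreeDSR) (s : RamState) (C A U : Finset (Fin x.n)) : Prop where
  loaded : Loaded x s
  core : Holds s 3 C
  cand : Holds s 4 A
  used : Holds s 5 U

namespace RoundData

variable {x : BicliqueFreeDSR} {s : RamState} {C A U : Finset (Fin x.n)}

theorem frame (h : RoundData x s C A U) {p : RamProg} {s' : RamState} (hf : Frame p s s')
    (hp : p.KeepsInput) (hp' : (p.writesMem 3 || p.writesMem 4 || p.writesMem 5) = false) :
    RoundData x s' C A U := by
  simp only [Bool.or_eq_false_iff] at hp'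
  exact ⟨h.loaded.frame hf hp, h.core.frame (hf.2 3 hp'.1.1), h.cand.frame (hf.2 4 hp'.1.2),
    h.used.frame (hf.2 5 hp'.2)⟩

theorem setReg (h : RoundData x s C A U) {r : ℕ} (hr : 5 ≤ r) (v : ℕ) :
    RoundData x (s.setReg r v) C A U := ⟨h.loaded.setReg hr v, h.core, h.cand, h.used⟩

theorem eval_nb (h : Loaded x s) {u v : Fin x.n} {a b : RamExpr} (ha : a.eval s = u)
    (hb : b.eval s = v) : (nbExpr a b).eval s = ind (CAdj x.G u v) := by
  simp only [RamExpr.eval, ha, hb, h.adj]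

/-- The count is kept multiplied by `k + 1`, ready to be compared with `|A|`. The recorded vertex is
meaningful only for `b ≠ 0`. -/
theorem run_best (h : RoundData x s C A U) (hn : 0 < x.n) :
    Run bestProg s (x.n * (x.n * 24 + 41) + 10) fun s' => ∃ b, s'.reg 10 = b * (x.k + 1) ∧
      (∀ v ∉ U, (A.filter fun a => CAdj x.G v a).card ≤ b) ∧ ∃ v : Fin x.n, s'.reg 11 = v ∧
        (b = 0 ∨ v ∉ U ∧ (A.filter fun a => CAdj x.G v a).card = b) := by
  unfold bestProg
  refine (Run.assign_seq <| Run.assign_seq <| Run.forTo (N := x.n) (T := x.n * 24 + 33)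
    (fun i s' => ∃ b, s'.reg 10 = b * (x.k + 1) ∧
      (∀ v ∉ U, (v : ℕ) < i → (A.filter fun a => CAdj x.G v a).card ≤ b) ∧
      ∃ v : Fin x.n, s'.reg 11 = v ∧ (b = 0 ∨ v ∉ U ∧ (A.filter fun a => CAdj x.G v a).card = b))
    (by simp [h.loaded.n]) rfl rfl (by decide) (fun i s' v h => by simpa using h)
    ⟨0, by simp, by simp, ⟨0, hn⟩, by simp⟩ ?_).mono (by simp; ring_nf; omega) ?_
  · rintro i hi s1 ⟨b, h10, hb, v, h11, hv⟩ hx hf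
    have h1 := ((h.setReg (r := 10) (by norm_num) 0).setReg (r := 11) (by norm_num) 0).frame hf rfl rfl
    refine (Run.seq (Run.countFin (n := x.n) (T := 1) (fun a => a ∈ A ∧ CAdj x.G ⟨i, hi⟩ a) (x.k + 1)
      h1.loaded.n (by decide) (by decide) ?_) (t₂ := 13) ?_).mono
      (by simp) fun _ h _ => h
    · intro u s2 hu hf2
      have h2 := h1.frame hf2 rfl rfl
      refine Run.skip ⟨?_, fun _ => h2.loaded.k1⟩
      have e12 : s2.reg 12 = i := (hf2.1 12 rfl).trans hx
      change s2.mem 4 (s2.reg 6) + (nbExpr (var 12) (var 6)).eval s2 - 1 ≠ 0 ↔ _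
      rw [eval_nb h2.loaded (a := var 12) (b := var 6) (u := ⟨i, hi⟩) (v := u) e12 hu, hu, h2.cand u,
        ← ind_and, Ne, ind_eq_zero, not_not]
    · intro s2 h13 hf2
      have h2 := h1.frame hf2 rfl rfl
      have e12 : s2.reg 12 = i := (hf2.1 12 rfl).trans hx
      have e10 : s2.reg 10 = b * (x.k + 1) := (hf2.1 10 rfl).trans h10
      have e11 : s2.reg 11 = v := (hf2.1 11 rfl).trans h11
      have ecard : (univ.filter fun a => a ∈ A ∧ CAdj x.G ⟨i, hi⟩ a) =
          A.filter fun a => CAdj x.G ⟨i, hi⟩ a := by ext; simp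
      rw [ecard] at h13
      have e5 : (arr 5 (var 12)).eval s2 = ind ((⟨i, hi⟩ : Fin x.n) ∈ U) := by
        rw [← h2.used]
        simp [e12]
      refine (Run.ite (t := 10) (fun h0 => (Run.skip ?_).mono (by norm_num) fun _ h _ => h) fun h0 =>
        (Run.ite (t := 4) (fun h3 => Run.assign_seq <| Run.assign ?_)
          fun h3 => (Run.skip ?_).mono (by norm_num) fun _ h _ => h).mono (by simp)
          fun _ h _ => h).mono (by simp) fun _ h _ => h
      · rw [e5, Ne, ind_eq_zero, not_not] at h0
        refine ⟨b, e10, fun w hw hwi => ?_, v, e11, hv⟩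
        rcases Nat.lt_succ_iff_lt_or_eq.1 hwi with hlt | heq
        · exact hb w hw hlt
        · exact absurd ((Fin.ext heq : w = ⟨i, hi⟩) ▸ h0) hw
      · rw [e5, ind_eq_zero] at h0
        simp only [RamExpr.eval, h13, e10] at h3
        have hlt : b < (A.filter fun a => CAdj x.G ⟨i, hi⟩ a).card := by
          by_contra! hle
          exact h3 (Nat.sub_eq_zero_of_le (Nat.mul_le_mul_right _ hle))
        refine ⟨(A.filter fun a => CAdj x.G ⟨i, hi⟩ a).card, by simp [h13], fun w hw hwi => ?_,
          ⟨i, hi⟩, by simp [e12], Or.inr ⟨h0, rfl⟩⟩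
        rcases Nat.lt_succ_iff_lt_or_eq.1 hwi with hlt' | heq
        · exact (hb w hw hlt').trans hlt.le
        · rw [(Fin.ext heq : w = ⟨i, hi⟩)]
      · rw [e5, ind_eq_zero] at h0
        simp only [RamExpr.eval, h13, e10] at h3
        have hle : (A.filter fun a => CAdj x.G ⟨i, hi⟩ a).card ≤ b := by
          by_contra! hlt
          have := Nat.mul_lt_mul_of_pos_right hlt (Nat.succ_pos x.k)
          simp only [Nat.succ_eq_add_one] at this
          omega
        refine ⟨b, e10, fun w hw hwi => ?_, v, e11, hv⟩
        rcases Nat.lt_succ_iff_lt_or_eq.1 hwi with hlt' | heq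
        · exact hb w hw hlt'
        · rw [(Fin.ext heq : w = ⟨i, hi⟩)]
          exact hle
  · rintro s' ⟨b, h1, h2, h3⟩ -
    exact ⟨b, h1, fun v hv => h2 v hv v.2, h3⟩

theorem run_remove (h : RoundData x s C A U) (hA : A.Nonempty) :
    Run removeProg s (x.n * 14 + 12) fun s' => ∃ c ∈ A, RoundData x s' (C.erase c) (A.erase c) U := by
  unfold removeProg
  refine (Run.seq (t₂ := 6) (Run.forTo (N := x.n) (T := 6)
    -- The invariant is conditional: before the first candidate is met, register `14` holds nothing
    -- useful.
    (fun i s' => (∃ a ∈ A, (a : ℕ) < i) → ∃ a ∈ A, s'.reg 14 = a) h.loaded.n rfl rfl (by decide)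
    (fun i s' v h => by simpa using h) (by simp) ?_) ?_).mono (by omega) fun _ h _ => h
  · intro i hi s1 hI hx hf
    have h1 := h.frame hf rfl rfl
    have e4 : (arr 4 (var 6)).eval s1 = ind ((⟨i, hi⟩ : Fin x.n) ∈ A) := by
      rw [← h1.cand]
      simp [hx]
    refine (Run.ite (t := 2) (fun h0 => Run.assign fun _ => ?_) fun h0 =>
      (Run.skip ?_).mono (by norm_num) fun _ h _ => h).mono (by simp) fun _ h _ => h
    · rw [e4, Ne, ind_eq_zero, not_not] at h0
      exact ⟨⟨i, hi⟩, h0, by simp [hx]⟩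
    · rw [e4, ind_eq_zero] at h0
      rintro ⟨a, ha, hai⟩
      refine hI ⟨a, ha, ?_⟩
      rcases Nat.lt_succ_iff_lt_or_eq.1 hai with hlt | heq
      · exact hlt
      · exact absurd ((Fin.ext heq : a = ⟨i, hi⟩) ▸ ha) h0
  · intro s1 hI hf
    have h1 := h.frame hf rfl rfl
    obtain ⟨a, ha⟩ := hA
    obtain ⟨c, hc, h14⟩ := hI ⟨a, ha, a.2⟩
    refine (Run.store_seq <| Run.store ?_).mono (by simp) fun _ h _ => h
    refine ⟨c, hc, ⟨?_, ?_, ?_, ?_⟩⟩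
    · obtain ⟨n, k, d, k1, adj, source, target⟩ := h1.loaded
      exact ⟨n, k, d, k1, by simpa using adj, source.frame (by ext; simp), target.frame (by ext; simp)⟩
    · have := h1.core.update (S' := C.erase c) (c := c) (b := 0) (by simp [ind_of_not])
        fun v hv => by simp [hv]
      exact this.frame (by ext; simp [h14])
    · have h4 : Holds (s1.setMem 3 c 0) 4 A := h1.cand.frame (by ext; simp)
      have := h4.update (S' := A.erase c) (c := c) (b := 0) (by simp [ind_of_not])
        fun v hv => by simp [hv]
      exact this.frame (by ext; simp [h14])
    · exact h1.used.frame (by ext; simp)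

theorem run_restrict (h : RoundData x s C A U) {v : Fin x.n} (hv : s.reg 11 = v) :
    Run restrictProg s (x.n * 20 + 10) fun s' =>
      RoundData x s' C (A.filter fun a => CAdj x.G v a) (insert v U) := by
  unfold restrictProg
  set s1 := s.setMem 5 v 1 with hs1
  have h1 : RoundData x s1 C A (insert v U) := by
    refine ⟨?_, h.core.frame (by ext; simp [hs1]), h.cand.frame (by ext; simp [hs1]), ?_⟩
    · obtain ⟨n, k, d, k1, adj, source, target⟩ := h.loaded
      exact ⟨n, k, d, k1, by simpa [hs1] using adj, source.frame (by ext; simp [hs1]),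
        target.frame (by ext; simp [hs1])⟩
    · exact h.used.update (by simp [ind_of]) fun w hw => by simp [hw]
  have := (Run.mapFin (x := 6) (a := 4) (A.filter fun a => CAdj x.G v a) h1.loaded.n
    (by decide) (e := sub (add (arr 4 (var 6)) (nbExpr (var 11) (var 6))) (const 1)) ?_).mono
      (t := x.n * 20 + 6) (by simp) (Q' := fun s' =>
      RoundData x s' C (A.filter fun a => CAdj x.G v a) (insert v U)) fun s' hA hf =>
      ⟨h1.loaded.frame hf rfl, h1.core.frame (hf.2 3 rfl), hA, h1.used.frame (hf.2 5 rfl)⟩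
  · refine (Run.store_seq (t := x.n * 20 + 6) ?_).mono (by simp; omega) fun _ h _ => h
    simpa only [RamExpr.eval, hv] using this
  · intro u s2 hu hf hm
    have h2 := h1.loaded.frame hf rfl
    have e11 : s2.reg 11 = v := (hf.1 11 rfl).trans hv
    change s2.mem 4 (s2.reg 6) + (nbExpr (var 11) (var 6)).eval s2 - 1 = _
    rw [eval_nb h2 (a := var 11) (b := var 6) (u := v) (v := u) e11 hu, hu, hm, h1.cand u, ← ind_and,
      mem_filter]

end RoundData

theorem run_round {x : BicliqueFreeDSR} {s : RamState} {C A U : Finset (Fin x.n)}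
    (h : RoundData x s C A U) (hn : 0 < x.n) :
    Run roundProg s (100 * (x.n + 1) * (x.n + 1)) fun s' => ∃ C' A' U' : Finset (Fin x.n),
      RoundData x s' C' A' U' ∧ RoundStep x.G (x.k + 1) C A U C' A' U' := by
  unfold roundProg
  refine (Run.seq ((Run.countFin (T := 1) (fun v => v ∈ A) 1 h.loaded.n (by decide) (by decide) ?_)) ?_
    (t₂ := (x.n * (x.n * 24 + 41) + 10 + (x.n * 20 + 30)))).mono ?_ fun _ h _ => h
  · intro v s1 hv hf
    have h1 := h.frame hf rfl rfl
    refine Run.skip ⟨?_, fun _ => rfl⟩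
    rw [RamExpr.eval, RamExpr.eval, hv, h1.cand v, Ne, ind_eq_zero, not_not]
  · intro s1 h9 hf1
    have h1 := h.frame hf1 rfl rfl
    refine Run.seq (h1.run_best hn) ?_
    rintro s2 ⟨b, h10, hb, v, h11, hv⟩ hf2
    have h2 := h1.frame hf2 rfl rfl
    have e9 : s2.reg 9 = A.card := by
      rw [hf2.1 9 rfl, h9]
      simp
    refine (Run.ite (t := x.n * 20 + 12) (fun h0 => ?_) fun h0 => ?_).mono (by simp; omega) fun _ h _ => h
    · simp only [RamExpr.eval, e9, h10] at h0
      refine (h2.run_remove (card_pos.1 (by omega))).mono (by omega) ?_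
      rintro s3 ⟨c, hc, h3⟩ -
      exact ⟨_, _, _, h3, Or.inl ⟨b, hb, by omega, c, hc, rfl, rfl, rfl⟩⟩
    · simp only [RamExpr.eval, e9, h10] at h0
      refine (h2.run_restrict h11).mono (by omega) fun s3 h3 _ => ⟨_, _, _, h3, Or.inr ⟨v, rfl, rfl, rfl,
        ?_⟩⟩
      rcases hv with rfl | ⟨hvU, rfl⟩
      · exact ⟨by omega, Or.inr (by omega)⟩
      · exact ⟨by omega, Or.inl hvU⟩
  · simp
    nlinarith

end Core

/-! ### Iterating the rounds until the core is small. -/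

section CoreLoop

open Finset
open scoped Classical

open RamExpr RamProg

/-- The invariant of the rounds: `C` arises from `C₀` by removing vertices, and unless a vertex has
been removed, `r` rounds have not decreased the set `A` of candidates by too much. -/
structure RoundInv {V : Type*} (G : SimpleGraph V) (q r : ℕ) (C₀ C A U : Finset V) : Prop where
  core : IsCore G q C
  subset : A ⊆ C
  adj : ∀ u ∈ U, ∀ a ∈ A, CAdj G u a
  card : C.card < C₀.card ∨ C.card = C₀.card ∧ C.card + 1 ≤ q ^ r * (A.card + 1) ∧
    (A.card ≤ 1 ∨ U.card = r)

/-- A removal makes the core smaller than `C₀` for good, so nothing else need be tracked afterwards.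
Without removals the estimates are those of `exists_core`. -/
theorem RoundInv.step {V : Type*} [DecidableEq V] {G : SimpleGraph V} {q r : ℕ}
    {C₀ C A U C' A' U' : Finset V} (hq : 2 ≤ q) (h : RoundInv G q r C₀ C A U)
    (hs : RoundStep G q C A U C' A' U') : RoundInv G q (r + 1) C₀ C' A' U' := by
  rcases hs with ⟨b, hb, hA, c, hc, rfl, rfl, rfl⟩ | ⟨v, rfl, rfl, rfl, hA, hv⟩
  · refine ⟨h.core.erase h.subset h.adj hb hA hc, erase_subset_erase _ h.subset,
      fun u hu a ha => h.adj u hu a (mem_of_mem_erase ha), Or.inl ?_⟩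
    have := card_erase_lt_of_mem (h.subset hc)
    have := h.card
    omega
  · refine ⟨h.core, (filter_subset _ _).trans h.subset, ?_, h.card.imp_right ?_⟩
    · intro u hu a ha
      rcases mem_insert.1 hu with rfl | hu
      · exact (mem_filter.1 ha).2
      · exact h.adj u hu a (mem_filter.1 ha).1
    · rintro ⟨h1, h2, h3⟩
      refine ⟨h1, card_round hq h2 hA, ?_⟩
      have hle := card_filter_le A fun a => CAdj G v a
      by_cases hA1 : A.card ≤ 1
      · exact Or.inl (hle.trans hA1)
      · rw [card_insert_of_notMem (hv.resolve_right hA1), h3.resolve_left hA1]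
        exact Or.inr rfl

/-- Computes a domination core in array `3`. -/
def coreProg : RamProg :=
  mapTo 6 1 3 (const 1) ;;
  forTo 7 1 (mapTo 6 1 4 (arr 3 (var 6)) ;; mapTo 6 1 5 (const 0) ;; forTo 8 3 roundProg)

theorem BicliqueFreeDSR.n_pos (x : BicliqueFreeDSR) : 0 < x.n := by
  have h := card_le_univ x.Ds
  rw [x.Ds_card, Fintype.card_fin] at h
  exact x.k_pos.trans_le h

/-- Every pass restarts with `A = C` and `U = ∅` and runs `d` rounds. It either removes a vertex or
certifies the bound, so `n` passes replace the choice of a minimum core. -/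
theorem run_core {x : BicliqueFreeDSR} {s : RamState} (h : Loaded x s) :
    Run coreProg s (300 * (x.d + 1) * (x.n + 1) ^ 3) fun s' => Loaded x s' ∧
      ∃ C : Finset (Fin x.n), Holds s' 3 C ∧ IsCore x.G (x.k + 1) C ∧
        C.card + 1 ≤ (x.k + 1) ^ x.d * (2 * x.d) := by
  unfold coreProg
  set B := (x.k + 1) ^ x.d * (2 * x.d) with hB
  have hk := x.k_pos
  refine (Run.seq (Run.mapFin (x := 6) (a := 3) (e := const 1) (univ : Finset (Fin x.n)) h.n
    (by decide) fun i s' _ _ _ => by simp [ind_of]) fun s1 h3 hf1 => Run.forTo (N := x.n)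
      (T := x.n * 12 + 6 + (x.n * 11 + 6 + (x.d * (100 * (x.n + 1) * (x.n + 1) + 8) + 6)))
      (fun i s' => ∃ C : Finset (Fin x.n), Holds s' 3 C ∧ IsCore x.G (x.k + 1) C ∧
        (C.card + 1 ≤ B ∨ C.card + i ≤ x.n)) ?_ rfl rfl (by decide) (fun i s' v h => h)
        ⟨univ, h3, isCore_univ _ _, Or.inr (by simp)⟩ ?_).mono ?_ ?_
  · exact (h.frame hf1 rfl).n
  · rintro i hi s2 ⟨C, h3', hC, hcard⟩ - hf2
    have h2 := (h.frame hf1 rfl).frame hf2 rfl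
    refine Run.seq ((Run.mapFin (x := 6) (a := 4) (e := arr 3 (var 6)) C h2.n (by decide) ?_).mono
      (by simp) fun _ h _ => h) fun s3 h4 hf3 => ?_
    · intro i s' hi hf _
      simp [hi, hf.2 3 rfl, h3' i]
    have l3 := h2.frame hf3 rfl
    refine Run.seq ((Run.mapFin (x := 6) (a := 5) (e := const 0) (∅ : Finset (Fin x.n)) l3.n
      (by decide) fun i s' _ _ _ => by simp [ind_of_not]).mono
      (by simp) fun _ h _ => h) fun s4 h5 hf4 => ?_
    have l4 : RoundData x s4 C C ∅ := ⟨l3.frame hf4 rfl,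
      h3'.frame ((hf4.2 3 rfl).trans (hf3.2 3 rfl)), h4.frame (hf4.2 4 rfl), h5⟩
    refine (Run.forTo (N := x.d) (T := 100 * (x.n + 1) * (x.n + 1)) (fun r s' =>
      ∃ C' A U, RoundData x s' C' A U ∧ RoundInv x.G (x.k + 1) r C C' A U) l4.loaded.d rfl rfl
      (by decide) ?_ ?_ ?_).mono le_rfl ?_
    · rintro i s' v ⟨C', A, U, h1, h2⟩
      exact ⟨C', A, U, h1.setReg (by norm_num) v, h2⟩
    · exact ⟨C, C, ∅, l4, hC, Subset.rfl, by simp, Or.inr (by simp)⟩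
    · rintro r hr s5 ⟨C', A, U, h5, hinv⟩ - -
      refine (run_round h5 x.n_pos).mono le_rfl ?_
      rintro s6 ⟨C'', A', U', h6, hs⟩ -
      exact ⟨C'', A', U', h6, hinv.step (by omega) hs⟩
    · rintro s5 ⟨C', A, U, h5, hinv⟩ -
      refine ⟨C', h5.core, hinv.core, ?_⟩
      rcases hinv.card with hlt | ⟨-, h1, h2⟩
      · omega
      · exact Or.inl (card_core x.d_pos x.free h2 hinv.adj h1)
  · simp only [RamExpr.cost]
    have : 0 ≤ x.n * x.n * x.n := Nat.zero_le _
    ring_nf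
    nlinarith [Nat.zero_le (x.n * x.d), Nat.zero_le (x.n^2 * x.d), Nat.zero_le (x.n^3 * x.d)]
  · rintro s2 ⟨C, h3', hC, hcard⟩ hf
    refine ⟨h.frame hf rfl, C, h3', hC, ?_⟩
    have : 1 ≤ (x.k + 1) ^ x.d := Nat.one_le_pow _ _ (by omega)
    -- If all `n` passes removed a vertex, the core is empty and `1 ≤ B` is enough.
    have : 1 * 2 ≤ B := Nat.mul_le_mul this (by have := x.d_pos; omega)
    omega

end CoreLoop

/-! ### Greedy computation of a kernel. -/

section Keep

open Finset
open scoped Classical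

open RamExpr RamProg

/-- Counts in register `17` the vertices of the core on which the traces of the vertices in
registers `6` and `12` differ. -/
def traceProg : RamProg :=
  countTo 18 1 17 skip (sub (add (arr 3 (var 18))
    (add (sub (nbExpr (var 6) (var 18)) (nbExpr (var 12) (var 18)))
      (sub (nbExpr (var 12) (var 18)) (nbExpr (var 6) (var 18))))) (const 1)) (const 1)

/-- Appends the vertex in register `12` to the list in array `7`. -/
def pushProg : RamProg :=
  store 7 (var 15) (var 12) ;; assign 15 (add (var 15) (const 1))

/-- Lists the vertices of a kernel in array `7`. -/
def keepProg : RamProg :=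
  assign 15 (const 0) ;; mapTo 6 1 6 (const 0) ;;
  forTo 12 1
    (countTo 6 1 13 traceProg (sub (arr 6 (var 6)) (var 17)) (const 1) ;;
      ite (add (add (arr 3 (var 12)) (arr 13 (var 12))) (arr 14 (var 12))) pushProg
        (ite (sub (var 4) (var 13)) (store 6 (var 12) (const 1) ;; pushProg) skip))

/-- Array `7` and register `15` hold the list `l` without repetitions of the vertices of `W`. -/
structure ListHolds {n : ℕ} (s : RamState) (l : List (Fin n)) (W : Finset (Fin n)) : Prop where
  nodup : l.Nodup
  mem_iff : ∀ v, v ∈ l ↔ v ∈ W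
  length : s.reg 15 = l.length
  get : ∀ (j : ℕ) (h : j < l.length), s.mem 7 j = l[j]

theorem ListHolds.frame {n : ℕ} {s s' : RamState} {l : List (Fin n)} {W : Finset (Fin n)}
    (h : ListHolds s l W) (h15 : s'.reg 15 = s.reg 15) (h7 : s'.mem 7 = s.mem 7) :
    ListHolds s' l W := ⟨h.nodup, h.mem_iff, h15.trans h.length, by rw [h7]; exact h.get⟩

theorem run_push {n : ℕ} {s : RamState} {l : List (Fin n)} {W : Finset (Fin n)}
    (h : ListHolds s l W) {v : Fin n} (hv : s.reg 12 = v) (hvW : v ∉ W) :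
    Run pushProg s 10 fun s' => ListHolds s' (l ++ [v]) (insert v W) := by
  unfold pushProg
  refine (Run.store_seq <| Run.assign ?_).mono (by simp) fun _ h _ => h
  refine ⟨?_, fun w => ?_, by simp [h.length], fun j hj => ?_⟩
  · rw [List.nodup_append]
    refine ⟨h.nodup, List.nodup_singleton _, fun a ha b hb hab => hvW ?_⟩
    rw [List.mem_singleton] at hb
    rwa [← hb, ← hab, ← h.mem_iff]
  · rw [List.mem_append, h.mem_iff, List.mem_singleton, mem_insert, or_comm]
  · simp only [RamState.setReg_mem, RamState.setMem_mem, RamExpr.eval, h.length, hv, true_and]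
    by_cases hjl : j = l.length
    · subst hjl
      simp
    · rw [List.length_append, List.length_singleton] at hj
      rw [if_neg hjl, List.getElem_append_left (by omega), h.get j (by omega)]

/-- The data of the kernel computation. -/
structure KeepData (x : BicliqueFreeDSR) (s : RamState) (C W : Finset (Fin x.n))
    (l : List (Fin x.n)) : Prop where
  loaded : Loaded x s
  core : Holds s 3 C
  list : ListHolds s l W
  reps : Holds s 6 (W.filter fun v => v ∉ C ∧ v ∉ x.Ds ∪ x.Dt)

namespace KeepData

variable {x : BicliqueFreeDSR} {s : RamState} {C W : Finset (Fin x.n)} {l : List (Fin x.n)}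

theorem frame (h : KeepData x s C W l) {p : RamProg} {s' : RamState} (hf : Frame p s s')
    (hp : p.KeepsInput)
    (hp' : (p.writesMem 3 || p.writesMem 6 || p.writesMem 7 || p.writesReg 15) = false) :
    KeepData x s' C W l := by
  simp only [Bool.or_eq_false_iff] at hp'
  exact ⟨h.loaded.frame hf hp, h.core.frame (hf.2 3 hp'.1.1.1),
    h.list.frame (hf.1 15 hp'.2) (hf.2 7 hp'.1.2), h.reps.frame (hf.2 6 hp'.1.1.2)⟩

/-- For 0-1 entries the two truncated differences add up to 1 exactly where the traces differ;
adding the entry of `C` and subtracting 1 is a conjunction. -/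
theorem run_trace (hs : Loaded x s) (hC : Holds s 3 C) {u v : Fin x.n} (hu : s.reg 6 = u)
    (hv : s.reg 12 = v) :
    Run traceProg s (x.n * 44 + 8) fun s' => s'.reg 17 = 0 ↔ SameTrace x.G C u v := by
  unfold traceProg
  refine (Run.countFin (T := 1) (fun c => c ∈ C ∧ ¬ (CAdj x.G u c ↔ CAdj x.G v c)) 1 hs.n (by decide)
    (by decide) ?_).mono (by simp; omega) fun s' h _ => ?_
  · intro c s1 hc hf
    have h1 := hs.frame hf rfl
    have eu : s1.reg 6 = u := (hf.1 6 rfl).trans hu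
    have ev : s1.reg 12 = v := (hf.1 12 rfl).trans hv
    have nu := RoundData.eval_nb h1 (a := var 6) (b := var 18) (u := u) (v := c) eu hc
    have nv := RoundData.eval_nb h1 (a := var 12) (b := var 18) (u := v) (v := c) ev hc
    have e3 : s1.mem 3 (s1.reg 18) = ind (c ∈ C) := by rw [hc, hf.2 3 rfl, hC]
    refine Run.skip ⟨?_, fun _ => rfl⟩
    change s1.mem 3 (s1.reg 18) + (((nbExpr (var 6) (var 18)).eval s1 -
      (nbExpr (var 12) (var 18)).eval s1) + ((nbExpr (var 12) (var 18)).eval s1 -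
      (nbExpr (var 6) (var 18)).eval s1)) - 1 ≠ 0 ↔ _
    rw [nu, nv, e3]
    by_cases h1 : c ∈ C <;> by_cases h2 : CAdj x.G u c <;> by_cases h3 : CAdj x.G v c <;>
      simp [ind, h1, h2, h3]
  · rw [h, mul_one, card_eq_zero, filter_eq_empty_iff]
    refine ⟨fun h c hc => ?_, fun h c _ hc => hc.2 (h c hc.1)⟩
    by_contra hne
    exact h (mem_univ c) ⟨hc, hne⟩

theorem run_countReps (h : KeepData x s C W l) {v : Fin x.n} (hv : s.reg 12 = v) :
    Run (countTo 6 1 13 traceProg (sub (arr 6 (var 6)) (var 17)) (const 1)) s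
      (x.n * (x.n * 44 + 25) + 8)
      fun s' => s'.reg 13 = (W.filter (IsRep x.G C (x.Ds ∪ x.Dt) v)).card := by
  refine (Run.countFin (T := x.n * 44 + 8)
    (fun u => u ∈ W ∧ IsRep x.G C (x.Ds ∪ x.Dt) v u) 1 h.loaded.n ⟨rfl, rfl, rfl⟩ (by decide)
    ?_).mono (by simp) fun s' h _ => ?_
  · intro u s1 hu hf
    have h1 := h.frame hf rfl rfl
    refine (run_trace h1.loaded h1.core hu ((hf.1 12 rfl).trans hv)).mono le_rfl fun s2 h17 hf2 =>
      ⟨?_, fun _ => rfl⟩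
    have h2 := h1.frame hf2 rfl rfl
    -- A 0-1 entry minus the number of differences is nonzero only for a kept representative with no
    -- difference at all.
    change s2.mem 6 (s2.reg 6) - s2.reg 17 ≠ 0 ↔ _
    rw [(hf2.1 6 rfl).trans hu, h2.reps, IsRep, ← and_assoc, ← h17, ← mem_filter (p := fun v =>
      v ∉ C ∧ v ∉ x.Ds ∪ x.Dt)]
    by_cases h3 : u ∈ W.filter fun v => v ∉ C ∧ v ∉ x.Ds ∪ x.Dt
    · rw [ind_of h3]
      simp only [h3, true_and]
      omega
    · rw [ind_of_not h3, Nat.zero_sub]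
      exact ⟨fun h => absurd rfl h, fun h => absurd h.1 h3⟩
  · rw [h, mul_one]
    congr 1
    ext u
    simp

/-- The invariant of the kernel computation after treating the vertices less than `i`. -/
structure Inv (x : BicliqueFreeDSR) (C W : Finset (Fin x.n)) (i : ℕ) : Prop where
  lt : ∀ v ∈ W, (v : ℕ) < i
  mem : ∀ v : Fin x.n, (v : ℕ) < i → v ∈ C ∨ v ∈ x.Ds ∪ x.Dt → v ∈ W
  card : ∀ v : Fin x.n, (v : ℕ) < i → v ∉ W →
    x.k + 1 ≤ (W.filter (IsRep x.G C (x.Ds ∪ x.Dt) v)).card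
  fibers : HasSmallFibers x.G C (x.Ds ∪ x.Dt) (x.k + 1) W

/-- A vertex outside `C ∪ S` enters only while its fibre has at most `k` members, so no fibre
exceeds `k + 1`. Insertions cannot harm vertices skipped before. -/
theorem Inv.insert {v : Fin x.n} (h : Inv x C W v)
    (hv : v ∈ C ∨ v ∈ x.Ds ∪ x.Dt ∨ (W.filter (IsRep x.G C (x.Ds ∪ x.Dt) v)).card ≤ x.k) :
    Inv x C (insert v W) (v + 1) := by
  refine ⟨fun w hw => ?_, fun w hwi hw => ?_, fun w hwi hw => ?_, fun w hw hwC hwS => ?_⟩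
  · rcases mem_insert.1 hw with rfl | hw
    · omega
    · have := h.lt w hw
      omega
  · rcases Nat.lt_succ_iff_lt_or_eq.1 hwi with hlt | heq
    · exact mem_insert_of_mem (h.mem w hlt hw)
    · rw [Fin.ext heq]
      exact mem_insert_self _ _
  · rcases Nat.lt_succ_iff_lt_or_eq.1 hwi with hlt | heq
    · exact (h.card w hlt fun hm => hw (mem_insert_of_mem hm)).trans
        (card_le_card (filter_subset_filter _ (subset_insert _ _)))
    · rw [Fin.ext heq] at hw
      exact absurd (mem_insert_self _ _) hw
  · rw [filter_insert]
    by_cases hr : IsRep x.G C (x.Ds ∪ x.Dt) w v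
    · rw [if_pos hr]
      have hc := (hv.resolve_left hr.1.1).resolve_left hr.1.2
      have : W.filter (IsRep x.G C (x.Ds ∪ x.Dt) w) = W.filter (IsRep x.G C (x.Ds ∪ x.Dt) v) :=
        filter_congr fun u _ => and_congr_right fun _ =>
          ⟨fun h => h.trans hr.2.symm, fun h => h.trans hr.2⟩
      rw [this]
      exact (card_insert_le _ _).trans (Nat.succ_le_succ hc)
    · rw [if_neg hr]
      rcases mem_insert.1 hw with rfl | hw
      · exact absurd ⟨⟨hwC, hwS⟩, SameTrace.refl _ _ _⟩ hr
      · exact h.fibers w hw hwC hwS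

theorem Inv.skip {v : Fin x.n} (h : Inv x C W v) (hvC : v ∉ C) (hvS : v ∉ x.Ds ∪ x.Dt)
    (hv : x.k < (W.filter (IsRep x.G C (x.Ds ∪ x.Dt) v)).card) : Inv x C W (v + 1) := by
  refine ⟨fun w hw => (h.lt w hw).trans (Nat.lt_succ_self _), fun w hwi hw => ?_,
    fun w hwi hw => ?_, h.fibers⟩
  · rcases Nat.lt_succ_iff_lt_or_eq.1 hwi with hlt | heq
    · exact h.mem w hlt hw
    · rw [Fin.ext heq] at hw
      exact absurd hw (not_or.2 ⟨hvC, hvS⟩)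
  · rcases Nat.lt_succ_iff_lt_or_eq.1 hwi with hlt | heq
    · exact h.card w hlt hw
    · rw [Fin.ext heq]
      exact hv

end KeepData

/-- A single pass suffices: a vertex is skipped only when `k + 1` representatives of its trace are
already kept, and kept vertices stay. This replaces minimality in `exists_kernel`. -/
theorem run_keep {x : BicliqueFreeDSR} {s : RamState} (hs : Loaded x s) {C : Finset (Fin x.n)}
    (hC : Holds s 3 C) :
    Run keepProg s (150 * (x.n + 1) ^ 3) fun s' => Loaded x s' ∧
      ∃ (W : Finset (Fin x.n)) (l : List (Fin x.n)), ListHolds s' l W ∧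
        IsKernel x.G C (x.Ds ∪ x.Dt) (x.k + 1) W ∧
        HasSmallFibers x.G C (x.Ds ∪ x.Dt) (x.k + 1) W := by
  unfold keepProg
  refine (Run.assign_seq <| Run.seq ((Run.mapFin (x := 6) (a := 6) (e := const 0)
    (∅ : Finset (Fin x.n)) (hs.setReg (r := 15) (by norm_num) 0).n (by decide)
    fun i s' _ _ _ => by simp [ind_of_not]).mono (t := x.n * 11 + 6) (by simp) fun _ h _ => h) ?_
    (t₂ := x.n * (x.n * (x.n * 44 + 25) + 60) + 6)).mono ?_ fun _ h _ => h
  · intro s1 h6 hf1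
    have l1 := (hs.setReg (r := 15) (by norm_num) 0).frame hf1 rfl
    refine (Run.forTo (N := x.n) (T := x.n * (x.n * 44 + 25) + 52) (fun i s' =>
      ∃ W l, KeepData x s' C W l ∧ KeepData.Inv x C W i) l1.n rfl rfl (by decide) ?_ ?_ ?_).mono
      (by ring_nf; omega) ?_
    · rintro i s' v ⟨W, l, h, hinv⟩
      obtain ⟨h1, h2, h3, h4⟩ := h
      exact ⟨W, l, ⟨h1.setReg (by norm_num) v, h2, h3.frame (by simp) rfl, h4⟩, hinv⟩
    · refine ⟨∅, [], ⟨l1, hC.frame (hf1.2 3 rfl), ⟨List.nodup_nil, by simp, ?_, by simp⟩, by simpa using h6⟩,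
        by simp, by simp, by simp, fun v hv => by simp at hv⟩
      rw [hf1.1 15 rfl]
      simp
    · rintro i hi s2 ⟨W, l, h2, hinv⟩ h12 -
      set v : Fin x.n := ⟨i, hi⟩ with hv
      have hinv : KeepData.Inv x C W v := hinv
      have hvW : v ∉ W := fun h => lt_irrefl _ (hinv.lt v h)
      refine Run.seq (h2.run_countReps (v := v) h12) (t₂ := 44) fun s3 h13 hf3 => ?_
      have h3 := h2.frame hf3 rfl rfl
      have e12 : s3.reg 12 = v := (hf3.1 12 rfl).trans h12
      refine (Run.ite (t := 30) (fun h0 => ?_) fun h0 => (Run.ite (t := 20) (fun h1 => ?_) fun h1 => ?_).mono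
        (by simp) fun _ h _ => h).mono (by simp) fun _ h _ => h
      · simp only [RamExpr.eval, e12, h3.core v, h3.loaded.source v, h3.loaded.target v] at h0
        have hmem : v ∈ C ∨ v ∈ x.Ds ∪ x.Dt := by
          by_contra hno
          rw [mem_union] at hno
          push Not at hno
          exact h0 (by simp [ind_of_not, hno])
        refine (run_push h3.list e12 hvW).mono (by norm_num) fun s4 h4 hf4 =>
          ⟨insert v W, l ++ [v], ⟨h3.loaded.frame hf4 rfl, h3.core.frame (hf4.2 3 rfl), h4, ?_⟩,
            hinv.insert (hmem.imp_right Or.inl)⟩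
        rw [filter_insert, if_neg (by tauto)]
        exact h3.reps.frame (hf4.2 6 rfl)
      · simp only [RamExpr.eval, e12, h3.core v, h3.loaded.source v, h3.loaded.target v,
          Nat.add_eq_zero_iff, ind_eq_zero] at h0
        simp only [RamExpr.eval, h3.loaded.k1, h13] at h1
        have hn : v ∉ C ∧ v ∉ x.Ds ∪ x.Dt := ⟨h0.1.1, by simp [h0.1.2, h0.2]⟩
        refine (Run.store_seq (t := 10) ?_).mono (by simp) fun _ h _ => h
        set s4 := s3.setMem 6 (eval s3 (var 12)) (eval s3 (const 1)) with hs4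
        have l4 : ListHolds s4 l W := h3.list.frame rfl (by ext; simp [hs4])
        refine (run_push l4 (v := v) e12 hvW).mono (by norm_num) fun s5 h5 hf5 =>
          ⟨insert v W, l ++ [v], ⟨?_, ?_, h5, ?_⟩, hinv.insert (Or.inr (Or.inr (by omega)))⟩
        · obtain ⟨n, k, d, k1, adj, source, target⟩ := h3.loaded
          refine Loaded.frame (s := s4) ?_ hf5 rfl
          exact ⟨n, k, d, k1, by simpa [hs4] using adj, source.frame (by ext; simp [hs4]),
            target.frame (by ext; simp [hs4])⟩
        · exact h3.core.frame ((hf5.2 3 rfl).trans (by ext; simp [hs4]))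
        · refine Holds.frame (s := s4) ?_ (hf5.2 6 rfl)
          have : s4 = s3.setMem 6 v 1 := by rw [hs4]; simp [e12]
          rw [this]
          refine h3.reps.update
            (by rw [ind_of]; exact mem_filter.2 ⟨mem_insert_self v W, hn⟩) fun w hw => by simp [hw]
      · simp only [RamExpr.eval, e12, h3.core v, h3.loaded.source v, h3.loaded.target v,
          Nat.add_eq_zero_iff, ind_eq_zero] at h0
        simp only [RamExpr.eval, h3.loaded.k1, h13] at h1
        exact (Run.skip ⟨W, l, h3, hinv.skip h0.1.1 (by simp [h0.1.2, h0.2]) (by omega)⟩).mono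
          (by norm_num) fun _ h _ => h
    · rintro s' ⟨W, l, h, hinv⟩ -
      exact ⟨h.loaded, W, l, h.list, ⟨fun v hv => hinv.mem v v.2 (Or.inl hv),
        fun v hv => hinv.mem v v.2 (Or.inr hv), fun v hv => hinv.card v v.2 hv⟩, hinv.fibers⟩
  · simp
    ring_nf
    nlinarith

end Keep

/-! ### Coding the subsets of the kernel by binary numbers. -/

section Masks

open Finset
open scoped Classical

open RamExpr RamProg

theorem testBit_add_two_pow {j : ℕ} : ∀ {X : ℕ}, X.testBit j = false → ∀ i,
    (X + 2 ^ j).testBit i = (X.testBit i || decide (i = j)) := by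
  induction j with
  | zero =>
    intro X hX i
    cases i with
    | zero =>
      simp only [Nat.testBit_zero, decide_eq_false_iff_not] at hX
      simp [Nat.testBit_zero]
      omega
    | succ i =>
      simp only [Nat.testBit_zero, decide_eq_false_iff_not] at hX
      rw [Nat.testBit_succ, Nat.testBit_succ, show (X + 2 ^ 0) / 2 = X / 2 by omega]
      simp
  | succ j ih =>
    intro X hX i
    cases i with
    | zero =>
      simp [Nat.testBit_zero, pow_succ]
    | succ i =>
      rw [Nat.testBit_succ] at hX ⊢
      rw [Nat.testBit_succ, show (X + 2 ^ (j + 1)) / 2 = X / 2 + 2 ^ j by rw [pow_succ]; omega, ih hX]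
      simp

/-- The number `X` with bit `j` flipped. -/
def flipBit (X j : ℕ) : ℕ := if X.testBit j then X - 2 ^ j else X + 2 ^ j

theorem testBit_sub_two_pow {j X : ℕ} (hX : X.testBit j = true) :
    2 ^ j ≤ X ∧ (X - 2 ^ j).testBit j = false := by
  have h : 2 ^ j ≤ X := Nat.ge_two_pow_of_testBit hX
  refine ⟨h, ?_⟩
  by_contra hne
  rw [Bool.not_eq_false] at hne
  have h1 := Nat.testBit_two_pow_add_eq (X - 2 ^ j) j
  rw [Nat.add_sub_cancel' h, hX, hne] at h1
  simp at h1

theorem testBit_flipBit (X j i : ℕ) :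
    (flipBit X j).testBit i = if i = j then !X.testBit j else X.testBit i := by
  unfold flipBit
  cases hX : X.testBit j with
  | false =>
    rw [if_neg (by simp), testBit_add_two_pow hX]
    by_cases h : i = j
    · simp [h]
    · simp [h]
  | true =>
    obtain ⟨hle, hf⟩ := testBit_sub_two_pow hX
    rw [if_pos rfl]
    by_cases h : i = j
    · simp [h, hf]
    · have := testBit_add_two_pow hf i
      rw [Nat.sub_add_cancel hle] at this
      simp [h, this]

theorem flipBit_lt {X j m : ℕ} (hX : X < 2 ^ m) (hj : j < m) : flipBit X j < 2 ^ m := by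
  refine Nat.lt_pow_two_of_testBit _ fun i hi => ?_
  rw [testBit_flipBit, if_neg (by omega)]
  exact Nat.testBit_lt_two_pow (hX.trans_le (Nat.pow_le_pow_right (by norm_num) hi))

variable {n : ℕ}

/-- The set of those members of the list `l` whose positions are the bits of `X`. -/
def maskSet (l : List (Fin n)) (X : ℕ) : Finset (Fin n) :=
  univ.filter fun v => v ∈ l ∧ X.testBit (l.idxOf v) = true

theorem getElem_mem_maskSet {l : List (Fin n)} (hl : l.Nodup) {X j : ℕ} (hj : j < l.length) :
    l[j] ∈ maskSet l X ↔ X.testBit j = true := by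
  simp [maskSet, hl.idxOf_getElem]

theorem maskSet_ext {l : List (Fin n)} (hl : l.Nodup) {X : ℕ} {D : Finset (Fin n)}
    (hD : ∀ v ∈ D, v ∈ l) :
    maskSet l X = D ↔ ∀ (j : ℕ) (h : j < l.length), X.testBit j = true ↔ l[j] ∈ D := by
  refine ⟨?_, fun h => ext fun v => ?_⟩
  · rintro rfl j hj
    exact (getElem_mem_maskSet hl hj).symm
  · by_cases hv : v ∈ l
    · obtain ⟨j, hj, rfl⟩ := List.getElem_of_mem hv
      rw [getElem_mem_maskSet hl, h]
    · simp only [maskSet, mem_filter, hv, false_and, and_false, false_iff]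
      exact fun h => hv (hD v h)

theorem mem_of_mem_maskSet {l : List (Fin n)} {X : ℕ} {v : Fin n} (h : v ∈ maskSet l X) : v ∈ l :=
  (mem_filter.1 h).2.1

theorem maskSet_injective {l : List (Fin n)} (hl : l.Nodup) {X Y : ℕ} (hX : X < 2 ^ l.length)
    (hY : Y < 2 ^ l.length) (h : maskSet l X = maskSet l Y) : X = Y := by
  refine Nat.eq_of_testBit_eq fun i => ?_
  by_cases hi : i < l.length
  · rw [Bool.eq_iff_iff, ← getElem_mem_maskSet hl hi, h, getElem_mem_maskSet hl hi]
  · have hp : ∀ Z, Z < 2 ^ l.length → Z.testBit i = false := fun Z hZ =>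
      Nat.testBit_lt_two_pow (hZ.trans_le (Nat.pow_le_pow_right (by norm_num) (not_lt.1 hi)))
    rw [hp X hX, hp Y hY]

theorem exists_testBit (p : ℕ → Prop) (m : ℕ) :
    ∃ X < 2 ^ m, ∀ i < m, X.testBit i = true ↔ p i := by
  induction m with
  | zero => exact ⟨0, by simp, by simp⟩
  | succ m ih =>
    obtain ⟨X, hX, h⟩ := ih
    by_cases hp : p m
    · refine ⟨X + 2 ^ m, by rw [pow_succ]; omega, fun i hi => ?_⟩
      rw [testBit_add_two_pow (Nat.testBit_lt_two_pow hX)]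
      rcases Nat.lt_succ_iff_lt_or_eq.1 hi with hlt | rfl
      · simp [hlt.ne, h i hlt]
      · simp [hp]
    · refine ⟨X, by rw [pow_succ]; omega, fun i hi => ?_⟩
      rcases Nat.lt_succ_iff_lt_or_eq.1 hi with hlt | rfl
      · exact h i hlt
      · simp [hp, Nat.testBit_lt_two_pow hX]

theorem exists_maskSet {l : List (Fin n)} (hl : l.Nodup) {D : Finset (Fin n)}
    (hD : ∀ v ∈ D, v ∈ l) : ∃ X < 2 ^ l.length, maskSet l X = D := by
  obtain ⟨X, hX, h⟩ := exists_testBit (fun j => ∃ h : j < l.length, l[j] ∈ D) l.length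
  refine ⟨X, hX, (maskSet_ext hl hD).2 fun j hj => ?_⟩
  rw [h j hj]
  simp [hj]

/-- Adding or removing a vertex is flipping its bit, so the neighbours of a mask are found by adding
or subtracting stored powers of two. -/
theorem flip_maskSet_iff {l : List (Fin n)} (hl : l.Nodup) {X Y : ℕ} (hX : X < 2 ^ l.length)
    (hY : Y < 2 ^ l.length) :
    Flip (maskSet l X) (maskSet l Y) ↔ ∃ j < l.length, Y = flipBit X j := by
  have key : ∀ j (hj : j < l.length) v, v ∈ maskSet l (flipBit X j) ↔
      if v = l[j] then v ∉ maskSet l X else v ∈ maskSet l X := by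
    intro j hj v
    by_cases hv : v ∈ l
    · obtain ⟨i, hi, rfl⟩ := List.getElem_of_mem hv
      rw [getElem_mem_maskSet hl, getElem_mem_maskSet hl, testBit_flipBit]
      by_cases hij : i = j
      · subst hij
        simp
      · have : l[i] ≠ l[j] := fun h => hij ((hl.getElem_inj_iff).1 h)
        simp [hij, this]
    · have : v ≠ l[j] := fun h => hv (h ▸ List.getElem_mem hj)
      rw [if_neg this]
      exact ⟨fun h => absurd (mem_of_mem_maskSet h) hv, fun h => absurd (mem_of_mem_maskSet h) hv⟩
  refine ⟨?_, ?_⟩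
  · rintro ⟨v, hv⟩
    have hvl : v ∈ l := by
      rcases hv with ⟨-, h⟩ | ⟨-, h⟩
      · exact mem_of_mem_maskSet (h ▸ mem_insert_self v _)
      · exact mem_of_mem_maskSet (h ▸ mem_insert_self v _)
    obtain ⟨j, hj, rfl⟩ := List.getElem_of_mem hvl
    refine ⟨j, hj, maskSet_injective hl hY (flipBit_lt hX hj) (ext fun w => ?_)⟩
    rw [key j hj]
    rcases hv with ⟨hv, h⟩ | ⟨hv, h⟩
    · rw [h, mem_insert]
      by_cases hw : w = l[j]
      · simp [hw, hv]
      · simp [hw]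
    · rw [h, mem_insert]
      by_cases hw : w = l[j]
      · simp [hw, hv]
      · simp [hw]
  · rintro ⟨j, hj, rfl⟩
    refine ⟨l[j], ?_⟩
    by_cases hm : l[j] ∈ maskSet l X
    · refine Or.inr ⟨by rw [key j hj]; simpa using hm, ext fun w => ?_⟩
      rw [mem_insert, key j hj]
      by_cases hw : w = l[j]
      · simp [hw, hm]
      · simp [hw]
    · refine Or.inl ⟨hm, ext fun w => ?_⟩
      rw [mem_insert, key j hj]
      by_cases hw : w = l[j]
      · simp [hw, hm]
      · simp [hw]

theorem count_getElem {l : List (Fin n)} (hl : l.Nodup) {D : Finset (Fin n)} (hD : ∀ v ∈ D, v ∈ l) :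
    Nat.count (fun j => ∃ h : j < l.length, l[j] ∈ D) l.length = D.card := by
  rw [count_eq_card_filter (fun j : Fin l.length => l[j] ∈ D) _ fun i => by simp]
  refine card_nbij (fun j => l[j]) (fun j hj => (mem_filter.1 hj).2) (fun i _ j _ h => ?_)
    fun v hv => ?_
  · exact Fin.ext ((hl.getElem_inj_iff).1 h)
  · obtain ⟨j, hj, rfl⟩ := List.getElem_of_mem (hD v hv)
    exact ⟨⟨j, hj⟩, by simpa using hv, rfl⟩

end Masks

/-! ### Programs for masks and the table of nodes. -/

section MaskPrograms

open Finset
open scoped Classical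

open RamExpr RamProg

/-- Computes the powers of two in array `8`, and the number of masks in register `19`. -/
def powProg : RamProg :=
  assign 26 (const 1) ;;
  forTo 24 15 (store 8 (var 24) (var 26) ;; assign 26 (add (var 26) (var 26))) ;;
  assign 19 (var 26)

/-- Computes in register `r` the mask of the set in array `a`. -/
def maskProg (r a : ℕ) : RamProg :=
  assign r (const 0) ;;
  forTo 24 15 (ite (arr a (arr 7 (var 24))) (assign r (add (var r) (arr 8 (var 24)))) skip)

/-- Writes the bits of register `22` to array `9`. -/
def decodeProg : RamProg :=
  assign 23 (var 22) ;;
  forTo 24 15 (assign 25 (sub (sub (var 15) (const 1)) (var 24)) ;;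
    ite (sub (add (var 23) (const 1)) (arr 8 (var 25)))
      (store 9 (var 25) (const 1) ;; assign 23 (sub (var 23) (arr 8 (var 25))))
      (store 9 (var 25) (const 0)))

/-- Counts in register `17` the vertices that are not dominated by the set in array `9`. -/
def dominationProg : RamProg :=
  countTo 12 1 17 (countTo 24 15 18 skip
      (sub (add (arr 9 (var 24)) (nbExpr (arr 7 (var 24)) (var 12))) (const 1)) (const 1))
    (sub (const 1) (var 18)) (const 1)

/-- Marks in array `10` the masks of the nodes of the reconfiguration graph. -/
def nodesProg : RamProg :=
  forTo 22 19 (decodeProg ;; countTo 24 15 13 skip (arr 9 (var 24)) (const 1) ;; dominationProg ;;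
    store 10 (var 22) (sub (sub (sub (const 1) (sub (var 2) (var 13))) (sub (var 13) (var 4)))
      (var 17)))

/-- The data available to the search among the subsets of `W`. -/
structure MaskData (x : BicliqueFreeDSR) (s : RamState) (W : Finset (Fin x.n))
    (l : List (Fin x.n)) : Prop where
  loaded : Loaded x s
  list : ListHolds s l W
  pow : ∀ j < l.length, s.mem 8 j = 2 ^ j
  count : s.reg 19 = 2 ^ l.length

namespace MaskData

variable {x : BicliqueFreeDSR} {s : RamState} {W : Finset (Fin x.n)} {l : List (Fin x.n)}

theorem frame (h : MaskData x s W l) {p : RamProg} {s' : RamState} (hf : Frame p s s')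
    (hp : p.KeepsInput)
    (hp' : (p.writesMem 7 || p.writesMem 8 || p.writesReg 15 || p.writesReg 19) = false) :
    MaskData x s' W l := by
  simp only [Bool.or_eq_false_iff] at hp'
  exact ⟨h.loaded.frame hf hp, h.list.frame (hf.1 15 hp'.1.2) (hf.2 7 hp'.1.1.1),
    by rw [hf.2 8 hp'.1.1.2]; exact h.pow, (hf.1 19 hp'.2).trans h.count⟩

theorem setReg (h : MaskData x s W l) {r : ℕ} (hr : 20 ≤ r) (v : ℕ) :
    MaskData x (s.setReg r v) W l :=
  ⟨h.loaded.setReg (by omega) v, h.list.frame (by rw [RamState.setReg_reg, if_neg (by omega)]) rfl,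
    h.pow, by rw [RamState.setReg_reg, if_neg (by omega)]; exact h.count⟩

theorem run_pow (hs : Loaded x s) (hl : ListHolds s l W) :
    Run powProg s (l.length * 20 + 10) fun s' => MaskData x s' W l := by
  unfold powProg
  refine (Run.assign_seq <| Run.seq (t₂ := 2) (Run.forTo (N := l.length) (T := 7) (fun i s' =>
    s'.reg 26 = 2 ^ i ∧ ∀ j < i, s'.mem 8 j = 2 ^ j) (by simpa using hl.length) rfl rfl (by decide)
    (fun i s' v h => by simpa using h) (by simp) ?_) ?_).mono (by simp; omega) fun _ h _ => h
  · rintro i hi s1 ⟨h26, h8⟩ hx hf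
    refine (Run.store_seq <| Run.assign ?_).mono (by simp) fun _ h _ => h
    refine ⟨by simp [h26, pow_succ]; ring, fun j hj => ?_⟩
    rcases Nat.lt_succ_iff_lt_or_eq.1 hj with hlt | rfl
    · simp [hx, hlt.ne, h8 j hlt]
    · simp [hx, h26]
  · rintro s1 ⟨h26, h8⟩ hf
    have l1 := (hs.setReg (r := 26) (by norm_num) 1).frame hf rfl
    have ll : ListHolds s1 l W := hl.frame (by rw [hf.1 15 rfl]; simp) (hf.2 7 rfl)
    exact Run.assign ⟨l1.setReg (by norm_num) _, ll.frame (by simp) rfl, h8, by simp [h26]⟩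

theorem run_mask (h : MaskData x s W l) {r a : ℕ} {D : Finset (Fin x.n)} (hr : 26 < r)
    (hD : Holds s a D) (hDW : D ⊆ W) :
    Run (maskProg r a) s (l.length * 20 + 10) fun s' =>
      s'.reg r < 2 ^ l.length ∧ maskSet l (s'.reg r) = D := by
  unfold maskProg
  have h0 := h.setReg (r := r) (by omega) 0
  refine (Run.assign_seq <| Run.forTo (N := l.length) (T := 9) (fun i s' =>
    s'.reg r < 2 ^ i ∧ ∀ (j : ℕ) (hj : j < i) (hjl : j < l.length),
      (s'.reg r).testBit j = true ↔ l[j] ∈ D) h0.list.length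
    (by simp [writesReg]; omega) (by simp [writesReg]; omega) (by norm_num)
    (fun i s' v hI => ?_) (by simp) ?_).mono (by simp; omega) ?_
  · rw [RamState.setReg_reg, if_neg (by omega)]
    exact hI
  · rintro i hi s1 ⟨hlt, hbit⟩ hx hf
    have f7 : s1.mem 7 = s.mem 7 := hf.2 7 rfl
    have f8 : s1.mem 8 = s.mem 8 := hf.2 8 rfl
    have fa : s1.mem a = s.mem a := hf.2 a rfl
    have e : (arr a (arr 7 (var 24))).eval s1 = ind (l[i] ∈ D) := by
      simp only [RamExpr.eval, hx, f7, fa, h.list.get i hi]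
      exact hD _
    refine (Run.ite (t := 5) (fun hc => (Run.assign ?_).mono (by simp) fun _ h _ => h) fun hc =>
      (Run.skip ?_).mono (by norm_num) fun _ h _ => h).mono (by simp) fun _ h _ => h
    · rw [e, Ne, ind_eq_zero, not_not] at hc
      have e' : (add (var r) (arr 8 (var 24))).eval s1 = s1.reg r + 2 ^ i := by
        simp only [RamExpr.eval, hx, f8, h.pow i hi]
      rw [e', RamState.setReg_reg, if_pos rfl]
      refine ⟨by rw [pow_succ]; omega, fun j hj hjl => ?_⟩
      rw [testBit_add_two_pow (Nat.testBit_lt_two_pow hlt)]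
      rcases Nat.lt_succ_iff_lt_or_eq.1 hj with hlt' | rfl
      · simp [hlt'.ne, hbit j hlt' hjl]
      · simp [hc]
    · rw [e, ind_eq_zero] at hc
      refine ⟨hlt.trans_le (Nat.pow_le_pow_right (by norm_num) (Nat.le_succ i)), fun j hj hjl => ?_⟩
      rcases Nat.lt_succ_iff_lt_or_eq.1 hj with hlt' | rfl
      · exact hbit j hlt' hjl
      · simp [hc, Nat.testBit_lt_two_pow hlt]
  · rintro s1 ⟨hlt, hbit⟩ -
    exact ⟨hlt, (maskSet_ext h.list.nodup fun v hv => (h.list.mem_iff v).2 (hDW hv)).2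
      fun j hj => hbit j hj hj⟩

/-- Without division, bits are split off from the top: before round `i`, register `23` holds `X`
modulo `2 ^ (l.length - i)`. With `j` the current position, the bit is set exactly if this is at
least `2 ^ j`, that is, if adding 1 and subtracting `2 ^ j` leaves something. -/
theorem run_decode (h : MaskData x s W l) {X : ℕ} (hX : s.reg 22 = X) (hlt : X < 2 ^ l.length) :
    Run decodeProg s (l.length * 40 + 10) fun s' => ∀ j < l.length,
      s'.mem 9 j = ind (X.testBit j = true) := by
  unfold decodeProg
  have h0 := h.setReg (r := 23) (by omega) X
  refine (Run.assign_seq <| Run.forTo (N := l.length) (T := 22) (fun i s' =>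
    s'.reg 23 = X % 2 ^ (l.length - i) ∧ ∀ j, l.length - i ≤ j → j < l.length →
      s'.mem 9 j = ind (X.testBit j = true)) (by simpa using h.list.length) rfl rfl (by decide)
    (fun i s' v h => by simpa using h) ⟨?_, ?_⟩ ?_).mono (by simp; omega) ?_
  · simp [hX, Nat.mod_eq_of_lt hlt]
  · intro j h1 h2
    omega
  · rintro i hi s1 ⟨h23, h9⟩ hx hf
    have e15 : s1.reg 15 = l.length := by
      rw [hf.1 15 rfl]
      simpa using h.list.length
    have f8 : s1.mem 8 = s.mem 8 := hf.2 8 rfl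
    obtain ⟨j, hj⟩ : ∃ j, l.length - 1 - i = j := ⟨_, rfl⟩
    have hij : l.length - i = j + 1 := by omega
    have hij' : l.length - (i + 1) = j := by omega
    rw [hij, Nat.mod_pow_succ, ← Nat.toNat_testBit] at h23
    have hmod : X % 2 ^ j < 2 ^ j := Nat.mod_lt _ (by positivity)
    have e25 : ((var 15).sub (const 1) |>.sub (var 24)).eval s1 = j := by
      simp only [RamExpr.eval, e15, hx, hj]
    refine (Run.assign_seq (t := 15) ?_).mono (by simp) fun _ h _ => h
    rw [e25]
    have ec : ((var 23).add (const 1) |>.sub (arr 8 (var 25))).eval (s1.setReg 25 j) =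
        X % 2 ^ j + 2 ^ j * (X.testBit j).toNat + 1 - 2 ^ j := by
      simp [h23, f8, h.pow j (by omega)]
    refine (Run.ite (t := 8) (fun hc => ?_) fun hc => ?_).mono (by simp) fun _ h _ => h
    · rw [ec] at hc
      have hbit : X.testBit j = true := by
        by_contra hne
        rw [Bool.not_eq_true] at hne
        rw [hne] at hc
        simp at hc
        omega
      refine (Run.store_seq <| Run.assign ?_).mono (by simp) fun _ h _ => h
      refine ⟨?_, fun j' h1 h2 => ?_⟩
      · simp [h23, f8, h.pow j (by omega), hij', hbit]
      · by_cases hjj : j' = j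
        · simp [hjj, hbit, ind]
        · simp [hjj, h9 j' (by omega) h2]
    · rw [ec] at hc
      have hbit : X.testBit j = false := by
        by_contra hne
        rw [Bool.not_eq_false] at hne
        rw [hne] at hc
        simp at hc
        omega
      refine (Run.store ?_).mono (by simp) fun _ h _ => h
      refine ⟨?_, fun j' h1 h2 => ?_⟩
      · simp [h23, hij', hbit]
      · by_cases hjj : j' = j
        · simp [hjj, hbit, ind]
        · simp [hjj, h9 j' (by omega) h2]
  · rintro s1 ⟨-, h9⟩ - j hj
    exact h9 j (by omega) hj

theorem run_domination (h : MaskData x s W l) {X : ℕ}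
    (h9 : ∀ j < l.length, s.mem 9 j = ind (X.testBit j = true)) :
    Run dominationProg s (x.n * (l.length * 30 + 25) + 8) fun s' =>
      s'.reg 17 = 0 ↔ IsDominating x.G (maskSet l X) := by
  unfold dominationProg
  refine (Run.countFin (n := x.n) (T := l.length * 30 + 8)
    (fun v => ¬ ∃ u ∈ maskSet l X, CAdj x.G u v) 1 h.loaded.n ⟨rfl, rfl, rfl⟩ (by decide) ?_).mono
    (by simp; gcongr _ * ?_; omega) ?_
  · intro v s1 hv hf
    have h1 := h.frame hf rfl rfl
    refine (Run.countTo (N := l.length) (T := 1) (fun j => ∃ hj : j < l.length,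
      l[j] ∈ maskSet l X ∧ CAdj x.G l[j] v) 1 h1.list.length (by decide) (by decide) ?_).mono
      (by simp; omega) ?_
    · intro j hj s2 hx hf2
      have h2 := h1.frame hf2 rfl rfl
      have e12 : s2.reg 12 = v := (hf2.1 12 rfl).trans hv
      have e9 : s2.mem 9 j = ind (l[j] ∈ maskSet l X) := by
        rw [hf2.2 9 rfl, hf.2 9 rfl, h9 j hj, getElem_mem_maskSet h.list.nodup hj]
      have e7 : (arr 7 (var 24)).eval s2 = l[j] := by simp [hx, h2.list.get j hj]
      refine Run.skip ⟨?_, fun _ => rfl⟩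
      change s2.mem 9 (s2.reg 24) + (nbExpr (arr 7 (var 24)) (var 12)).eval s2 - 1 ≠ 0 ↔ _
      rw [RoundData.eval_nb h2.loaded e7 (b := var 12) (v := v) e12, hx, e9, ← ind_and, Ne,
        ind_eq_zero, not_not]
      simp [hj]
    · intro s2 h18 hf2
      refine ⟨?_, fun _ => rfl⟩
      change 1 - s2.reg 18 ≠ 0 ↔ _
      rw [h18, mul_one]
      have : (1 - Nat.count (fun j => ∃ hj : j < l.length, l[j] ∈ maskSet l X ∧ CAdj x.G l[j] v)
          l.length ≠ 0) ↔ Nat.count (fun j => ∃ hj : j < l.length, l[j] ∈ maskSet l X ∧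
          CAdj x.G l[j] v) l.length = 0 := by omega
      rw [this, count_eq_zero_iff, not_exists]
      refine ⟨fun hall u hu => ?_, fun hall j hj => ?_⟩
      · obtain ⟨j, hj, rfl⟩ := List.getElem_of_mem (mem_of_mem_maskSet hu.1)
        exact hall j hj ⟨hj, hu⟩
      · rintro ⟨_, hu⟩
        exact hall _ hu
  · intro s1 h17 _
    rw [h17, mul_one, card_eq_zero, filter_eq_empty_iff, isDominating_iff]
    simp

/-- In truncated arithmetic the stored value is 1 only if the cardinality is neither below `k` nor
above `k + 1` and no vertex is undominated; otherwise one of the subtractions brings it to 0. -/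
theorem run_nodes (h : MaskData x s W l) :
    Run nodesProg s (2 ^ l.length * (100 * (x.n + 1) * (l.length + 1)) + 6) fun s' =>
      ∀ X < 2 ^ l.length, s'.mem 10 X = ind (IsNode x.G x.k W (maskSet l X)) := by
  unfold nodesProg
  refine (Run.forTo (N := 2 ^ l.length) (T := (l.length * 40 + 10) + ((l.length * 17 + 8) +
    ((x.n * (l.length * 30 + 25) + 8) + 15)))
    (fun i s' => ∀ X < i, s'.mem 10 X = ind (IsNode x.G x.k W (maskSet l X))) h.count rfl rfl
    (by decide) (fun i s' v h => h) (by simp) ?_).mono ?_ fun _ h _ => h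
  · rintro X hX s1 hI hx hf
    have h1 := h.frame hf rfl rfl
    refine Run.seq (h1.run_decode hx hX) fun s2 h9 hf2 => ?_
    have h2 := h1.frame hf2 rfl rfl
    refine Run.seq ((Run.countTo (N := l.length) (T := 1) (fun j => ∃ hj : j < l.length,
      l[j] ∈ maskSet l X) 1 h2.list.length (by decide) (by decide) ?_).mono
      (by simp; omega) fun _ h _ => h) fun s3 h13 hf3 => ?_
    · intro j hj s3 hj3 hf3
      refine Run.skip ⟨?_, fun _ => rfl⟩
      rw [RamExpr.eval, RamExpr.eval, hj3, hf3.2 9 rfl, h9 j hj, Ne, ind_eq_zero, not_not,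
        ← getElem_mem_maskSet h.list.nodup hj]
      simp [hj]
    have h3 := h2.frame hf3 rfl rfl
    rw [count_getElem h.list.nodup fun v => mem_of_mem_maskSet, mul_one] at h13
    refine Run.seq (h3.run_domination (X := X) (by rw [hf3.2 9 rfl]; exact h9)) fun s4 h17 hf4 => ?_
    have h4 := h3.frame hf4 rfl rfl
    refine (Run.store fun Y hY => ?_).mono (by simp) fun _ h _ => h
    have e22 : s4.reg 22 = X := by rw [hf4.1 22 rfl, hf3.1 22 rfl, hf2.1 22 rfl, hx]
    rcases Nat.lt_succ_iff_lt_or_eq.1 hY with hlt | rfl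
    · simp only [RamState.setMem_mem, RamExpr.eval, e22, hlt.ne, and_false, if_false]
      rw [hf4.2 10 rfl, hf3.2 10 rfl, hf2.2 10 rfl, hI Y hlt]
    · have e13 : s4.reg 13 = (maskSet l Y).card := (hf4.1 13 rfl).trans h13
      have hsub : maskSet l Y ⊆ W := fun v hv => (h.list.mem_iff v).1 (mem_of_mem_maskSet hv)
      simp only [RamState.setMem_mem, RamExpr.eval, e22, and_self, if_true, h4.loaded.k,
        h4.loaded.k1, e13]
      by_cases hn : IsNode x.G x.k W (maskSet l Y)
      · rw [ind_of hn, h17.2 hn.2.1]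
        have := hn.2.2
        omega
      · rw [ind_of_not hn]
        by_contra hne
        exact hn ⟨hsub, h17.1 (by omega), by omega, by omega⟩
  · refine Nat.add_le_add_right (Nat.mul_le_mul_left _ ?_) _
    nlinarith [Nat.zero_le (x.n * l.length)]

end MaskData

end MaskPrograms

/-! ### Distances and their truncation to a given level. -/

section Distance

variable {R : ℕ → ℕ → Prop} {T Q : ℕ}

/-- `ℓ` is the smallest number of steps in which `T` can be reached from `X`. -/
def HasDist (R : ℕ → ℕ → Prop) (T X ℓ : ℕ) : Prop :=
  Reach R ℓ X T ∧ ∀ ℓ' < ℓ, ¬ Reach R ℓ' X T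

theorem HasDist.unique {X ℓ ℓ' : ℕ} (h : HasDist R T X ℓ) (h' : HasDist R T X ℓ') : ℓ = ℓ' := by
  rcases lt_trichotomy ℓ ℓ' with hlt | heq | hlt
  · exact absurd h.1 (h'.2 ℓ hlt)
  · exact heq
  · exact absurd h'.1 (h.2 ℓ' hlt)

theorem exists_hasDist {X ℓ : ℕ} (h : Reach R ℓ X T) : ∃ ℓ' ≤ ℓ, HasDist R T X ℓ' := by
  classical
  have hex : ∃ ℓ, Reach R ℓ X T := ⟨ℓ, h⟩
  exact ⟨Nat.find hex, Nat.find_min' hex h, Nat.find_spec hex, fun ℓ' h' => Nat.find_min hex h'⟩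

theorem HasDist.exists_step {X ℓ : ℕ} (h : HasDist R T X (ℓ + 1)) :
    ∃ Y, R X Y ∧ HasDist R T Y ℓ := by
  obtain ⟨Y, hY, hr⟩ := h.1
  exact ⟨Y, hY, hr, fun ℓ' hlt hr' => h.2 (ℓ' + 1) (by omega) ⟨Y, hY, hr'⟩⟩

/-- A shortest path passes through elements at each of the distances `0, ..., ℓ`. These are distinct
and below `Q`, so `ℓ + 1 ≤ Q`. Hence `Q` levels of search are enough. -/
theorem HasDist.lt (hR : ∀ X Y, R X Y → X < Q ∧ Y < Q) {X ℓ : ℕ} (hX : X < Q)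
    (h : HasDist R T X ℓ) : ℓ < Q := by
  have key : ∀ ℓ X, X < Q → HasDist R T X ℓ → ∀ i ≤ ℓ, ∃ Z < Q, HasDist R T Z i := by
    intro ℓ
    induction ℓ with
    | zero =>
      intro X hX h i hi
      exact ⟨X, hX, by rwa [Nat.le_zero.1 hi]⟩
    | succ ℓ ih =>
      intro X hX h i hi
      rcases Nat.le_succ_iff.1 hi with hi | rfl
      · obtain ⟨Y, hXY, hY⟩ := h.exists_step
        exact ih Y (hR X Y hXY).2 hY i hi
      · exact ⟨X, hX, h⟩
  have hex : ∀ i : Fin (ℓ + 1), ∃ Z : Fin Q, HasDist R T Z i := fun i => by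
    obtain ⟨Z, hZ, hd⟩ := key ℓ X hX h i (Nat.lt_succ_iff.1 i.2)
    exact ⟨⟨Z, hZ⟩, hd⟩
  choose f hf using hex
  have hinj : Function.Injective f := fun i j hij => by
    have h1 := hf i
    rw [hij] at h1
    exact Fin.ext (h1.unique (hf j))
  simpa using Fintype.card_le_of_injective f hinj

/-- `c` is one more than the distance of `X` from `T` if this is at most `L`, and `0` otherwise. -/
def DistUpTo (R : ℕ → ℕ → Prop) (T L X c : ℕ) : Prop :=
  (c = 0 ∧ ∀ ℓ ≤ L, ¬ Reach R ℓ X T) ∨ ∃ ℓ ≤ L, c = ℓ + 1 ∧ HasDist R T X ℓ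

/-- The criterion for distance `ℓ` is the same at every level `L ≥ ℓ`; a table whose entries belong
to two successive levels can therefore be read uniformly. -/
theorem DistUpTo.eq_iff {L X c ℓ : ℕ} (h : DistUpTo R T L X c) (hℓ : ℓ ≤ L) :
    c = ℓ + 1 ↔ HasDist R T X ℓ := by
  rcases h with ⟨rfl, h⟩ | ⟨ℓ', hℓ', rfl, h⟩
  · exact ⟨fun h' => by omega, fun h' => absurd h'.1 (h ℓ hℓ)⟩
  · exact ⟨fun h' => by rwa [← Nat.succ_injective h'], fun h' => by rw [h.unique h']⟩

theorem DistUpTo.succ_of_ne_zero {L X c : ℕ} (h : DistUpTo R T L X c) (hc : c ≠ 0) :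
    DistUpTo R T (L + 1) X c := by
  rcases h with ⟨rfl, -⟩ | ⟨ℓ, hℓ, hc, h⟩
  · exact absurd rfl hc
  · exact Or.inr ⟨ℓ, by omega, hc, h⟩

theorem DistUpTo.not_reach {L X : ℕ} (h : DistUpTo R T L X 0) : ∀ ℓ ≤ L, ¬ Reach R ℓ X T := by
  rcases h with ⟨-, h⟩ | ⟨ℓ, -, h, -⟩
  · exact h
  · omega

theorem DistUpTo.reach_iff (hR : ∀ X Y, R X Y → X < Q ∧ Y < Q) {X c : ℕ} (hX : X < Q)
    (h : DistUpTo R T Q X c) : c = 0 ↔ ∀ ℓ, ¬ Reach R ℓ X T := by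
  refine ⟨?_, fun h' => ?_⟩
  · rintro rfl ℓ hr
    obtain ⟨ℓ', -, hd⟩ := exists_hasDist hr
    exact h.not_reach ℓ' (hd.lt hR hX).le hd.1
  · rcases h with ⟨rfl, -⟩ | ⟨ℓ, -, -, hd⟩
    · rfl
    · exact absurd hd.1 (h' ℓ)

end Distance

/-! ### Breadth-first search on masks. -/

section Search

open Finset
open scoped Classical

open RamExpr RamProg

/-- A reconfiguration step in terms of masks. -/
def MStep {n : ℕ} (G : SimpleGraph (Fin n)) (k : ℕ) (W : Finset (Fin n)) (l : List (Fin n))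
    (X Y : ℕ) : Prop :=
  X < 2 ^ l.length ∧ Y < 2 ^ l.length ∧ RStep G k W (maskSet l X) (maskSet l Y)

/-- Checks whether flipping the bit in register `24` of the mask in register `22` leads to a mask of
the current level. -/
def relaxProg : RamProg :=
  ite (arr 9 (var 24)) (assign 27 (sub (var 22) (arr 8 (var 24))))
    (assign 27 (add (var 22) (arr 8 (var 24)))) ;;
  ite (add (sub (arr 11 (var 27)) (add (var 26) (const 1)))
      (sub (add (var 26) (const 1)) (arr 11 (var 27)))) skip
    (store 11 (var 22) (add (var 26) (const 2)) ;; store 12 (var 22) (var 27))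

/-- Breadth-first search from the target, whose mask is in register `29`. -/
def searchProg : RamProg :=
  store 11 (var 29) (const 1) ;;
  forTo 26 19 (forTo 22 19 (ite (arr 10 (var 22))
    (ite (arr 11 (var 22)) skip (decodeProg ;; forTo 24 15 relaxProg)) skip))

/-- The parents stored in array `12` lead one step closer to the target. -/
def ParentsHold (R : ℕ → ℕ → Prop) (T Q : ℕ) (s : RamState) : Prop :=
  ∀ X < Q, ∀ ℓ, s.mem 11 X = ℓ + 2 → R X (s.mem 12 X) ∧ HasDist R T (s.mem 12 X) ℓ

namespace MaskData

variable {x : BicliqueFreeDSR} {s : RamState} {W : Finset (Fin x.n)} {l : List (Fin x.n)} {T : ℕ}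

theorem mStep_iff (h : MaskData x s W l) {X Y : ℕ} (hX : X < 2 ^ l.length) :
    MStep x.G x.k W l X Y ↔ IsNode x.G x.k W (maskSet l X) ∧ IsNode x.G x.k W (maskSet l Y) ∧
      ∃ j < l.length, Y = flipBit X j := by
  refine ⟨fun ⟨_, h2, h3, h4, h5⟩ => ⟨h3, h4, (flip_maskSet_iff h.list.nodup hX h2).1 h5⟩, ?_⟩
  rintro ⟨h1, h2, j, hj, rfl⟩
  have hlt := flipBit_lt hX hj
  exact ⟨hX, hlt, h1, h2, (flip_maskSet_iff h.list.nodup hX hlt).2 ⟨j, hj, rfl⟩⟩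

theorem isNode_of_reach (hT : IsNode x.G x.k W (maskSet l T)) {X ℓ : ℕ}
    (h : Reach (MStep x.G x.k W l) ℓ X T) : IsNode x.G x.k W (maskSet l X) := by
  cases ℓ with
  | zero =>
    have h : X = T := h
    rwa [h]
  | succ ℓ =>
    obtain ⟨Y, hY, -⟩ := h
    exact hY.2.2.1

/-- The distances from `T` have been computed up to `L` for the masks less than `i`, and up to
`L - 1` for the others. -/
structure SearchInv (x : BicliqueFreeDSR) (W : Finset (Fin x.n)) (l : List (Fin x.n)) (T L i : ℕ)
    (s : RamState) : Prop where
  done : ∀ X < 2 ^ l.length, X < i → DistUpTo (MStep x.G x.k W l) T (L + 1) X (s.mem 11 X)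
  todo : ∀ X < 2 ^ l.length, i ≤ X → DistUpTo (MStep x.G x.k W l) T L X (s.mem 11 X)
  parents : ParentsHold (MStep x.G x.k W l) T (2 ^ l.length) s

theorem run_relax (h : MaskData x s W l) {L X j : ℕ} (hj : j < l.length)
    (h9 : ∀ j < l.length, s.mem 9 j = ind (X.testBit j = true)) (h22 : s.reg 22 = X)
    (h26 : s.reg 26 = L) (h24 : s.reg 24 = j) :
    Run relaxProg s 40 fun s' =>
      (s.mem 11 (flipBit X j) = L + 1 ∧ s'.mem 11 = Function.update (s.mem 11) X (L + 2) ∧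
        s'.mem 12 = Function.update (s.mem 12) X (flipBit X j)) ∨
      (s.mem 11 (flipBit X j) ≠ L + 1 ∧ s'.mem 11 = s.mem 11 ∧ s'.mem 12 = s.mem 12) := by
  unfold relaxProg
  refine (Run.seq (t₁ := 10) (t₂ := 30) (Q' := fun s' => s'.reg 27 = flipBit X j) ?_
    fun s1 h27 hf => ?_).mono (by norm_num) fun _ h _ => h
  · have e9 : (arr 9 (var 24)).eval s = ind (X.testBit j = true) := by simp [h24, h9 j hj]
    refine (Run.ite (t := 5) (fun hc => (Run.assign ?_).mono (by simp) fun _ h _ => h) fun hc =>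
      (Run.assign ?_).mono (by simp) fun _ h _ => h).mono (by simp) fun _ h _ => h
    · rw [e9, Ne, ind_eq_zero, not_not] at hc
      simp [h22, h24, h.pow j hj, flipBit, hc]
    · rw [e9, ind_eq_zero] at hc
      simp [h22, h24, h.pow j hj, flipBit, hc]
  · have e22 : s1.reg 22 = X := (hf.1 22 rfl).trans h22
    have e26 : s1.reg 26 = L := (hf.1 26 rfl).trans h26
    have e11 : s1.mem 11 = s.mem 11 := hf.2 11 rfl
    have e12 : s1.mem 12 = s.mem 12 := hf.2 12 rfl
    refine (Run.ite (t := 10) (fun hc => (Run.skip ?_).mono (by norm_num) fun _ h _ => h) fun hc =>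
      (Run.store_seq <| Run.store ?_).mono (by simp) fun _ h _ => h).mono (by simp) fun _ h _ => h
    · simp only [RamExpr.eval, h27, e11, e26] at hc
      exact Or.inr ⟨by omega, e11, e12⟩
    · simp only [RamExpr.eval, h27, e11, e26] at hc
      refine Or.inl ⟨by omega, funext fun i => ?_, funext fun i => ?_⟩
      · simp [e22, e26, e11, Function.update_apply]
      · simp [e22, h27, e12, Function.update_apply]

theorem flipBit_ne (X j : ℕ) : flipBit X j ≠ X := fun h => by
  have := testBit_flipBit X j j
  rw [h, if_pos rfl] at this
  simp at this

/-- An unmarked node cannot reach `T` within `L` steps, so it has distance `L + 1` exactly if one of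
its bit flips has distance `L`. Such a flip is automatically a node by `isNode_of_reach`. -/
theorem run_visit (h : MaskData x s W l) {L X : ℕ} (hX : X < 2 ^ l.length)
    (hT : IsNode x.G x.k W (maskSet l T))
    (h10 : ∀ X < 2 ^ l.length, s.mem 10 X = ind (IsNode x.G x.k W (maskSet l X)))
    (h22 : s.reg 22 = X) (h26 : s.reg 26 = L) (hinv : SearchInv x W l T L X s) :
    Run (ite (arr 10 (var 22))
      (ite (arr 11 (var 22)) skip (decodeProg ;; forTo 24 15 relaxProg)) skip) s
      (100 * (l.length + 1)) (SearchInv x W l T L (X + 1)) := by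
  have hcur := hinv.todo X hX le_rfl
  have hnext : ∀ s' : RamState, (∀ Y, Y ≠ X → s'.mem 11 Y = s.mem 11 Y) →
      (∀ Y, Y ≠ X → s'.mem 12 Y = s.mem 12 Y) →
      DistUpTo (MStep x.G x.k W l) T (L + 1) X (s'.mem 11 X) →
      (∀ ℓ, s'.mem 11 X = ℓ + 2 → MStep x.G x.k W l X (s'.mem 12 X) ∧
        HasDist (MStep x.G x.k W l) T (s'.mem 12 X) ℓ) → SearchInv x W l T L (X + 1) s' := by
    intro s' h1 h2 h3 h4
    refine ⟨fun Y hY hlt => ?_, fun Y hY hle => ?_, fun Y hY ℓ hℓ => ?_⟩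
    · rcases Nat.lt_succ_iff_lt_or_eq.1 hlt with hlt | rfl
      · rw [h1 Y hlt.ne]
        exact hinv.done Y hY hlt
      · exact h3
    · have hne : Y ≠ X := by omega
      rw [h1 Y hne]
      exact hinv.todo Y hY (by omega)
    · by_cases hne : Y = X
      · subst hne
        exact h4 ℓ hℓ
      · rw [h1 Y hne] at hℓ
        rw [h2 Y hne]
        exact hinv.parents Y hY ℓ hℓ
  refine (Run.ite (t := 95 * (l.length + 1)) (fun h0 => ?_) fun h0 => (Run.skip ?_).mono (by omega)
    fun _ h _ => h).mono (by simp; omega) fun _ h _ => h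
  swap
  · simp only [RamExpr.eval, h22, h10 X hX, ind_eq_zero] at h0
    refine hnext s (fun _ _ => rfl) (fun _ _ => rfl) ?_ (hinv.parents X hX)
    have hno : ∀ ℓ, ¬ Reach (MStep x.G x.k W l) ℓ X T := fun ℓ hr => h0 (isNode_of_reach hT hr)
    rcases hcur with ⟨hc, -⟩ | ⟨ℓ, -, -, hd⟩
    · exact Or.inl ⟨hc, fun ℓ _ => hno ℓ⟩
    · exact absurd hd.1 (hno ℓ)
  simp only [RamExpr.eval, h22, h10 X hX, Ne, ind_eq_zero, not_not] at h0
  refine (Run.ite (t := 90 * (l.length + 1)) (fun h1 => (Run.skip ?_).mono (by omega)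
    fun _ h _ => h) fun h1 => ?_).mono (by simp; omega) fun _ h _ => h
  · simp only [RamExpr.eval, h22] at h1
    exact hnext s (fun _ _ => rfl) (fun _ _ => rfl) (hcur.succ_of_ne_zero h1) (hinv.parents X hX)
  simp only [RamExpr.eval, h22] at h1
  refine (Run.seq (t₂ := l.length * 48 + 6) (h.run_decode h22 hX) fun s1 h9 hf1 => ?_).mono (by omega)
    fun _ h _ => h
  have l1 := h.frame hf1 rfl rfl
  have e11 : s1.mem 11 = s.mem 11 := hf1.2 11 rfl
  have e12 : s1.mem 12 = s.mem 12 := hf1.2 12 rfl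
  refine (Run.forTo (N := l.length) (T := 40) (fun j s' =>
    (∀ Y, Y ≠ X → s'.mem 11 Y = s.mem 11 Y) ∧ (∀ Y, Y ≠ X → s'.mem 12 Y = s.mem 12 Y) ∧
    ((s'.mem 11 X = 0 ∧ ∀ j' < j, s.mem 11 (flipBit X j') ≠ L + 1) ∨
      (s'.mem 11 X = L + 2 ∧ ∃ j' < l.length, s'.mem 12 X = flipBit X j' ∧
        s.mem 11 (flipBit X j') = L + 1)))
    l1.list.length rfl rfl (by decide) (fun i s' v h => h) ?_ ?_).mono (by omega) ?_
  · exact ⟨fun _ _ => by rw [e11], fun _ _ => by rw [e12], Or.inl ⟨by rw [e11, h1], by simp⟩⟩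
  · rintro j hj s2 ⟨i1, i2, i3⟩ hx hf2
    have l2 := l1.frame hf2 rfl rfl
    have e22 : s2.reg 22 = X := by rw [hf2.1 22 rfl, hf1.1 22 rfl, h22]
    have e26 : s2.reg 26 = L := by rw [hf2.1 26 rfl, hf1.1 26 rfl, h26]
    refine (l2.run_relax hj (by rw [hf2.2 9 rfl]; exact h9) e22 e26 hx).mono le_rfl fun s3 h3 _ => ?_
    -- The loop changes no entry but that of `X`, and no flip of `X` is `X`; so the test sees the
    -- old table.
    rw [i1 _ (flipBit_ne X j)] at h3
    rcases h3 with ⟨hd, m11, m12⟩ | ⟨hd, m11, m12⟩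
    · refine ⟨fun Y hY => ?_, fun Y hY => ?_, Or.inr ⟨?_, j, hj, ?_, hd⟩⟩
      · rw [m11, Function.update_of_ne hY, i1 Y hY]
      · rw [m12, Function.update_of_ne hY, i2 Y hY]
      · rw [m11, Function.update_self]
      · rw [m12, Function.update_self]
    · rw [m11, m12]
      refine ⟨i1, i2, i3.imp_left fun ⟨h, h'⟩ => ⟨h, fun j' hj' => ?_⟩⟩
      rcases Nat.lt_succ_iff_lt_or_eq.1 hj' with hlt | rfl
      · exact h' j' hlt
      · exact hd
  · rintro s2 ⟨i1, i2, i3⟩ -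
    -- The table is half updated, but the mark `L + 1` means distance `L` on either side of `X`.
    have hdist : ∀ Y < 2 ^ l.length, s.mem 11 Y = L + 1 ↔ HasDist (MStep x.G x.k W l) T Y L := by
      intro Y hY
      by_cases hlt : Y < X
      · exact (hinv.done Y hY hlt).eq_iff (Nat.le_succ L)
      · exact (hinv.todo Y hY (not_lt.1 hlt)).eq_iff le_rfl
    rw [h1] at hcur
    rcases i3 with ⟨hz, hno⟩ | ⟨hz, j, hj, hp, hd⟩
    · refine hnext s2 i1 i2 (Or.inl ⟨hz, fun ℓ hℓ hr => ?_⟩) fun ℓ hℓ => by omega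
      rcases Nat.le_succ_iff.1 hℓ with hℓ | rfl
      · exact hcur.not_reach ℓ hℓ hr
      · obtain ⟨Y, hXY, hr'⟩ := hr
        obtain ⟨-, -, j, hj, rfl⟩ := (h.mStep_iff hX).1 hXY
        refine hno j hj ((hdist _ hXY.2.1).2 ⟨hr', fun ℓ' hlt hr'' => ?_⟩)
        exact hcur.not_reach (ℓ' + 1) (by omega) ⟨_, hXY, hr''⟩
    · have hd' := (hdist _ (flipBit_lt hX hj)).1 hd
      have hstep : MStep x.G x.k W l X (flipBit X j) :=
        (h.mStep_iff hX).2 ⟨h0, isNode_of_reach hT hd'.1, j, hj, rfl⟩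
      refine hnext s2 i1 i2 (Or.inr ⟨L + 1, le_rfl, hz, ⟨_, hstep, hd'.1⟩, fun ℓ' hlt =>
        hcur.not_reach ℓ' (by omega)⟩) fun ℓ hℓ => ?_
      have : ℓ = L := by omega
      rw [this, hp]
      exact ⟨hstep, hd'⟩

/-- Searching backwards from the target makes the parents lead from the source forwards, in the
order in which the sets are to be written. -/
theorem run_search (h : MaskData x s W l) (hT : IsNode x.G x.k W (maskSet l T))
    (h10 : ∀ X < 2 ^ l.length, s.mem 10 X = ind (IsNode x.G x.k W (maskSet l X)))
    (h29 : s.reg 29 = T) (h11 : ∀ X, s.mem 11 X = 0) :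
    Run searchProg s (2 ^ l.length * (2 ^ l.length * (100 * (l.length + 1) + 8) + 14) + 10)
      fun s' => (∀ X < 2 ^ l.length,
        DistUpTo (MStep x.G x.k W l) T (2 ^ l.length) X (s'.mem 11 X)) ∧
        ParentsHold (MStep x.G x.k W l) T (2 ^ l.length) s' := by
  unfold searchProg
  set s1 := s.setMem 11 T 1 with hs1
  have l1 : MaskData x s1 W l := by
    obtain ⟨⟨n, k, d, k1, adj, source, target⟩, list, pow, count⟩ := h
    exact ⟨⟨n, k, d, k1, by simpa [hs1] using adj, source.frame (by ext; simp [hs1]),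
      target.frame (by ext; simp [hs1])⟩, list.frame rfl (by ext; simp [hs1]),
      by simpa [hs1] using pow, count⟩
  have e10 : s1.mem 10 = s.mem 10 := by ext; simp [hs1]
  refine (Run.store_seq (t := 2 ^ l.length * (2 ^ l.length * (100 * (l.length + 1) + 8) + 14) + 6) ?_).mono
    (by simp; omega) fun _ h _ => h
  have hs : s.setMem 11 (eval s (var 29)) (eval s (const 1)) = s1 := by simp [hs1, h29]
  rw [hs]
  refine (Run.forTo (N := 2 ^ l.length) (T := 2 ^ l.length * (100 * (l.length + 1) + 8) + 6)
    (fun L s' => SearchInv x W l T L 0 s') l1.count rfl rfl (by decide)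
    (fun i s' v h => ⟨h.1, h.2, h.3⟩) ?_ ?_).mono le_rfl ?_
  · refine ⟨by simp, fun X hX _ => ?_, fun X hX ℓ hℓ => ?_⟩
    · by_cases hXT : X = T
      · exact Or.inr ⟨0, le_rfl, by simp [hs1, hXT], hXT, by simp⟩
      · refine Or.inl ⟨by simp [hs1, hXT, h11], fun ℓ hℓ hr => ?_⟩
        rw [Nat.le_zero.1 hℓ] at hr
        exact hXT hr
    · by_cases hXT : X = T
      · simp [hs1, hXT] at hℓ
      · simp [hs1, hXT, h11] at hℓ
  · intro L _ s2 hinv hL hf2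
    have l2 := l1.frame hf2 rfl rfl
    refine (Run.forTo (N := 2 ^ l.length) (T := 100 * (l.length + 1))
      (fun i s' => SearchInv x W l T L i s') l2.count rfl rfl (by decide)
      (fun i s' v h => ⟨h.1, h.2, h.3⟩) hinv ?_).mono le_rfl ?_
    · intro X hX s3 hinv3 h22 hf3
      refine (l2.frame hf3 rfl rfl).run_visit hX hT ?_ h22 ((hf3.1 26 rfl).trans hL) hinv3
      rw [hf3.2 10 rfl, hf2.2 10 rfl, e10]
      exact h10
    · intro s3 hinv3 _
      exact ⟨by simp, fun X hX _ => hinv3.done X hX hX, hinv3.parents⟩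
  · intro s2 hinv _
    exact ⟨fun X hX => hinv.todo X hX (Nat.zero_le _), hinv.parents⟩

end MaskData

end Search

/-! ### Writing a shortest sequence. -/

section Output

open Finset
open scoped Classical

open RamExpr RamProg

theorem outputOf_append {n : ℕ} {s s' : RamState} {S : Finset (Fin n)}
    (h0 : s'.reg 0 = s.reg 0 + n) (h : ∀ i < s.reg 0, s'.mem 1 i = s.mem 1 i)
    (h' : ∀ v : Fin n, s'.mem 1 (s.reg 0 + v) = ind (v ∈ S)) :
    outputOf s' = outputOf s ++ encodeSet S := by
  unfold outputOf
  rw [h0, List.range_add, List.map_append, List.map_map]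
  congr 1
  · exact List.map_congr_left fun i hi => h i (List.mem_range.1 hi)
  · refine List.ext_getElem (by simp [length_encodeSet]) fun i hi _ => ?_
    have hi : i < n := by simpa using hi
    simp only [List.getElem_map, List.getElem_range, Function.comp_apply, encodeSet,
      List.getElem_ofFn]
    rw [h' ⟨i, hi⟩]
    unfold ind
    congr

/-- Fills the next `n` cells of the output with zeros. -/
def zeroProg : RamProg := forTo 6 1 (store 1 (add (var 0) (var 6)) (const 0))

/-- Appends the 0-1 word of the set with the mask in register `22` to the output. -/
def writeProg : RamProg :=
  decodeProg ;; zeroProg ;; forTo 24 15 (store 1 (add (var 0) (arr 7 (var 24))) (arr 9 (var 24))) ;;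
    assign 0 (add (var 0) (var 1))

/-- Writes the sets on the way from the mask in register `22` to the target to the output. -/
def writePathProg : RamProg :=
  forTo 31 30 (writeProg ;; assign 22 (arr 12 (var 22))) ;; writeProg

/-- Writes a shortest reconfiguration sequence to the output. -/
def outProg : RamProg :=
  assign 0 (const 1) ;;
  ite (arr 11 (var 28))
    ((store 1 (const 0) (const 1) ;; assign 22 (var 28) ;;
      assign 30 (sub (arr 11 (var 28)) (const 1))) ;; writePathProg)
    (store 1 (const 0) (const 0))

namespace MaskData

variable {x : BicliqueFreeDSR} {s : RamState} {W : Finset (Fin x.n)} {l : List (Fin x.n)} {T : ℕ}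

/-- After clearing `n` cells, bit `j` goes to the cell of vertex `l[j]`. As `l` has no repetitions,
no cell is written by two different bits. -/
theorem run_write (h : MaskData x s W l) {X : ℕ} (hX : X < 2 ^ l.length) (h22 : s.reg 22 = X) :
    Run writeProg s (l.length * 60 + x.n * 20 + 30) fun s' =>
      outputOf s' = outputOf s ++ encodeSet (maskSet l X) := by
  unfold writeProg zeroProg
  refine (Run.seq (t₂ := x.n * 14 + 6 + (l.length * 16 + 6 + 4)) (h.run_decode h22 hX)
    fun s1 h9 hf1 => ?_).mono (by omega) fun _ h _ => h
  have l1 := h.frame hf1 rfl rfl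
  have e1 : s1.mem 1 = s.mem 1 := hf1.2 1 rfl
  have e0 : s1.reg 0 = s.reg 0 := hf1.1 0 rfl
  refine Run.seq (Run.forTo (N := x.n) (T := 6) (fun i s' =>
    (∀ j < s.reg 0, s'.mem 1 j = s.mem 1 j) ∧ ∀ j < i, s'.mem 1 (s.reg 0 + j) = 0) l1.loaded.n rfl rfl
    (by decide) (fun i s' v h => h) ⟨by simp [e1], by simp⟩ ?_) fun s2 h2 hf2 => ?_
  · rintro i hi s2 ⟨i1, i2⟩ hx hf
    have r0 : s2.reg 0 = s.reg 0 := (hf.1 0 rfl).trans e0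
    refine (Run.store ⟨fun j hj => ?_, fun j hj => ?_⟩).mono (by simp) fun _ h _ => h
    · have : j ≠ s.reg 0 + i := by omega
      simp [r0, hx, this, i1 j hj]
    · by_cases hji : j = i
      · simp [r0, hx, hji]
      · simp [r0, hx, hji, i2 j (by omega)]
  have l2 := l1.frame hf2 rfl rfl
  have e0' : s2.reg 0 = s.reg 0 := (hf2.1 0 rfl).trans e0
  have e9 : s2.mem 9 = s1.mem 9 := hf2.2 9 rfl
  refine Run.seq (t₂ := 4) (Run.forTo (N := l.length) (T := 8) (fun i s' =>
    (∀ j < s.reg 0, s'.mem 1 j = s.mem 1 j) ∧ ∀ v : Fin x.n, s'.mem 1 (s.reg 0 + v) =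
      ind (∃ (j : ℕ) (hj : j < l.length), j < i ∧ l[j] = v ∧ X.testBit j = true)) l2.list.length rfl
    rfl (by decide) (fun i s' v h => h) ⟨h2.1, fun v => ?_⟩ ?_) fun s3 h3 hf3 => ?_
  · rw [h2.2 v v.2, eq_comm, ind_eq_zero]
    simp
  · rintro i hi s3 ⟨i1, i2⟩ hx hf
    have r0 : s3.reg 0 = s.reg 0 := (hf.1 0 rfl).trans e0'
    have l3 := l2.frame hf rfl rfl
    have r9 : s3.mem 9 i = ind (X.testBit i = true) := by rw [hf.2 9 rfl, e9, h9 i hi]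
    refine (Run.store ⟨fun j hj => ?_, fun v => ?_⟩).mono (by simp) fun _ h _ => h
    · have : j ≠ s.reg 0 + l[i] := by omega
      simp [r0, hx, l3.list.get i hi, this, i1 j hj]
    · by_cases hv : l[i] = v
      · have : (v : ℕ) = l[i] := by rw [hv]
        simp only [RamState.setMem_mem, RamExpr.eval, r0, hx, l3.list.get i hi, this, r9]
        simp only [and_self, if_true]
        congr 1
        refine propext ⟨fun hb => ⟨i, hi, by omega, hv, hb⟩, ?_⟩
        rintro ⟨j, hj, -, hjv, hb⟩
        have : i = j := (h.list.nodup.getElem_inj_iff).1 (hv.trans hjv.symm)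
        rwa [this]
      · have : (v : ℕ) ≠ l[i] := fun he => hv (Fin.ext he.symm)
        simp only [RamState.setMem_mem, RamExpr.eval, r0, hx, l3.list.get i hi, true_and]
        rw [if_neg (by omega), i2]
        congr 1
        refine propext ⟨?_, ?_⟩
        · rintro ⟨j, hj, h1, h2⟩
          exact ⟨j, hj, by omega, h2⟩
        · rintro ⟨j, hj, h1, h2⟩
          refine ⟨j, hj, ?_, h2⟩
          rcases Nat.lt_succ_iff_lt_or_eq.1 h1 with h1 | rfl
          · exact h1
          · exact absurd h2.1 hv
  · have e0'' : s3.reg 0 = s.reg 0 := (hf3.1 0 rfl).trans e0'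
    have l3 := l2.frame hf3 rfl rfl
    refine (Run.assign (Q := fun s' => outputOf s' = outputOf s ++ encodeSet (maskSet l X))
      (outputOf_append ?_ h3.1 fun v => ?_)).mono (by simp) fun _ h _ => h
    · simp [e0'', l3.loaded.n]
    · refine (h3.2 v).trans (congrArg ind (propext ⟨?_, fun hv => ?_⟩))
      · rintro ⟨j, hj, -, rfl, hb⟩
        exact (getElem_mem_maskSet h.list.nodup hj).2 hb
      · obtain ⟨j, hj, rfl⟩ := List.getElem_of_mem (mem_of_mem_maskSet hv)
        exact ⟨j, hj, hj, rfl, (getElem_mem_maskSet h.list.nodup hj).1 hv⟩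

/-- After `i` rounds the walk built so far ends at the current mask, whose distance to the target is
`ℓ - i`. The output lags by one set, as `L` is the support without its last node; the final write
closes the gap. -/
theorem run_writePath (h : MaskData x s W l) {X ℓ : ℕ} (h22 : s.reg 22 = X) (h30 : s.reg 30 = ℓ)
    (hout : outputOf s = [1]) (hX : X < 2 ^ l.length)
    (hs : maskSet l X = x.Ds) (ht : maskSet l T = x.Dt)
    (hdist : ∀ X < 2 ^ l.length,
      DistUpTo (MStep x.G x.k W l) T (2 ^ l.length) X (s.mem 11 X))
    (hpar : ParentsHold (MStep x.G x.k W l) T (2 ^ l.length) s)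
    (hd : HasDist (MStep x.G x.k W l) T X ℓ) :
    Run writePathProg s ((ℓ + 1) * (100 * (l.length + x.n + 1))) fun s' =>
      ∃ w : (reconfGraph x.G x.k).Walk x.source x.target, w.length = ℓ ∧
        outputOf s' = 1 :: w.support.flatMap fun D => encodeSet D.1 := by
  have hR : ∀ X Y, MStep x.G x.k W l X Y → X < 2 ^ l.length ∧ Y < 2 ^ l.length :=
    fun X Y h => ⟨h.1, h.2.1⟩
  unfold writePathProg
  refine (Run.seq (Run.forTo (N := ℓ) (T := l.length * 60 + x.n * 20 + 34) (fun i s' =>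
    ∃ Y < 2 ^ l.length, s'.reg 22 = Y ∧ HasDist (MStep x.G x.k W l) T Y (ℓ - i) ∧
    ∃ (v : DSNode x.G x.k) (w : (reconfGraph x.G x.k).Walk x.source v),
      v.1 = maskSet l Y ∧ w.length = i ∧ ∃ L, w.support = L ++ [v] ∧
      outputOf s' = 1 :: L.flatMap fun D => encodeSet D.1) h30 rfl rfl (by decide)
    (fun i s' v h => h) ?_ ?_) fun s1 h1 hf1 => ?_).mono (t₁ := ℓ * (l.length * 60 + x.n * 20 + 34 + 8) + 6 + (l.length * 60 + x.n * 20 + 30)) ?_ fun _ h _ => h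
  · exact ⟨X, hX, h22, hd, x.source, SimpleGraph.Walk.nil, hs.symm, rfl, [], rfl, by simpa using hout⟩
  · rintro i hi s1 ⟨Y, hY, h22, hd, v, w, hv, hw, L, hL, ho⟩ - hf
    have l1 := h.frame hf rfl rfl
    obtain ⟨r, hr⟩ : ∃ r, ℓ - i = r + 1 := ⟨ℓ - i - 1, by omega⟩
    have hr' : ℓ - (i + 1) = r := by omega
    rw [hr] at hd
    have hdY := ((hdist Y hY).eq_iff (hd.lt hR hY).le).2 hd
    obtain ⟨hstep, hd'⟩ := hpar Y hY r hdY
    refine (Run.seq (t₂ := 4) (l1.run_write hY h22) fun s2 ho2 hf2 =>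
      (Run.assign ?_).mono (by simp) fun _ h _ => h).mono (by omega)
      fun _ h _ => h
    have e22 : s2.reg 22 = Y := (hf2.1 22 rfl).trans h22
    have e12 : s2.mem 12 = s.mem 12 := (hf2.2 12 rfl).trans (hf.2 12 rfl)
    have hadj : (reconfGraph x.G x.k).Adj v ⟨maskSet l (s.mem 12 Y), hstep.2.2.2.1.2⟩ := by
      rw [reconfGraph_adj_iff, hv]
      exact hstep.2.2.2.2
    refine ⟨s.mem 12 Y, hstep.2.1, by simp [e22, e12], by rwa [hr'], _, w.concat hadj, rfl,
      by simp [hw], L ++ [v], by simp [SimpleGraph.Walk.support_concat, hL], ?_⟩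
    change outputOf s2 = _
    rw [ho2, ho, List.flatMap_append, ← hv]
    simp
  · obtain ⟨Y, hY, h22, hd, v, w, hv, hw, L, hL, ho⟩ := h1
    rw [Nat.sub_self] at hd
    have hYT : Y = T := hd.1
    have hvt : v = x.target := Subtype.ext (by rw [hv, hYT, ht]; rfl)
    subst hvt
    refine ((h.frame hf1 rfl rfl).run_write hY h22).mono le_rfl fun s2 ho2 _ => ⟨w, hw, ?_⟩
    rw [ho2, ho, hL, List.flatMap_append, ← hv]
    simp
  · rw [Nat.succ_mul]
    have : ℓ * (l.length * 60 + x.n * 20 + 34 + 8) ≤ ℓ * (100 * (l.length + x.n + 1)) :=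
      Nat.mul_le_mul_left _ (by omega)
    omega

/-- The mark of the source is 0 if there is no sequence and otherwise one more than the distance.
Minimality transfers to `G` because `hreach` matches walks length by length. -/
theorem run_out (h : MaskData x s W l) {X : ℕ} (h28 : s.reg 28 = X) (hX : X < 2 ^ l.length)
    (hs : maskSet l X = x.Ds) (ht : maskSet l T = x.Dt)
    (hdist : ∀ X < 2 ^ l.length,
      DistUpTo (MStep x.G x.k W l) T (2 ^ l.length) X (s.mem 11 X))
    (hpar : ParentsHold (MStep x.G x.k W l) T (2 ^ l.length) s)
    (hreach : ∀ ℓ, Reach (reconfGraph x.G x.k).Adj ℓ x.source x.target ↔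
      Reach (MStep x.G x.k W l) ℓ X T) :
    Run outProg s (2 ^ l.length * (100 * (l.length + x.n + 1)) + 100) fun s' =>
      x.IsShortestSolution (outputOf s') := by
  have hR : ∀ X Y, MStep x.G x.k W l X Y → X < 2 ^ l.length ∧ Y < 2 ^ l.length :=
    fun X Y h => ⟨h.1, h.2.1⟩
  have hyes : x.IsYes ↔ ∃ ℓ, Reach (MStep x.G x.k W l) ℓ X T := by
    refine ⟨fun ⟨w⟩ => ⟨w.length, (hreach _).1 (exists_walk_iff_reach.1 ⟨w, rfl⟩)⟩, ?_⟩
    rintro ⟨ℓ, hr⟩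
    obtain ⟨w, -⟩ := exists_walk_iff_reach.2 ((hreach _).2 hr)
    exact ⟨w⟩
  have hs0 : MaskData x (s.setReg 0 1) W l := by
    obtain ⟨⟨n, k, d, k1, adj, source, target⟩, list, pow, count⟩ := h
    exact ⟨⟨n, k, d, k1, adj, source, target⟩, list.frame rfl rfl, pow, count⟩
  unfold outProg
  refine (Run.assign_seq <| Run.ite (t := 2 ^ l.length * (100 * (l.length + x.n + 1)) + 50)
    (fun hc => ?_) fun hc => ?_).mono (by simp; omega) fun _ h _ => h
  swap
  · refine (Run.store (Or.inl ⟨?_, ?_⟩)).mono (by simp) fun _ h _ => h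
    · rw [hyes, not_exists]
      refine ((hdist X hX).reach_iff hR hX).1 ?_
      simpa [h28] using hc
    · simp [outputOf]
  obtain ⟨ℓ, hℓ, hd⟩ : ∃ ℓ, s.mem 11 X = ℓ + 1 ∧ HasDist (MStep x.G x.k W l) T X ℓ := by
    rcases hdist X hX with ⟨h0, -⟩ | ⟨ℓ, -, h1, h2⟩
    · exact absurd h0 (by simpa [h28] using hc)
    · exact ⟨ℓ, h1, h2⟩
  have hlt := hd.lt hR hX
  refine (Run.seq (t₁ := 15) (t₂ := (ℓ + 1) * (100 * (l.length + x.n + 1)))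
    (Q' := fun s' => s'.reg 22 = X ∧ s'.reg 30 = ℓ ∧ outputOf s' = [1])
    ((Run.store_seq <| Run.assign_seq <| Run.assign ?_).mono (by simp) fun _ h _ => h)
    fun s1 ⟨h22, h30, ho⟩ hf1 => ?_).mono ?_ fun _ h _ => h
  · simp [h28, hℓ, outputOf]
  · have l0 := (hs0.frame hf1 rfl rfl)
    have e11 : s1.mem 11 = s.mem 11 := hf1.2 11 rfl
    have e12 : s1.mem 12 = s.mem 12 := hf1.2 12 rfl
    refine (l0.run_writePath h22 h30 ho hX hs ht (by rw [e11]; exact hdist)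
      (fun X hX ℓ hℓ => ?_) hd).mono le_rfl ?_
    · rw [e12]
      exact hpar X hX ℓ (by rwa [e11] at hℓ)
    · rintro s2 ⟨w, hw, ho2⟩ -
      refine Or.inr ⟨w, fun w' => ?_, ho2⟩
      rw [hw]
      exact not_lt.1 fun hlt => hd.2 _ hlt ((hreach _).1 (exists_walk_iff_reach.1 ⟨w', rfl⟩))
  · have := Nat.mul_le_mul_right (100 * (l.length + x.n + 1)) (show ℓ + 1 ≤ _ from hlt)
    omega

end MaskData

end Output

/-! ### The complete algorithm and its running time. -/

section Solve

open Finset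
open scoped Classical

open RamExpr RamProg

theorem ListHolds.length_eq_card {n : ℕ} {s : RamState} {l : List (Fin n)} {W : Finset (Fin n)}
    (h : ListHolds s l W) : l.length = W.card := by
  rw [← List.toFinset_card_of_nodup h.nodup]
  congr 1
  ext v
  rw [List.mem_toFinset, h.mem_iff]

theorem ListHolds.reach_mStep_iff {n : ℕ} {s : RamState} {l : List (Fin n)} {W : Finset (Fin n)}
    (h : ListHolds s l W) {G : SimpleGraph (Fin n)} {k ℓ X T : ℕ} (hX : X < 2 ^ l.length)
    (hT : T < 2 ^ l.length) :
    Reach (RStep G k W) ℓ (maskSet l X) (maskSet l T) ↔ Reach (MStep G k W l) ℓ X T := by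
  refine ⟨fun hr => ?_, Reach.map fun X Y h => h.2.2⟩
  have key : ∀ ℓ X, X < 2 ^ l.length → Reach (RStep G k W) ℓ (maskSet l X) (maskSet l T) →
      Reach (MStep G k W l) ℓ X T := by
    intro ℓ
    induction ℓ with
    | zero => exact fun X hX hr => maskSet_injective h.nodup hX hT hr
    | succ ℓ ih =>
      rintro X hX ⟨D, hD, hr⟩
      obtain ⟨Y, hY, rfl⟩ := exists_maskSet h.nodup fun v hv => (h.mem_iff v).2 (hD.2.1.1 hv)
      exact ⟨Y, ⟨hX, hY, hD⟩, ih Y hY hr⟩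
  exact key ℓ X hX hr

/-- Finds a shortest reconfiguration sequence by searching a kernel. -/
def solveProg : RamProg :=
  loadProg ;; coreProg ;; keepProg ;; powProg ;; maskProg 28 13 ;; maskProg 29 14 ;; nodesProg ;;
  searchProg ;; outProg

/-- A bound for the size of the core. -/
def coreBound (s : ℕ) : ℕ := (s + 1) ^ s * (2 * s)

/-- A bound for the size of the kernel. -/
def kernelBound (s : ℕ) : ℕ := coreBound s + 2 * s + s * coreBound s ^ s

/-- The dependence of the running time on the parameter. -/
def timeBound (s : ℕ) : ℕ := 1100 * (2 ^ kernelBound s * 2 ^ kernelBound s * (kernelBound s + 1) * (s + 1))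

namespace BicliqueFreeDSR

variable (x : BicliqueFreeDSR)

/-- All quantities are monotone, so `k` and `d` may be replaced by their sum, which removes their
separate roles from the time bound. -/
theorem card_le_kernelBound {C W : Finset (Fin x.n)}
    (hC : C.card + 1 ≤ (x.k + 1) ^ x.d * (2 * x.d))
    (hW : HasSmallFibers x.G C (x.Ds ∪ x.Dt) (x.k + 1) W) : W.card ≤ kernelBound x.param := by
  have hk := x.k_pos
  have hd := x.d_pos
  have hs : x.param = x.k + x.d := rfl
  have h1 : (x.k + 1) ^ x.d ≤ (x.param + 1) ^ x.param :=
    (Nat.pow_le_pow_left (by omega) _).trans (Nat.pow_le_pow_right (by omega) (by omega))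
  have h2 : (x.k + 1) ^ x.d * (2 * x.d) ≤ coreBound x.param := Nat.mul_le_mul h1 (by omega)
  have h3 : 1 ≤ (x.param + 1) ^ x.param := Nat.one_le_pow _ _ (by omega)
  have h4 : 2 ≤ coreBound x.param := by
    have := Nat.mul_le_mul h3 (show 2 ≤ 2 * x.param by omega)
    simpa [coreBound] using this
  refine (card_kernel_le x.d_pos x.free hW (by omega) x.card_union_le_two_mul h4).trans ?_
  have h5 : coreBound x.param ^ x.d ≤ coreBound x.param ^ x.param :=
    Nat.pow_le_pow_right (by omega) (by omega)
  have h6 := Nat.mul_le_mul_left x.param h5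
  unfold kernelBound
  rw [← hs]
  omega

theorem time_le {m : ℕ} (hm : m ≤ kernelBound x.param) {t : ℕ}
    (ht : t ≤ 70 * x.n + 70 + 300 * (x.d + 1) * (x.n + 1) ^ 3 + 150 * (x.n + 1) ^ 3 +
      3 * (m * 20 + 10) + (2 ^ m * (100 * (x.n + 1) * (m + 1)) + 6) +
      (2 ^ m * (2 ^ m * (100 * (m + 1) + 8) + 14) + 10) +
      (2 ^ m * (100 * (m + x.n + 1)) + 100)) :
    t ≤ timeBound x.param * x.encode.length ^ 3 := by
  have hlen : x.n + 1 ≤ x.encode.length := by rw [x.length_encode]; nlinarith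
  have hd : x.d + 1 ≤ x.param + 1 := Nat.succ_le_succ (Nat.le_add_left _ _)
  have hp : 2 ^ m ≤ 2 ^ kernelBound x.param := Nat.pow_le_pow_right (by norm_num) hm
  have hp1 : 1 ≤ 2 ^ m := Nat.one_le_two_pow
  have h1 : 1100 * (2 ^ m * 2 ^ m * (m + 1) * (x.d + 1)) * (x.n + 1) ^ 3 ≤
      timeBound x.param * x.encode.length ^ 3 := by
    unfold timeBound
    gcongr
  refine ht.trans (le_trans ?_ h1)
  generalize 2 ^ m = P at *
  obtain ⟨P, rfl⟩ := Nat.exists_eq_add_of_le hp1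
  generalize x.n = n
  generalize x.d = d
  ring_nf
  omega

/-- The search uses dominating sets of `G` inside `W`, so neither `G[W]` nor the special cases of
`exists_isReduction` are needed: the kernel preserves lengths for all `k` and `d`. -/
theorem run_solve : Run solveProg (initState x.encode) (timeBound x.param * x.encode.length ^ 3)
    fun s => x.IsShortestSolution (outputOf s) := by
  have hrun : ∃ m ≤ kernelBound x.param, Run solveProg (initState x.encode)
      (70 * x.n + 70 + (300 * (x.d + 1) * (x.n + 1) ^ 3 + (150 * (x.n + 1) ^ 3 +
      ((m * 20 + 10) + ((m * 20 + 10) + ((m * 20 + 10) +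
      ((2 ^ m * (100 * (x.n + 1) * (m + 1)) + 6) +
      ((2 ^ m * (2 ^ m * (100 * (m + 1) + 8) + 14) + 10) +
      (2 ^ m * (100 * (m + x.n + 1)) + 100)))))))))
      fun s => x.IsShortestSolution (outputOf s) := by
    obtain ⟨t1, s1, r1, ht1, l1⟩ := run_load x
    obtain ⟨t2, s2, r2, ht2, l2, C, hC, hcore, hcard⟩ := run_core l1
    obtain ⟨t3, s3, r3, ht3, l3, W, l, hl, hW, hfib⟩ := run_keep l2 hC
    obtain ⟨t4, s4, r4, ht4, l4⟩ := MaskData.run_pow l3 hl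
    have hsW : x.Ds ⊆ W := subset_union_left.trans hW.2.1
    have htW : x.Dt ⊆ W := subset_union_right.trans hW.2.1
    obtain ⟨t5, s5, r5, ht5, hX, hXs⟩ := l4.run_mask (r := 28) (by norm_num) l4.loaded.source hsW
    have l5 := l4.frame r5.frame rfl rfl
    obtain ⟨t6, s6, r6, ht6, hT, hTt⟩ := l5.run_mask (r := 29) (by norm_num) l5.loaded.target htW
    have l6 := l5.frame r6.frame rfl rfl
    obtain ⟨t7, s7, r7, ht7, h10⟩ := l6.run_nodes
    have l7 := l6.frame r7.frame rfl rfl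
    have e28 : s7.reg 28 = s5.reg 28 := (r7.frame.1 28 rfl).trans (r6.frame.1 28 rfl)
    have e29 : s7.reg 29 = s6.reg 29 := r7.frame.1 29 rfl
    have hTn : IsNode x.G x.k W (maskSet l (s6.reg 29)) := by
      rw [hTt]
      exact ⟨htW, x.target.2⟩
    -- The search takes 0 for unmarked; no earlier phase writes array `11`, so it is still zero from
    -- the start.
    have e11 : s7.mem 11 = (initState x.encode).mem 11 := by
      rw [r7.frame.2 11 rfl, r6.frame.2 11 rfl, r5.frame.2 11 rfl, r4.frame.2 11 rfl,
        r3.frame.2 11 rfl, r2.frame.2 11 rfl, r1.frame.2 11 rfl]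
    obtain ⟨t8, s8, r8, ht8, hdist, hpar⟩ := l7.run_search hTn h10 e29 fun X => by
      rw [e11]
      simp [initState]
    have l8 := l7.frame r8.frame rfl rfl
    have hreach : ∀ ℓ, Reach (reconfGraph x.G x.k).Adj ℓ x.source x.target ↔
        Reach (MStep x.G x.k W l) ℓ (s5.reg 28) (s6.reg 29) := fun ℓ => by
      rw [reach_reconfGraph_iff, ← hl.reach_mStep_iff hX hT, hXs, hTt]
      exact reach_kernel_iff hcore hW subset_union_left subset_union_right
    obtain ⟨t9, s9, r9, ht9, hsol⟩ := l8.run_out ((r8.frame.1 28 rfl).trans e28) hX hXs hTt hdist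
      hpar hreach
    refine ⟨l.length, hl.length_eq_card.trans_le (x.card_le_kernelBound hcard hfib), _, s9,
      r1.seq (r2.seq (r3.seq (r4.seq (r5.seq (r6.seq (r7.seq (r8.seq r9))))))), ?_, hsol⟩
    omega
  obtain ⟨m, hm, h⟩ := hrun
  exact h.mono (x.time_le hm (by omega)) fun _ h _ => h

theorem fptSolvable :
    FPTSolvable BicliqueFreeDSR.encode BicliqueFreeDSR.param
      BicliqueFreeDSR.IsShortestSolution :=
  ⟨solveProg, timeBound, 3, fun x => by
    obtain ⟨t, s, h, ht, hs⟩ := x.run_solve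
    exact ⟨t, outputOf s, ⟨s, h, rfl⟩, ht, hs⟩⟩

theorem IsShortestSolution.head {x : BicliqueFreeDSR} {s : RamState}
    (h : x.IsShortestSolution (outputOf s)) :
    (x.IsYes ∧ s.mem 1 0 = 1) ∨ (¬ x.IsYes ∧ s.mem 1 0 = 0) := by
  have hhead : ∀ a L, outputOf s = a :: L → s.mem 1 0 = a := by
    intro a L h
    unfold outputOf at h
    cases hr : s.reg 0 with
    | zero => simp [hr] at h
    | succ r =>
      rw [hr, List.range_succ_eq_map, List.map_cons] at h
      exact (List.cons.inj h).1
  rcases h with ⟨hno, h⟩ | ⟨w, -, h⟩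
  · exact Or.inr ⟨hno, hhead _ _ h⟩
  · exact Or.inl ⟨⟨w⟩, hhead _ _ h⟩

/-- The first cell of a shortest solution already answers the question, so the output is cut to
length 1. The two extra steps are absorbed by adding 2 to `timeBound`, as the input is not empty. -/
theorem fptDecidable :
    FPTDecidable BicliqueFreeDSR.encode BicliqueFreeDSR.param (fun x => x.IsYes) := by
  refine ⟨solveProg ;; assign 0 (const 1), fun s => timeBound s + 2, 3, fun x => ?_⟩
  obtain ⟨t, s, h, ht, hs⟩ := x.run_solve
  refine ⟨t + 2, [s.mem 1 0], ⟨_, h.seq (Exec.assign s 0 (const 1)), ?_⟩, ?_, ?_⟩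
  · simp [outputOf]
  · have : 1 ≤ x.encode.length ^ 3 := Nat.one_le_pow _ _ (by rw [x.length_encode]; omega)
    rw [Nat.add_mul]
    omega
  · exact hs.head.imp (fun h => ⟨h.1, by rw [h.2]⟩) fun h => ⟨h.1, by rw [h.2]⟩

end BicliqueFreeDSR

end Solve

theorem mainTheorem3 :
    FPTDecidable BicliqueFreeDSR.encode BicliqueFreeDSR.param (fun x => x.IsYes) ∧
    FPTSolvable BicliqueFreeDSR.encode BicliqueFreeDSR.param BicliqueFreeDSR.IsShortestSolution ∧
    ∀ x : BicliqueFreeDSR, ∃ W : Finset (Fin x.n), x.IsReduction W ∧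
      W.card ≤ x.d * x.k ^ x.d + 2 * x.k
        + 2 * x.d * (3 * (x.d * x.k ^ x.d)) ^ (2 * x.d) :=
  ⟨BicliqueFreeDSR.fptDecidable, BicliqueFreeDSR.fptSolvable, fun x => x.exists_isReduction⟩
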